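/- Let $\mathcal A$ be a finite alphabet and $\mathcal A^*=\mathcal A\cup\{G\}$, where $G$ is a gap symbol. A symmetric scoring function is a map $R:\mathcal A^*\times\mathcal A^*\to\mathbb R$ with $R(\alpha,\beta)=R(\beta,\alpha)$ for all $\alpha,\beta$ and $R(G,G)=0$; its Frobenius norm is $|R|_2=\bigl(\sum_{\alpha,\beta\in\mathcal A^*}R(\alpha,\beta)^2\bigr)^{1/2}$. An alignment $\nu$ of two words $x=x_1\dots x_n$, $y=y_1\dots y_n$ over $\mathcal A$ consists of some $k\in\{0,\dots,n\}$ and of indices $1\le i_1<\dots<i_k\le n$ and $1\le j_1<\dots<j_k\le n$; $\Lambda_n$ is the set of all of them. The total score is $$R_\nu(x,y)=\sum_{\ell=1}^kR(x_{i_\ell},y_{j_\ell})+\sum_{i\notin\{i_1,\dots,i_k\}}R(x_i,G)+\sum_{j\notin\{j_1,\dots,j_k\}}R(G,y_j).$$ For symmetric scoring functions $S,T$ let $\mathrm{SET}^n_{S,T}(x,y)\subset\mathbb R^2$ be the closed convex hull of $\{(S_\nu(x,y)/n,\,T_\nu(x,y)/n):\nu\in\Lambda_n\}$. Let $X_1,X_2,\dots$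 and $Y_1,Y_2,\dots$ be independent random letters of $\mathcal A$, all with the same distribution, and let $\mathrm{SET}_{S,T}$ be the deterministic nonempty compact convex set to which $\mathrm{SET}^n_{S,T}(X_1\dots X_n,Y_1\dots Y_n)$ converges almost surely in the Hausdorff distance as $n\to\infty$. For a closed convex set $K\subset\mathbb R^2$ and a point $p\in\partial K$, the curvature $\kappa(\partial K,p)\in[0,\infty]$ is defined as follows. If $p$ is a vertex of $\partial K$, that is, if the normal cone of $K$ at $p$ has nonempty interior, then $\kappa(\partial K,p)=\infty$. Otherwise let $c$ be a parametrization of $\partial K$ by arc length near $p$ with $c(0)=p$; then $\kappa(\partial K,p)=\|\ddot c(0)\|_2$ if $\ddot c(0)$ exists, and $\kappa(\partial K,p)=\infty$ if $\|(\dot c(t)-\dot c(0))/t\|_2\to\infty$ as $t\to0$ (where $\ddot c(0)$ and this limit are taken along the parameters $t$ at which $\dot c(t)$ exists). **Theorem.** Let $S$ and $T$ be independent and uniformly distributed on the unit sphere of the Frobenius norm in the space of symmetric scoring functions. Then: 1. Almost surely, the first coordinate $x$ has a unique maximiser over $\mathrm{SET}^n_{S,T}(u,v)$ for all $n$ and all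 words $u,v$ of length $n$, and it has a unique maximiser $(x_0,y_0)$ over $\mathrm{SET}_{S,T}$. 2. Almost surely, the curvature $\kappa(\partial\,\mathrm{SET}_{S,T},(x_0,y_0))\in[0,\infty]$ exists, and for every real number $k>0$, $$\mathbb P\bigl[\kappa(\partial\,\mathrm{SET}_{S,T},(x_0,y_0))<k\bigr]\le\frac{4k}{\pi}.$$ -/

import Mathlib

open MeasureTheory ProbabilityTheory Filter Set
open scoped Topology ENNReal

noncomputable section

/-! ### Scoring functions

The alphabet is `A`; the augmented alphabet is `Option A`, with `none` as the gap symbol. -/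

/-- The space of symmetric scoring functions `R : A* × A* → ℝ` with `R(G, G) = 0`. It inherits from
`EuclideanSpace` the Frobenius norm `√(∑ a b, R(a, b)²)`, where `(a, b)` and `(b, a)` are both
counted. -/
def symScoringSubmodule (A : Type*) [Fintype A] :
    Submodule ℝ (EuclideanSpace ℝ (Option A × Option A)) where
  carrier := {R | (∀ a b, R (a, b) = R (b, a)) ∧ R (none, none) = 0}
  add_mem' := by
    rintro R R' ⟨h, h0⟩ ⟨h', h0'⟩
    exact ⟨fun a b => by simp [h a b, h' a b], by simp [h0, h0']⟩
  zero_mem' := by simp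
  smul_mem' := by
    rintro c R ⟨h, h0⟩
    exact ⟨fun a b => by simp [h a b], by simp [h0]⟩

/-- Symmetric scoring functions, with the Frobenius norm. -/
abbrev SymScoring (A : Type*) [Fintype A] : Type _ := ↥(symScoringSubmodule A)

/-- The value `R(a, b)`. -/
def SymScoring.score {A : Type*} [Fintype A] (R : SymScoring A) (a b : Option A) : ℝ := R.1 (a, b)

/-- The unit sphere of the Frobenius norm. -/
abbrev FrobeniusSphere (A : Type*) [Fintype A] : Type _ := ↥(Metric.sphere (0 : SymScoring A) 1)

/-- The uniform distribution on the Frobenius unit sphere: the normalised surface measure (which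
does not depend on the normalisation of the Haar measure that induces it). -/
def frobeniusUniform (A : Type*) [Fintype A] : Measure (FrobeniusSphere A) :=
  ((Measure.addHaar : Measure (SymScoring A)).toSphere univ)⁻¹ •
    (Measure.addHaar : Measure (SymScoring A)).toSphere

/-! ### Alignments with gaps -/

/-- An alignment of two words of length `n`: for some `k ≤ n`, two strictly increasing sequences
`i_1 < ⋯ < i_k` and `j_1 < ⋯ < j_k` of positions (positions being numbered from `0`). -/
abbrev GapAlignment (n : ℕ) : Type := Σ k : Fin (n + 1), (Fin k ↪o Fin n) × (Fin k ↪o Fin n)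

/-- The total score `R_ν(x, y)`: the aligned pairs, plus all the remaining letters of `x` and of
`y`, each aligned with a gap. -/
def totalScore {A : Type*} [Fintype A] {n : ℕ} (R : SymScoring A) (ν : GapAlignment n)
    (x y : Fin n → A) : ℝ :=
  ∑ l, R.score (some (x (ν.2.1 l))) (some (y (ν.2.2 l)))
    + ∑ i ∈ (Finset.univ.map ν.2.1.toEmbedding)ᶜ, R.score (some (x i)) none
    + ∑ j ∈ (Finset.univ.map ν.2.2.toEmbedding)ᶜ, R.score none (some (y j))

/-- The Euclidean plane. -/
abbrev Plane : Type := EuclideanSpace ℝ (Fin 2)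

/-- The set `SCORES^n_{S,T}` of the rescaled pairs of scores, for the words `x` and `y`. -/
def scores {A : Type*} [Fintype A] {n : ℕ} (S T : SymScoring A) (x y : Fin n → A) : Set Plane :=
  range fun ν : GapAlignment n => !₂[totalScore S ν x y / n, totalScore T ν x y / n]

/-- The set `SET^n_{S,T}`, the closed convex hull of `SCORES^n_{S,T}`, for the words `x` and `y`. -/
def scoreSet {A : Type*} [Fintype A] {n : ℕ} (S T : SymScoring A) (x y : Fin n → A) : Set Plane :=
  closure (convexHull ℝ (scores S T x y))

/-- `K` is a (deterministic) nonempty compact convex set to which `SET^n_{S,T}`, formed from the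
first `n` letters of the random sequences `X` and `Y`, converges almost surely in the Hausdorff
distance. -/
structure IsLimitSet {A Ω : Type*} [Fintype A] [MeasurableSpace Ω] (P : Measure Ω)
    (X Y : ℕ → Ω → A) (S T : SymScoring A) (K : Set Plane) : Prop where
  nonempty : K.Nonempty
  isCompact : IsCompact K
  convex : Convex ℝ K
  tendsto : ∀ᵐ ω ∂P, Tendsto
    (fun n : ℕ => Metric.hausdorffDist
      (scoreSet S T (fun i : Fin n => X i ω) (fun j : Fin n => Y j ω)) K) atTop (𝓝 0)

/-- The set `SET_{S,T}`: the almost sure Hausdorff limit of `SET^n_{S,T}`. (The limit is unique, so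
that this is a union of one set; it would be empty if there were no limit.) -/
def limitSet {A Ω : Type*} [Fintype A] [MeasurableSpace Ω] (P : Measure Ω)
    (X Y : ℕ → Ω → A) (S T : SymScoring A) : Set Plane :=
  ⋃₀ {K | IsLimitSet P X Y S T K}

/-- `p` is a maximiser of the first coordinate over `K`. -/
def IsMaximiser (K : Set Plane) (p : Plane) : Prop :=
  p ∈ K ∧ ∀ q ∈ K, q 0 ≤ p 0

/-! ### Curvature of the boundary of a closed convex set in the plane -/

/-- The (outer) normal cone of `K` at `p`. -/
def normalCone (K : Set Plane) (p : Plane) : Set Plane :=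
  {u | ∀ q ∈ K, inner ℝ u (q - p) ≤ 0}

/-- `p` is a vertex of `∂K`: the normal cone there has nonempty interior. -/
def IsVertex (K : Set Plane) (p : Plane) : Prop :=
  p ∈ frontier K ∧ (interior (normalCone K p)).Nonempty

/-- `c` parametrises `∂K` by arc length on a neighbourhood of `0`, with `c 0 = p`: it is a bijection
from some interval `(-ε, ε)` to a neighbourhood of `p` in `∂K`, and the part of the curve between
the parameters `s ≤ t` has length `t - s`. -/
def IsArcLengthParam (K : Set Plane) (p : Plane) (c : ℝ → Plane) : Prop :=
  c 0 = p ∧ ∃ ε > 0, InjOn c (Ioo (-ε) ε) ∧ MapsTo c (Ioo (-ε) ε) (frontier K) ∧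
    c '' Ioo (-ε) ε ∈ 𝓝[frontier K] p ∧ HasUnitSpeedOn c (Ioo (-ε) ε)

/-- `∂K` has curvature `κ ∈ [0, ∞]` at `p`. The curvature is `∞` at a vertex. Otherwise it is
`‖c̈(0)‖` for a parametrisation `c` of `∂K` by arc length with `c(0) = p`, where `c̈(0)` is the
derivative at `0` of the map `t ↦ ċ(t)`, taken along the set of parameters where `c` is
differentiable (all but countably many; it is the ordinary second derivative if `c` is
differentiable near `0`); and it is `∞` if the difference quotients of `ċ` at `0` tend to `∞` in
norm. -/
def HasCurvatureAt (K : Set Plane) (p : Plane) (κ : ℝ≥0∞) : Prop :=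
  (IsVertex K p ∧ κ = ∞) ∨
  ∃ c : ℝ → Plane, IsArcLengthParam K p c ∧ DifferentiableAt ℝ c 0 ∧
    ((∃ w : Plane, HasDerivWithinAt (deriv c) w {t | DifferentiableAt ℝ c t} 0 ∧ κ = ‖w‖ₑ) ∨
     (Tendsto (fun t : ℝ => ‖t⁻¹ • (deriv c t - deriv c 0)‖)
        (𝓝[{t | DifferentiableAt ℝ c t} \ {0}] 0) atTop ∧ κ = ∞))

end

/-!
# Curvature of the asymptotic score set at its rightmost point

Write `h R` for the almost sure limit of the optimal alignment score per letter under the scoring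
function `R`. It exists because the optimal score is superadditive under concatenation and changes
boundedly when one letter changes, so that its mean grows linearly and its variance at most linearly
(`exists_ae_tendsto_div`). As a limit of maxima of linear functions of `R`, `h` is sublinear
(`IsSupportFun`), and the limit set is the convex body with support function
`u ↦ h (u₀ S + u₁ T)` (`IsScoreRate.limitSet_eq`). Its support function in the direction `(1, t)` is
therefore `f t = h (S + t T)`, and everything about its rightmost point is encoded in the behaviour
of the convex function `f` at `0`.

*Uniqueness and existence of the curvature.* A convex function on the line has a second derivative
almost everywhere, in the sense that its subgradients have a first order expansion. By Fubini's
theorem and homogeneity, almost every pair `(S, T)` on the sphere is such that `0` is a good point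
of `f` (`IsSupportFun.ae_toSphere_exists_hasSubgradientDeriv`). At a good point, the maximiser is
unique, the boundary is locally a graph over the second coordinate, and the arc length
parametrisation of this graph has curvature `1 / f'' 0` (`existsUnique_isMaximiser`,
`exists_hasCurvatureAt`).

*The bound.* Curvature less than `k` forces `s ^ 2 / k ≤ f s + f (-s) - 2 f 0` for small `s`
(`eventually_secondDifference_ge`), so by Markov's inequality it suffices to bound the mean of
`f'' 0`. Averaging over pairs `(S, T)` in the unit ball of the product, the rotation that takes
`(1, τ)` to the first coordinate direction shows that `h (S + τ T)` has `√(1 + τ ^ 2)` times the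
mean of `h S`. Hence the second derivative has the same mean as `h S`, that is, as the half width
`(h S + h (-S)) / 2` (`IsSupportFun.integral_secondDifference_le`). Polar coordinates carry the
estimate over to the sphere (`IsSupportFun.toSphere_prod_le`). Two alignments of words of length `n`
differ in score by at most `√6 ‖R‖ n` (`totalScore_sub_le`), which gives probability at most
`(√6 / 2) k ≤ 4 k / π`.
-/

/-! ### Support functions and the convex bodies they determine -/

/-- A support function on a normed space: a sublinear function that is bounded on the unit ball. In
finite dimension the last condition is automatic; it is kept as a field because it yields the
Lipschitz constant. -/
structure IsSupportFun {E : Type*} [NormedAddCommGroup E] [NormedSpace ℝ E] (g : E → ℝ) : Prop where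
  smul : ∀ c : ℝ, 0 ≤ c → ∀ x, g (c • x) = c * g x
  add_le : ∀ x y, g (x + y) ≤ g x + g y
  bound : ∃ C : ℝ, ∀ x, g x ≤ C * ‖x‖

namespace IsSupportFun

section Normed

variable {E : Type*} [NormedAddCommGroup E] [NormedSpace ℝ E] {g : E → ℝ}

lemma map_zero (hg : IsSupportFun g) : g 0 = 0 := by
  simpa using hg.smul 0 le_rfl 0

lemma abs_sub_le (hg : IsSupportFun g) {C : ℝ} (hC : ∀ x, g x ≤ C * ‖x‖) (x y : E) :
    |g x - g y| ≤ C * ‖x - y‖ := by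
  have h1 := hg.add_le (x - y) y
  have h2 := hg.add_le (y - x) x
  have h3 := hC (x - y)
  have h4 := hC (y - x)
  rw [sub_add_cancel] at h1 h2
  rw [norm_sub_rev y x] at h4
  rw [abs_le]
  constructor <;> linarith

lemma continuous (hg : IsSupportFun g) : Continuous g := by
  obtain ⟨C, hC⟩ := hg.bound
  have : LipschitzWith (Real.toNNReal C) g := by
    refine LipschitzWith.of_dist_le_mul fun x y => ?_
    rw [Real.dist_eq, dist_eq_norm]
    refine (hg.abs_sub_le hC x y).trans ?_
    gcongr
    exact Real.le_coe_toNNReal C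
  exact this.continuous

lemma convexOn (hg : IsSupportFun g) : ConvexOn ℝ univ g := by
  refine ⟨convex_univ, fun x _ y _ a b ha hb _ => ?_⟩
  calc g (a • x + b • y) ≤ g (a • x) + g (b • y) := hg.add_le _ _
    _ = a • g x + b • g y := by rw [hg.smul a ha, hg.smul b hb]; rfl

lemma comp_linear {F : Type*} [NormedAddCommGroup F] [NormedSpace ℝ F] (hg : IsSupportFun g)
    (L : F →L[ℝ] E) : IsSupportFun fun x => g (L x) where
  smul c hc x := by rw [L.map_smul, hg.smul c hc]
  add_le x y := by rw [L.map_add]; exact hg.add_le _ _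
  bound := by
    obtain ⟨C, hC⟩ := hg.bound
    refine ⟨|C| * ‖L‖, fun x => (hC _).trans ?_⟩
    calc C * ‖L x‖ ≤ |C| * (‖L‖ * ‖x‖) := by
          gcongr
          · exact le_abs_self C
          · exact L.le_opNorm x
      _ = _ := by ring

end Normed

section Inner

variable {E : Type*} [NormedAddCommGroup E] [InnerProductSpace ℝ E] {g : E → ℝ}

/-- The convex body with support function `g`. -/
def _root_.supportBody (g : E → ℝ) : Set E := {z | ∀ u, inner ℝ z u ≤ g u}

lemma _root_.isClosed_supportBody (g : E → ℝ) : IsClosed (supportBody g) := by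
  simp only [supportBody, ofPred_forall]
  exact isClosed_iInter fun u => isClosed_le (by fun_prop) continuous_const

lemma _root_.convex_supportBody (g : E → ℝ) : Convex ℝ (supportBody g) := by
  intro x hx y hy a b ha hb hab u
  rw [inner_add_left, real_inner_smul_left, real_inner_smul_left]
  calc a * inner ℝ x u + b * inner ℝ y u ≤ a * g u + b * g u :=
        add_le_add (mul_le_mul_of_nonneg_left (hx u) ha) (mul_le_mul_of_nonneg_left (hy u) hb)
    _ = g u := by rw [← add_mul, hab, one_mul]

lemma norm_le_of_mem {C : ℝ} (hC : ∀ x, g x ≤ C * ‖x‖) {z : E}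
    (hz : z ∈ supportBody g) : ‖z‖ ≤ |C| := by
  have h1 := (hz z).trans (hC z)
  rw [real_inner_self_eq_norm_mul_norm] at h1
  rcases (norm_nonneg z).eq_or_lt' with h | h
  · rw [h]; exact abs_nonneg C
  · exact (le_of_mul_le_mul_right h1 h).trans (le_abs_self C)

section FiniteDim

variable [FiniteDimensional ℝ E]

lemma isCompact_supportBody (hg : IsSupportFun g) : IsCompact (supportBody g) := by
  obtain ⟨C, hC⟩ := hg.bound
  refine Metric.isCompact_of_isClosed_isBounded (isClosed_supportBody g)
    (isBounded_iff_forall_norm_le.2 ⟨|C|, fun z hz => norm_le_of_mem hC hz⟩)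

/-- The Hahn-Banach theorem: the body of a support function `g` has support function `g`, and its
values are attained. -/
lemma exists_mem_inner_eq (hg : IsSupportFun g) (u : E) :
    ∃ z ∈ supportBody g, inner ℝ z u = g u := by
  have key : ∀ c : ℝ, c * g u ≤ g (c • u) := by
    intro c
    rcases le_total 0 c with hc | hc
    · rw [hg.smul c hc]
    · have h1 := hg.add_le (c • u) ((-c) • u)
      rw [← add_smul, add_neg_cancel, zero_smul, hg.map_zero, hg.smul (-c) (by linarith)] at h1
      linarith
  by_cases hu : u = 0
  · obtain ⟨φ, -, hφ⟩ := exists_extension_of_le_sublinear (⊥ : E →ₗ.[ℝ] ℝ) g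
      (fun c hc x => hg.smul c hc.le x) hg.add_le (by
        rintro ⟨x, hx⟩
        have hx' : x = 0 := (Submodule.mem_bot ℝ).1 hx
        subst hx'
        rw [hg.map_zero]
        exact (LinearPMap.map_zero _).le)
    refine ⟨(InnerProductSpace.toDual ℝ E).symm (LinearMap.toContinuousLinearMap φ),
      fun x => ?_, ?_⟩
    · simpa using hφ x
    · subst hu; simp [hg.map_zero]
  · obtain ⟨φ, hφ', hφ⟩ := exists_extension_of_le_sublinear
      (LinearPMap.mkSpanSingleton u (g u) hu : E →ₗ.[ℝ] ℝ) g
      (fun c hc x => hg.smul c hc.le x) hg.add_le (by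
        rintro ⟨x, hx⟩
        obtain ⟨c, rfl⟩ := Submodule.mem_span_singleton.1 hx
        rw [show (LinearPMap.mkSpanSingleton u (g u) hu : E →ₗ.[ℝ] ℝ) ⟨c • u, hx⟩ = c • g u
          from LinearPMap.mkSpanSingleton'_apply _ _ _ c hx]
        simpa using key c)
    refine ⟨(InnerProductSpace.toDual ℝ E).symm (LinearMap.toContinuousLinearMap φ),
      fun x => ?_, ?_⟩
    · simpa using hφ x
    · have h1 := hφ' ⟨u, Submodule.mem_span_singleton_self u⟩
      have h2 := LinearPMap.mkSpanSingleton_apply ℝ ℝ (σ := RingHom.id ℝ) hu (g u)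
      rw [h2] at h1
      simpa using h1

lemma nonempty_supportBody (hg : IsSupportFun g) : (supportBody g).Nonempty := by
  obtain ⟨z, hz, -⟩ := hg.exists_mem_inner_eq 0
  exact ⟨z, hz⟩

/-- If the support function of `A` is at most `r` above that of the closed convex set `K` on unit
vectors, then `A` lies within `r` of `K`. -/
lemma _root_.infDist_le_of_inner_le {K : Set E} (hne : K.Nonempty) (hK : IsClosed K)
    (hconv : Convex ℝ K) {z : E} {r : ℝ} (hr : 0 ≤ r)
    (h : ∀ u : E, ∀ b : ℝ, (∀ y ∈ K, inner ℝ y u ≤ b) → inner ℝ z u ≤ b + r * ‖u‖) :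
    Metric.infDist z K ≤ r := by
  obtain ⟨w, hw, hmin⟩ := exists_norm_eq_iInf_of_complete_convex hne hK.isComplete hconv z
  rw [norm_eq_iInf_iff_real_inner_le_zero hconv hw] at hmin
  have h1 := h (z - w) (inner ℝ w (z - w)) (fun y hy => by
    have := hmin y hy
    rw [inner_sub_right, real_inner_comm, real_inner_comm _ (z - w)] at this
    linarith)
  have h2 : inner ℝ z (z - w) - inner ℝ w (z - w) = ‖z - w‖ * ‖z - w‖ := by
    rw [← inner_sub_left, real_inner_self_eq_norm_mul_norm]
  refine (Metric.infDist_le_dist_of_mem hw).trans ?_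
  rw [dist_eq_norm]
  rcases (norm_nonneg (z - w)).eq_or_lt' with h0 | h0
  · rw [h0]; exact hr
  · exact le_of_mul_le_mul_right (by linarith) h0

/-- A closed convex set is determined by its support function. -/
lemma _root_.eq_supportBody {K : Set E} (hne : K.Nonempty) (hK : IsClosed K)
    (hconv : Convex ℝ K) (hg : ∀ u, IsLUB ((fun z => inner ℝ z u) '' K) (g u)) :
    K = supportBody g := by
  refine subset_antisymm (fun z hz u => (hg u).1 ⟨z, hz, rfl⟩) fun z hz => ?_
  have h1 : Metric.infDist z K ≤ 0 := by
    refine infDist_le_of_inner_le hne hK hconv le_rfl fun u b hb => ?_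
    have : g u ≤ b := (hg u).2 (by rintro _ ⟨y, hy, rfl⟩; exact hb y hy)
    linarith [hz u]
  exact (hK.mem_iff_infDist_zero hne).2 (le_antisymm h1 Metric.infDist_nonneg)

lemma hausdorffDist_supportBody_le {g' : E → ℝ} (hg : IsSupportFun g) (hg' : IsSupportFun g')
    {r : ℝ} (hr : 0 ≤ r) (h : ∀ u, |g u - g' u| ≤ r * ‖u‖) :
    Metric.hausdorffDist (supportBody g) (supportBody g') ≤ r := by
  refine Metric.hausdorffDist_le_of_infDist hr (fun z hz => ?_) (fun z hz => ?_)
  · refine infDist_le_of_inner_le hg'.nonempty_supportBody (isClosed_supportBody _)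
      (convex_supportBody _) hr fun u b hb => ?_
    obtain ⟨y, hy, hyu⟩ := hg'.exists_mem_inner_eq u
    have := hb y hy
    linarith [(abs_le.1 (h u)).2, hz u]
  · refine infDist_le_of_inner_le hg.nonempty_supportBody (isClosed_supportBody _)
      (convex_supportBody _) hr fun u b hb => ?_
    obtain ⟨y, hy, hyu⟩ := hg.exists_mem_inner_eq u
    have := hb y hy
    linarith [(abs_le.1 (h u)).1, hz u]

/-- A boundary point of a body has a unit outer normal. -/
lemma exists_normal_of_mem_frontier [Nontrivial E] (hg : IsSupportFun g) {z : E}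
    (hz : z ∈ frontier (supportBody g)) : ∃ u : E, ‖u‖ = 1 ∧ inner ℝ z u = g u := by
  obtain ⟨u, hu, hmin⟩ := (isCompact_sphere (0 : E) 1).exists_isMinOn
    (NormedSpace.sphere_nonempty.2 zero_le_one)
    (f := fun u => g u - inner ℝ z u) (by have := hg.continuous; fun_prop)
  have hu1 : ‖u‖ = 1 := by simpa using hu
  have hzK : z ∈ supportBody g := (isClosed_supportBody g).frontier_subset hz
  refine ⟨u, hu1, le_antisymm (hzK u) ?_⟩
  by_contra hlt
  push Not at hlt
  refine hz.2 (mem_interior_iff_mem_nhds.2 ?_)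
  refine Filter.mem_of_superset (Metric.ball_mem_nhds z (sub_pos.2 hlt)) fun y hy v => ?_
  rw [Metric.mem_ball, dist_eq_norm] at hy
  by_cases hv : v = 0
  · subst hv; simp [hg.map_zero]
  have hv' : 0 < ‖v‖ := norm_pos_iff.2 hv
  have h1 : g u - inner ℝ z u ≤ g (‖v‖⁻¹ • v) - inner ℝ z (‖v‖⁻¹ • v) :=
    hmin (show ‖v‖⁻¹ • v ∈ Metric.sphere (0 : E) 1 by
      simp [norm_smul, hv'.ne'])
  rw [hg.smul _ (by positivity), inner_smul_right, ← mul_sub] at h1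
  have h2 : (g u - inner ℝ z u) * ‖v‖ ≤ g v - inner ℝ z v := by
    have := mul_le_mul_of_nonneg_right h1 hv'.le
    rwa [mul_comm (‖v‖⁻¹), mul_assoc, inv_mul_cancel₀ hv'.ne', mul_one] at this
  have h3 : inner ℝ (y - z) v ≤ ‖y - z‖ * ‖v‖ := real_inner_le_norm _ _
  rw [inner_sub_left] at h3
  nlinarith

/-- Support functions that converge on a dense sequence, with a common bound on the unit ball,
converge uniformly on the unit ball, so that the bodies converge in the Hausdorff distance. -/
lemma tendsto_hausdorffDist_supportBody {gn : ℕ → E → ℝ} {C : ℝ} (hg : IsSupportFun g)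
    (hgn : ∀ n, IsSupportFun (gn n)) (hC : ∀ x, g x ≤ C * ‖x‖) (hCn : ∀ n x, gn n x ≤ C * ‖x‖)
    {d : ℕ → E} (hd : DenseRange d) (h : ∀ k, Tendsto (fun n => gn n (d k)) atTop (𝓝 (g (d k)))) :
    Tendsto (fun n => Metric.hausdorffDist (supportBody (gn n)) (supportBody g)) atTop (𝓝 0) := by
  have hC' : ∀ x : E, C * ‖x‖ ≤ |C| * ‖x‖ := fun x => by gcongr; exact le_abs_self C
  rw [Metric.tendsto_atTop]
  intro ε hε
  -- a finite net of the unit sphere, made of points of the dense sequence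
  have hδ : 0 < ε / (4 * (|C| + 1)) := by positivity
  set δ := ε / (4 * (|C| + 1)) with hδdef
  obtain ⟨t, ht⟩ := (isCompact_sphere (0 : E) 1).elim_finite_subcover
    (fun k => Metric.ball (d k) δ) (fun k => Metric.isOpen_ball) (fun x _ => by
      obtain ⟨k, hk⟩ := hd.exists_dist_lt x hδ
      exact mem_iUnion.2 ⟨k, hk⟩)
  have hev : ∀ᶠ n in atTop, ∀ k ∈ t, |gn n (d k) - g (d k)| < ε / 4 := by
    rw [Filter.eventually_all_finset]
    intro k _
    have := Metric.tendsto_nhds.1 (h k) (ε / 4) (by positivity)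
    simpa [Real.dist_eq] using this
  obtain ⟨N, hN⟩ := eventually_atTop.1 hev
  refine ⟨N, fun n hn => ?_⟩
  have hsph : ∀ u : E, ‖u‖ = 1 → |gn n u - g u| ≤ 3 / 4 * ε := by
    intro u hu
    obtain ⟨k, hk, hku⟩ := mem_iUnion₂.1 (ht (show u ∈ Metric.sphere (0 : E) 1 by simpa using hu))
    rw [Metric.mem_ball, dist_eq_norm] at hku
    have h1 := (hgn n).abs_sub_le (hCn n) u (d k)
    have h2 := hg.abs_sub_le hC u (d k)
    have h3 := hN n hn k hk
    have h4 : C * ‖u - d k‖ ≤ ε / 4 := by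
      calc C * ‖u - d k‖ ≤ (|C| + 1) * δ := by
            have := le_abs_self C
            have := abs_nonneg C
            have := norm_nonneg (u - d k)
            nlinarith
        _ = ε / 4 := by rw [hδdef]; field_simp
    rw [abs_le] at h1 h2 ⊢
    rw [abs_lt] at h3
    constructor <;> linarith
  have hall : ∀ u : E, |gn n u - g u| ≤ 3 / 4 * ε * ‖u‖ := by
    intro u
    by_cases hu : u = 0
    · subst hu; simp [hg.map_zero, (hgn n).map_zero]
    have hu' : 0 < ‖u‖ := norm_pos_iff.2 hu
    have h1 := hsph (‖u‖⁻¹ • u) (by simp [norm_smul, hu'.ne'])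
    rw [hg.smul _ (by positivity), (hgn n).smul _ (by positivity), ← mul_sub, abs_mul,
      abs_of_pos (by positivity), inv_mul_le_iff₀ hu'] at h1
    linarith
  have := hausdorffDist_supportBody_le (hgn n) hg (by positivity) hall
  rw [Real.dist_eq, sub_zero, abs_of_nonneg Metric.hausdorffDist_nonneg]
  linarith

end FiniteDim

end Inner

end IsSupportFun

/-! ### Curves of unit speed and the lower bound on the second difference -/

/-- The mean value inequality for the difference of a Lipschitz and a smooth curve, with a bound
on the derivative at almost every point only. -/
lemma norm_sub_le_of_ae_deriv_le {F : Type*} [NormedAddCommGroup F] [InnerProductSpace ℝ F]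
    [FiniteDimensional ℝ F] {c q : ℝ → F} {a b M : ℝ} {C : NNReal} (hab : a ≤ b)
    (hc : LipschitzOnWith C c (Icc a b)) (hq : ContDiff ℝ 1 q)
    (hM : ∀ t ∈ Ioo a b, DifferentiableAt ℝ c t → ‖deriv c t - deriv q t‖ ≤ M) :
    ‖(c b - q b) - (c a - q a)‖ ≤ M * (b - a) := by
  set v := (c b - q b) - (c a - q a) with hv
  have hAC : AbsolutelyContinuousOnInterval (fun t => inner ℝ v (c t) - inner ℝ v (q t)) a b := by
    refine AbsolutelyContinuousOnInterval.sub ?_ ?_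
    · refine LipschitzOnWith.absolutelyContinuousOnInterval (K := ‖v‖₊ * C) ?_
      rw [uIcc_of_le hab]
      refine LipschitzOnWith.of_dist_le_mul fun x hx y hy => ?_
      rw [Real.dist_eq, ← inner_sub_right]
      calc |inner ℝ v (c x - c y)| ≤ ‖v‖ * ‖c x - c y‖ := abs_real_inner_le_norm _ _
        _ ≤ ‖v‖ * (C * dist x y) := by
            gcongr; rw [← dist_eq_norm]; exact hc.dist_le_mul x hx y hy
        _ = _ := by push_cast; ring
    · refine ContDiffOn.absolutelyContinuousOnInterval ?_
      exact (contDiff_const.inner ℝ hq).contDiffOn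
  have h1 := hAC.integral_deriv_eq_sub
  have hdiff : ∀ᵐ t, t ∈ Icc a b → DifferentiableWithinAt ℝ c (Icc a b) t :=
    hc.ae_differentiableWithinAt_of_mem_real
  have hb : ∀ᵐ t : ℝ, t ≠ b := by simp [ae_iff, measure_singleton]
  have h2 : ‖∫ t in a..b, deriv (fun t => inner ℝ v (c t) - inner ℝ v (q t)) t‖
      ≤ (‖v‖ * M) * |b - a| := by
    refine intervalIntegral.norm_integral_le_of_norm_le_const_ae ?_
    filter_upwards [hdiff, hb] with t ht htb htI
    rw [uIoc_of_le hab] at htI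
    have htI' : t ∈ Ioo a b := ⟨htI.1, lt_of_le_of_ne htI.2 htb⟩
    have hct : DifferentiableAt ℝ c t :=
      (ht (Ioo_subset_Icc_self htI')).differentiableAt (Icc_mem_nhds htI'.1 htI'.2)
    have hqt : DifferentiableAt ℝ q t := (hq.differentiable one_ne_zero).differentiableAt
    have hd : HasDerivAt (fun t => inner ℝ v (c t) - inner ℝ v (q t))
        (inner ℝ v (deriv c t) - inner ℝ v (deriv q t)) t := by
      have h3 := ((hasDerivAt_const t v).inner ℝ hct.hasDerivAt)
      have h4 := ((hasDerivAt_const t v).inner ℝ hqt.hasDerivAt)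
      simpa using h3.fun_sub h4
    rw [hd.deriv, ← inner_sub_right]
    exact (norm_inner_le_norm _ _).trans
      (mul_le_mul_of_nonneg_left (hM t htI' hct) (norm_nonneg _))
  rw [h1] at h2
  have h5 : inner ℝ v (c b) - inner ℝ v (q b) - (inner ℝ v (c a) - inner ℝ v (q a))
      = ‖v‖ * ‖v‖ := by
    rw [← inner_sub_right, ← inner_sub_right, ← inner_sub_right, ← hv,
      real_inner_self_eq_norm_mul_norm]
  rw [h5, abs_of_nonneg (sub_nonneg.2 hab), Real.norm_of_nonneg (by positivity), mul_assoc] at h2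
  rcases (norm_nonneg v).eq_or_lt' with h0 | h0
  · rw [h0]
    rcases hab.eq_or_lt with rfl | hlt
    · simp
    · -- a point of differentiability shows that the bound is nonnegative
      have hpos : volume (Ioo a b) ≠ 0 := by simp [hlt]
      have : ∃ t ∈ Ioo a b, DifferentiableAt ℝ c t := by
        by_contra hcon
        push Not at hcon
        refine hpos (measure_mono_null ?_ (ae_iff.1 hdiff))
        intro t ht htn
        exact hcon t ht ((htn (Ioo_subset_Icc_self ht)).differentiableAt
          (Icc_mem_nhds ht.1 ht.2))
      obtain ⟨t, ht, htd⟩ := this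
      exact mul_nonneg ((norm_nonneg _).trans (hM t ht htd)) (sub_nonneg.2 hab)
  · exact le_of_mul_le_mul_left h2 h0

lemma eVariationOn_le_of_lipschitzOnWith {F : Type*} [PseudoEMetricSpace F] {c : ℝ → F}
    {s : Set ℝ} {x y : ℝ} {C : NNReal} (hx : x ∈ s) (hy : y ∈ s)
    (hc : LipschitzOnWith C c (s ∩ Icc x y)) :
    eVariationOn c (s ∩ Icc x y) ≤ C * ENNReal.ofReal (y - x) := by
  have h1 := hc.comp_eVariationOn_le (g := id) (s := s ∩ Icc x y) (mapsTo_id _)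
  refine h1.trans ?_
  gcongr
  exact ((monotoneOn_id (s := s)).eVariationOn_eq hx hy).le

lemma HasUnitSpeedOn.lipschitzOnWith {F : Type*} [PseudoEMetricSpace F] {c : ℝ → F} {s : Set ℝ}
    (hc : HasUnitSpeedOn c s) : LipschitzOnWith 1 c s := by
  have key : ∀ x ∈ s, ∀ y ∈ s, x ≤ y → edist (c x) (c y) ≤ ENNReal.ofReal (y - x) := by
    intro x hx y hy hxy
    have h1 : eVariationOn c (s ∩ Icc x y) = ENNReal.ofReal (((1 : NNReal) : ℝ) * (y - x)) :=
      hc hx hy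
    rw [NNReal.coe_one, one_mul] at h1
    rw [← h1]
    exact eVariationOn.edist_le c ⟨hx, left_mem_Icc.2 hxy⟩ ⟨hy, right_mem_Icc.2 hxy⟩
  intro x hx y hy
  rw [ENNReal.coe_one, one_mul, edist_dist x y, Real.dist_eq]
  rcases le_total x y with h | h
  · rw [abs_sub_comm, abs_of_nonneg (sub_nonneg.2 h)]; exact key x hx y hy h
  · rw [edist_comm, abs_of_nonneg (sub_nonneg.2 h)]; exact key y hy x hx h

/-- Where the derivative of a curve of unit speed is continuous along the points of
differentiability, it has norm at least `1`: otherwise the curve would be too short. -/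
lemma HasUnitSpeedOn.one_le_norm_deriv {F : Type*} [NormedAddCommGroup F] [InnerProductSpace ℝ F]
    [FiniteDimensional ℝ F] {c : ℝ → F} {ε : ℝ} (hε : 0 < ε)
    (hc : HasUnitSpeedOn c (Ioo (-ε) ε))
    (hcont : ContinuousWithinAt (deriv c) {t | DifferentiableAt ℝ c t} 0) :
    1 ≤ ‖deriv c 0‖ := by
  by_contra hlt
  push Not at hlt
  set M : ℝ := (1 + ‖deriv c 0‖) / 2 with hM
  have hM0 : 0 ≤ M := by have := norm_nonneg (deriv c 0); linarith
  have h1 : ∀ᶠ t in 𝓝[{t | DifferentiableAt ℝ c t}] 0, ‖deriv c t‖ < M :=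
    hcont.norm.eventually_lt_const (by linarith)
  rw [eventually_nhdsWithin_iff, Metric.eventually_nhds_iff] at h1
  obtain ⟨δ, hδ, hδM⟩ := h1
  set r := min ε δ / 2 with hr
  have hr0 : 0 < r := by positivity
  have hrε : r < ε := by have := min_le_left ε δ; have := lt_min hε hδ; linarith
  have hrδ : r < δ := by have := min_le_right ε δ; have := lt_min hε hδ; linarith
  have h0m : (0 : ℝ) ∈ Ioo (-ε) ε := ⟨by linarith, hε⟩
  have hrm : r ∈ Ioo (-ε) ε := ⟨by linarith, hrε⟩
  have hsub : Icc 0 r ⊆ Ioo (-ε) ε := fun t ht => ⟨by linarith [ht.1], by linarith [ht.2]⟩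
  have hlip : LipschitzOnWith M.toNNReal c (Icc 0 r) := by
    have key : ∀ x ∈ Icc 0 r, ∀ y ∈ Icc 0 r, x ≤ y → ‖c y - c x‖ ≤ M * (y - x) := by
      intro x hx y hy hxy
      have := norm_sub_le_of_ae_deriv_le (c := c) (q := fun _ => 0) (M := M) hxy
        (hc.lipschitzOnWith.mono ((Icc_subset_Icc hx.1 hy.2).trans hsub)) contDiff_const
        (fun t ht htd => by
          simp only [deriv_const, sub_zero]
          refine (hδM ?_ htd).le
          rw [Real.dist_eq, sub_zero, abs_lt]
          constructor <;> linarith [ht.1, ht.2, hx.1, hy.2])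
      simpa using this
    refine LipschitzOnWith.of_dist_le_mul fun x hx y hy => ?_
    rw [Real.coe_toNNReal M hM0, dist_eq_norm, Real.dist_eq]
    rcases le_total x y with h | h
    · rw [abs_sub_comm, abs_of_nonneg (sub_nonneg.2 h), norm_sub_rev]; exact key x hx y hy h
    · rw [abs_of_nonneg (sub_nonneg.2 h)]; exact key y hy x hx h
  have h2 : eVariationOn c (Ioo (-ε) ε ∩ Icc 0 r)
      = ENNReal.ofReal (((1 : NNReal) : ℝ) * (r - 0)) := hc h0m hrm
  have h3 := eVariationOn_le_of_lipschitzOnWith h0m hrm (hlip.mono inter_subset_right)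
  rw [h2, NNReal.coe_one, one_mul, sub_zero] at h3
  rw [show ((M.toNNReal : NNReal) : ℝ≥0∞) = ENNReal.ofReal M from rfl,
    ← ENNReal.ofReal_mul hM0, ENNReal.ofReal_le_ofReal_iff (by positivity)] at h3
  nlinarith

/-- The second order expansion of a Lipschitz curve whose derivative is itself differentiable at
`0` along the points where it exists. -/
lemma exists_norm_sub_taylor_le {F : Type*} [NormedAddCommGroup F] [InnerProductSpace ℝ F]
    [FiniteDimensional ℝ F] {c : ℝ → F} {ε : ℝ} (hε : 0 < ε) {C : NNReal}
    (hc : LipschitzOnWith C c (Ioo (-ε) ε)) {w : F}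
    (hw : HasDerivWithinAt (deriv c) w {t | DifferentiableAt ℝ c t} 0) {η : ℝ} (hη : 0 < η) :
    ∃ δ > 0, ∀ t, |t| < δ →
      ‖c t - c 0 - (t • deriv c 0 + (t ^ 2 / 2) • w)‖ ≤ η * t ^ 2 := by
  have h1 := (hasDerivWithinAt_iff_isLittleO.1 hw).def hη
  rw [eventually_nhdsWithin_iff, Metric.eventually_nhds_iff] at h1
  obtain ⟨δ, hδ, hδ'⟩ := h1
  set q : ℝ → F := fun t => t • deriv c 0 + (t ^ 2 / 2) • w with hq
  have hqd : ∀ t, HasDerivAt q (deriv c 0 + t • w) t := by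
    intro t
    have h2 := (hasDerivAt_id t).smul_const (deriv c 0)
    have h3 := (((hasDerivAt_id t).pow 2).div_const 2).smul_const w
    refine (h2.add h3).congr_deriv ?_
    simp
  have hqs : ContDiff ℝ 1 q := by fun_prop
  have hq0 : q 0 = 0 := by simp [hq]
  have key : ∀ a b r : ℝ, a ≤ b → |a| ≤ r → |b| ≤ r → r < min ε δ →
      ‖(c b - q b) - (c a - q a)‖ ≤ (η * r) * (b - a) := by
    intro a b r hab ha hb hr
    have hrε := hr.trans_le (min_le_left _ _)
    have hrδ := hr.trans_le (min_le_right _ _)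
    rw [abs_le] at ha hb
    refine norm_sub_le_of_ae_deriv_le hab (hc.mono fun t ht => ⟨?_, ?_⟩) hqs fun t ht htd => ?_
    · linarith [ht.1]
    · linarith [ht.2]
    · have htr : |t| ≤ r := abs_le.2 ⟨by linarith [ht.1], by linarith [ht.2]⟩
      have h4 := hδ' (y := t) (by rw [Real.dist_eq, sub_zero]; linarith) htd
      rw [(hqd t).deriv]
      rw [sub_zero, Real.norm_eq_abs] at h4
      rw [← sub_sub]
      exact h4.trans (by gcongr)
  refine ⟨min ε δ, lt_min hε hδ, fun t ht => ?_⟩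
  rcases le_total 0 t with h | h
  · have := key 0 t |t| h (by simp) le_rfl ht
    rw [hq0, sub_zero] at this
    rw [show c t - c 0 - q t = c t - q t - c 0 by abel]
    refine this.trans (le_of_eq ?_)
    rw [abs_of_nonneg h]; ring
  · have := key t 0 |t| h le_rfl (by simp) ht
    rw [hq0, sub_zero, norm_sub_rev] at this
    rw [show c t - c 0 - q t = c t - q t - c 0 by abel]
    refine this.trans (le_of_eq ?_)
    rw [abs_of_nonpos h]; ring

lemma abs_apply_le_norm (z : Plane) (i : Fin 2) : |z i| ≤ ‖z‖ := by
  simpa using PiLp.norm_apply_le z i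

/-- If the boundary of `K` has curvature less than `k` at a maximiser `p` of the first coordinate,
then it bends away from its vertical tangent at most quadratically, so that the support function
of `K` near the direction `(1, 0)` is at least that of a circle of radius `1 / k`. -/
lemma eventually_secondDifference_ge {K : Set Plane} (hK : IsClosed K) {p : Plane}
    (hp : IsMaximiser K p) {κ : ℝ≥0∞} (hκ : HasCurvatureAt K p κ) {k : ℝ} (hk : 0 < k)
    (hκk : κ < ENNReal.ofReal k) {f : ℝ → ℝ} (hf : ∀ z ∈ K, ∀ s, z 0 + s * z 1 ≤ f s)
    (hf0 : f 0 = p 0) :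
    ∃ δ > 0, ∀ s, |s| < δ → s ^ 2 / k ≤ f s + f (-s) - 2 * f 0 := by
  rcases hκ with ⟨-, rfl⟩ | ⟨c, ⟨hc0, ε, hε, -, hcK, -, hcu⟩, hcd, ⟨w, hw, rfl⟩ | ⟨-, rfl⟩⟩
  · simp at hκk
  swap
  · simp at hκk
  have hwk : ‖w‖ < k := by
    rw [← ofReal_norm, ENNReal.ofReal_lt_ofReal_iff hk] at hκk
    exact hκk
  set τ := deriv c 0 with hτ
  have hτ1 : 1 ≤ ‖τ‖ := hcu.one_le_norm_deriv hε hw.continuousWithinAt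
  -- the tangent at the maximiser is vertical
  have hτ0 : τ 0 = 0 := by
    have hd : HasDerivAt (fun t => c t 0) (τ 0) 0 :=
      (EuclideanSpace.proj (𝕜 := ℝ) (0 : Fin 2)).hasFDerivAt.comp_hasDerivAt (0 : ℝ)
        hcd.hasDerivAt
    refine IsLocalMax.hasDerivAt_eq_zero ?_ hd
    filter_upwards [Ioo_mem_nhds (neg_lt_zero.2 hε) hε] with t ht
    rw [hc0]
    exact hp.2 _ (hK.frontier_subset (hcK ht))
  have hτ1' : 1 ≤ |τ 1| := by
    rw [EuclideanSpace.norm_eq, Fin.sum_univ_two, hτ0] at hτ1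
    simpa [Real.sqrt_sq_eq_abs] using hτ1
  set η := (k - ‖w‖) / 4 with hη
  have hη0 : 0 < η := by linarith
  obtain ⟨δ, hδ, hδc⟩ := exists_norm_sub_taylor_le hε hcu.lipschitzOnWith hw hη0
  have hW : 0 ≤ ‖w‖ := norm_nonneg w
  -- the point of the curve at parameter `± s / k` is a competitor in direction `(1, s)`
  have key : ∀ s, |s| < min (k * min δ ε) (η / (‖w‖ / 2 + η)) →
      s ^ 2 / (2 * k) ≤ f s - f 0 - s * p 1 := by
    intro s hs
    have hs1 := hs.trans_le (min_le_left _ _)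
    have hs2 := (hs.trans_le (min_le_right _ _)).le
    rw [le_div_iff₀ (by positivity)] at hs2
    obtain ⟨t, ht1, ht2⟩ : ∃ t, t * (τ 1) * s = s ^ 2 / k * |τ 1| ∧ |t| = |s| / k := by
      rcases le_total 0 (τ 1) with h | h
      · exact ⟨s / k, by rw [abs_of_nonneg h]; ring, by rw [abs_div, abs_of_pos hk]⟩
      · exact ⟨-(s / k), by rw [abs_of_nonpos h]; ring, by rw [abs_neg, abs_div, abs_of_pos hk]⟩
    have htδ : |t| < min δ ε := by rw [ht2, div_lt_iff₀ hk]; linarith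
    have htK : c t ∈ K := hK.frontier_subset
      (hcK (by have := abs_lt.1 (htδ.trans_le (min_le_right _ _)); exact this))
    have he := hδc t (htδ.trans_le (min_le_left _ _))
    set e := c t - c 0 - (t • τ + (t ^ 2 / 2) • w) with hedef
    have hct : ∀ i, c t i = p i + t * τ i + t ^ 2 / 2 * w i + e i := by
      intro i
      rw [hedef, hc0]
      simp
      ring
    have h1 := hf _ htK s
    rw [hct 0, hct 1, hτ0] at h1
    have ht2' : t ^ 2 = s ^ 2 / k ^ 2 := by
      rw [← sq_abs t, ht2, div_pow, sq_abs]
    have hw0 := (abs_le.1 (abs_apply_le_norm w 0)).1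
    have he0 := (abs_le.1 ((abs_apply_le_norm e 0).trans he)).1
    have hA : |t ^ 2 / 2 * w 1 + e 1| ≤ t ^ 2 * (‖w‖ / 2 + η) := by
      have hw1 := abs_apply_le_norm w 1
      have he1 := (abs_apply_le_norm e 1).trans he
      calc |t ^ 2 / 2 * w 1 + e 1| ≤ t ^ 2 / 2 * |w 1| + |e 1| := by
            refine (abs_add_le _ _).trans ?_
            rw [abs_mul, abs_of_nonneg (by positivity : 0 ≤ t ^ 2 / 2)]
        _ ≤ t ^ 2 / 2 * ‖w‖ + η * t ^ 2 := by gcongr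
        _ = _ := by ring
    have hB : -(t ^ 2 * η) ≤ s * (t ^ 2 / 2 * w 1 + e 1) := by
      refine (abs_le.1 ?_).1
      rw [abs_mul]
      calc |s| * |t ^ 2 / 2 * w 1 + e 1| ≤ |s| * (t ^ 2 * (‖w‖ / 2 + η)) := by gcongr
        _ = t ^ 2 * (|s| * (‖w‖ / 2 + η)) := by ring
        _ ≤ t ^ 2 * η := by gcongr
    have hC : s ^ 2 / k ≤ t * τ 1 * s := by
      rw [ht1]
      exact le_mul_of_one_le_right (by positivity) hτ1'
    have hD : s ^ 2 / (2 * k) = s ^ 2 / k - t ^ 2 / 2 * ‖w‖ - 2 * (η * t ^ 2) := by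
      rw [ht2', hη]; field_simp; ring
    have hE : -(t ^ 2 / 2 * ‖w‖) ≤ t ^ 2 / 2 * w 0 := by
      have : 0 ≤ t ^ 2 / 2 := by positivity
      nlinarith
    rw [hf0, hD]
    nlinarith
  refine ⟨min (k * min δ ε) (η / (‖w‖ / 2 + η)), lt_min (by positivity) (by positivity),
    fun s hs => ?_⟩
  have h1 := key s hs
  have h2 := key (-s) (by rwa [abs_neg])
  have h3 : s ^ 2 / k = s ^ 2 / (2 * k) + (-s) ^ 2 / (2 * k) := by field_simp; ring
  rw [h3]
  linarith

/-! ### Subgradients of convex functions of one variable -/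

/-- `y` is a subgradient of `f` at `m`. -/
def IsSubgradientAt (f : ℝ → ℝ) (m y : ℝ) : Prop := ∀ t, f m + y * (t - m) ≤ f t

lemma IsSubgradientAt.mul_sub_nonneg {f : ℝ → ℝ} {m y m' y' : ℝ} (h : IsSubgradientAt f m y)
    (h' : IsSubgradientAt f m' y') : 0 ≤ (y - y') * (m - m') := by
  have h1 := h m'
  have h2 := h' m
  nlinarith

/-- The subdifferential of `f` is differentiable at `0`, with value `y₀` and derivative `ρ`. For a
convex function this means that `f` has the second derivative `ρ` at `0`, in the sense of
Alexandrov. -/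
def HasSubgradientDeriv (f : ℝ → ℝ) (ρ y₀ : ℝ) : Prop :=
  ∀ ε > 0, ∃ δ > 0, ∀ m y, |m| < δ → IsSubgradientAt f m y → |y - y₀ - ρ * m| ≤ ε * |m|

lemma HasSubgradientDeriv.eq_of_isSubgradientAt_zero {f : ℝ → ℝ} {ρ y₀ y : ℝ}
    (h : HasSubgradientDeriv f ρ y₀) (hy : IsSubgradientAt f 0 y) : y = y₀ := by
  obtain ⟨δ, hδ, h1⟩ := h 1 one_pos
  have := h1 0 y (by simpa using hδ) hy
  simp only [abs_zero, mul_zero, sub_zero] at this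
  linarith [abs_nonpos_iff.1 this]

/-! ### The boundary of a planar body near a maximiser of the first coordinate -/

lemma inner_vec (z : Plane) (a b : ℝ) : inner ℝ z !₂[a, b] = z 0 * a + z 1 * b := by
  simp [PiLp.inner_apply, Fin.sum_univ_two, mul_comm]

/-- The restriction of a support function in the plane to the line of directions `(1, t)`. -/
def slopeSupport (g : Plane → ℝ) (t : ℝ) : ℝ := g !₂[1, t]

section PlanarBody

variable {g : Plane → ℝ} {ρ y₀ : ℝ} {p : Plane}

lemma le_slopeSupport {z : Plane} (hz : z ∈ supportBody g) (t : ℝ) :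
    z 0 + t * z 1 ≤ slopeSupport g t := by
  have := hz !₂[1, t]
  rw [inner_vec] at this
  rw [slopeSupport]; linarith

lemma exists_eq_slopeSupport (hg : IsSupportFun g) (t : ℝ) :
    ∃ z ∈ supportBody g, z 0 + t * z 1 = slopeSupport g t := by
  obtain ⟨z, hz, h⟩ := hg.exists_mem_inner_eq !₂[1, t]
  rw [inner_vec] at h
  exact ⟨z, hz, by rw [slopeSupport]; linarith⟩

lemma isSubgradientAt_slopeSupport {z : Plane} (hz : z ∈ supportBody g) {m : ℝ}
    (hm : z 0 + m * z 1 = slopeSupport g m) : IsSubgradientAt (slopeSupport g) m (z 1) := by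
  intro t
  have := le_slopeSupport hz t
  linarith

lemma IsMaximiser.slopeSupport_zero (hg : IsSupportFun g) (hp : IsMaximiser (supportBody g) p) :
    slopeSupport g 0 = p 0 := by
  obtain ⟨z, hz, h⟩ := exists_eq_slopeSupport hg 0
  have h1 := hp.2 z hz
  have h2 := le_slopeSupport hp.1 0
  linarith

lemma IsMaximiser.apply_one_eq (hg : IsSupportFun g)
    (hf : HasSubgradientDeriv (slopeSupport g) ρ y₀) (hp : IsMaximiser (supportBody g) p) :
    p 1 = y₀ :=
  hf.eq_of_isSubgradientAt_zero
    (isSubgradientAt_slopeSupport hp.1 (by rw [hp.slopeSupport_zero hg]; ring))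

/-- Where the support function is differentiable, the face is a single point. -/
lemma existsUnique_isMaximiser (hg : IsSupportFun g)
    (hf : HasSubgradientDeriv (slopeSupport g) ρ y₀) :
    ∃! p, IsMaximiser (supportBody g) p := by
  obtain ⟨z, hz, h⟩ := exists_eq_slopeSupport hg 0
  have hzm : IsMaximiser (supportBody g) z := by
    refine ⟨hz, fun q hq => ?_⟩
    have := le_slopeSupport hq 0
    linarith
  refine ⟨z, hzm, fun q hq => ?_⟩
  ext i
  fin_cases i
  · exact le_antisymm (hzm.2 q hq.1) (hq.2 z hzm.1)
  · exact (hq.apply_one_eq hg hf).trans (hzm.apply_one_eq hg hf).symm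

/-- A point of `K` is a boundary point if moving it in the direction `(1, 0)` leaves `K` at
once. -/
lemma mem_frontier_of_forall_le {K : Set Plane} {z : Plane} (hz : z ∈ K)
    (h : ∀ᶠ s : ℝ in 𝓝[>] 0, z + s • !₂[1, 0] ∉ K) : z ∈ frontier K := by
  refine ⟨subset_closure hz, fun hint => ?_⟩
  have h1 : Tendsto (fun s : ℝ => z + s • (!₂[1, 0] : Plane)) (𝓝[>] 0) (𝓝 z) := by
    have : Continuous fun s : ℝ => z + s • (!₂[1, 0] : Plane) := by fun_prop
    have h2 := this.tendsto 0
    rw [zero_smul, add_zero] at h2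
    exact h2.mono_left nhdsWithin_le_nhds
  obtain ⟨s, hs1, hs2⟩ := (h.and (h1.eventually (mem_interior_iff_mem_nhds.1 hint))).exists
  exact hs1 hs2

lemma mem_frontier_of_support {z : Plane} (hz : z ∈ supportBody g) {m : ℝ}
    (hm : z 0 + m * z 1 = slopeSupport g m) : z ∈ frontier (supportBody g) := by
  refine mem_frontier_of_forall_le hz ?_
  filter_upwards [self_mem_nhdsWithin] with s hs hmem
  have := le_slopeSupport hmem m
  simp only [PiLp.add_apply, PiLp.smul_apply, smul_eq_mul] at this
  simp at this
  linarith [show (0 : ℝ) < s from hs]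

lemma isVertex_of_normals {K : Set Plane} (hp : p ∈ frontier K) {u v : Plane}
    (hu : u ∈ normalCone K p) (hv : v ∈ normalCone K p) (huv : u 0 * v 1 - u 1 * v 0 ≠ 0) :
    IsVertex K p := by
  refine ⟨hp, ?_⟩
  set d := u 0 * v 1 - u 1 * v 0 with hd
  -- the open cone spanned by the two normals, in coordinates given by Cramer's rule
  let O : Set Plane := {w | 0 < (w 0 * v 1 - w 1 * v 0) / d ∧ 0 < (u 0 * w 1 - u 1 * w 0) / d}
  have hO : IsOpen O := by
    refine IsOpen.and ?_ ?_ <;> exact isOpen_lt continuous_const (by fun_prop)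
  refine ⟨u + v, mem_interior.2 ⟨O, fun w hw q hq => ?_, hO, ?_, ?_⟩⟩
  · have hwe : w = ((w 0 * v 1 - w 1 * v 0) / d) • u + ((u 0 * w 1 - u 1 * w 0) / d) • v := by
      ext i
      fin_cases i
      · simp; field_simp; rw [hd]; ring
      · simp; field_simp; rw [hd]; ring
    rw [hwe, inner_add_left, real_inner_smul_left, real_inner_smul_left]
    have h1 := mul_nonpos_of_nonneg_of_nonpos hw.1.le (hu q hq)
    have h2 := mul_nonpos_of_nonneg_of_nonpos hw.2.le (hv q hq)
    linarith
  · have : ((u + v) 0 * v 1 - (u + v) 1 * v 0) / d = 1 := by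
      rw [div_eq_one_iff_eq huv, hd]; simp; ring
    rw [this]; exact one_pos
  · have : (u 0 * (u + v) 1 - u 1 * (u + v) 0) / d = 1 := by
      rw [div_eq_one_iff_eq huv, hd]; simp; ring
    rw [this]; exact one_pos

/-- If the maximiser is not a vertex, then the body has a boundary point with normal `(1, m)` away
from the maximiser, on the side given by the sign of `m`. -/
lemma exists_support_point (hg : IsSupportFun g)
    (hf : HasSubgradientDeriv (slopeSupport g) ρ y₀) (hp : IsMaximiser (supportBody g) p)
    (hv : ¬ IsVertex (supportBody g) p) {m : ℝ} (hm : m ≠ 0) :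
    ∃ z ∈ supportBody g, z 0 + m * z 1 = slopeSupport g m ∧ 0 < (z 1 - y₀) * m ∧ z 0 < p 0 := by
  have hp1 := hp.apply_one_eq hg hf
  have hp0 := hp.slopeSupport_zero hg
  have hpsub := isSubgradientAt_slopeSupport hp.1 (m := 0) (by rw [hp0]; ring)
  have hpf := mem_frontier_of_support hp.1 (m := 0) (by rw [hp0]; ring)
  obtain ⟨z, hz, h⟩ := exists_eq_slopeSupport hg m
  have hlt : p 0 + m * p 1 < slopeSupport g m := by
    refine lt_of_le_of_ne (le_slopeSupport hp.1 m) fun heq => hv ?_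
    refine isVertex_of_normals hpf (u := !₂[1, 0]) (v := !₂[1, m]) ?_ ?_ (by simpa using hm)
    · intro q hq
      rw [real_inner_comm, inner_vec]
      have := hp.2 q hq
      simp; linarith
    · intro q hq
      rw [real_inner_comm, inner_vec]
      have := le_slopeSupport hq m
      simp; linarith
  have hmono := (isSubgradientAt_slopeSupport hz h).mul_sub_nonneg hpsub
  have hz0 := hp.2 z hz
  have hne : z 1 ≠ y₀ := by
    intro heq
    rw [heq] at h
    rw [hp1] at hlt
    linarith
  refine ⟨z, hz, h, ?_, lt_of_le_of_ne hz0 fun heq => hne ?_⟩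
  · rw [sub_zero, hp1] at hmono
    exact lt_of_le_of_ne hmono (mul_ne_zero (sub_ne_zero.2 hne) hm).symm
  · have hzm : IsMaximiser (supportBody g) z := ⟨hz, fun q hq => by rw [heq]; exact hp.2 q hq⟩
    exact hzm.apply_one_eq hg hf

/-- Near a maximiser of the first coordinate that is not a vertex, the boundary is the graph of
a function `φ` of the second coordinate, with a normal `(1, m y)` at height `y`, and the slope `m`
is continuous and vanishes at the maximiser. -/
lemma exists_local_graph (hg : IsSupportFun g)
    (hf : HasSubgradientDeriv (slopeSupport g) ρ y₀) (hp : IsMaximiser (supportBody g) p)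
    (hv : ¬ IsVertex (supportBody g) p) :
    ∃ r > 0, ∃ φ m : ℝ → ℝ, ∃ W : Set Plane, IsOpen W ∧ p ∈ W ∧
      (∀ y, |y - y₀| < r → !₂[φ y, y] ∈ frontier (supportBody g) ∧
        φ y + m y * y = slopeSupport g (m y) ∧ |m y| ≤ 1) ∧
      (∀ q ∈ frontier (supportBody g), q ∈ W → |q 1 - y₀| < r → q = !₂[φ (q 1), q 1]) ∧
      ∀ δ > 0, ∃ η > 0, ∀ y, |y - y₀| < η → |y - y₀| < r → |m y| ≤ δ := by
  have hcl : IsClosed (supportBody g) := isClosed_supportBody g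
  have hp1 := hp.apply_one_eq hg hf
  obtain ⟨b, hb, hbm, hb1, hb0⟩ := exists_support_point hg hf hp hv (one_ne_zero (α := ℝ))
  obtain ⟨a, ha, ham, ha1, ha0⟩ := exists_support_point hg hf hp hv
    (neg_ne_zero.2 (one_ne_zero (α := ℝ)))
  rw [mul_one] at hb1
  have ha1' : 0 < y₀ - a 1 := by linarith
  set X := max (a 0) (b 0) with hX
  have haX : a 0 ≤ X := le_max_left _ _
  have hbX : b 0 ≤ X := le_max_right _ _
  have hXp : X < p 0 := max_lt ha0 hb0
  -- a boundary point that is close to the maximiser has a normal of the form `(1, m)`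
  have hnormal : ∀ q ∈ frontier (supportBody g), X < q 0 → a 1 < q 1 → q 1 < b 1 →
      ∃ m, q 0 + m * q 1 = slopeSupport g m := by
    intro q hq hqX hqa hqb
    obtain ⟨u, hu1, hu⟩ := hg.exists_normal_of_mem_frontier hq
    have hin : ∀ z : Plane, inner ℝ z u = z 0 * u 0 + z 1 * u 1 := by
      intro z
      simp [PiLp.inner_apply, Fin.sum_univ_two, mul_comm]
    have hA := ha u
    have hB := hb u
    rw [← hu, hin, hin] at hA hB
    have hu0 : 0 < u 0 := by
      by_contra hle
      push Not at hle
      have h1 : u 1 = 0 := by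
        have h2 : (a 1 - q 1) * u 1 ≤ 0 := by nlinarith
        have h3 : (b 1 - q 1) * u 1 ≤ 0 := by nlinarith
        have h4 : 0 ≤ u 1 := by nlinarith
        have h5 : u 1 ≤ 0 := by nlinarith
        linarith
      have h2 : u 0 = 0 := by
        rw [h1] at hB
        nlinarith
      rw [EuclideanSpace.norm_eq, Fin.sum_univ_two, h1, h2] at hu1
      simp at hu1
    refine ⟨u 1 / u 0, ?_⟩
    have hue : u = (u 0) • (!₂[1, u 1 / u 0] : Plane) := by
      ext i
      fin_cases i
      · simp
      · simp; field_simp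
    have h1 : g u = u 0 * slopeSupport g (u 1 / u 0) := by
      conv_lhs => rw [hue]
      rw [hg.smul _ hu0.le, slopeSupport]
    rw [hin, h1] at hu
    refine mul_left_cancel₀ hu0.ne' ?_
    rw [← hu]; field_simp
  -- the radius in which the chords from the maximiser stay to the right of `X`
  set θ := (p 0 - X) / (2 * (p 0 - min (a 0) (b 0))) with hθ
  have hmin : min (a 0) (b 0) ≤ X := (min_le_left _ _).trans haX
  have hθ0 : 0 < θ := div_pos (by linarith) (by linarith)
  have hθ1 : θ ≤ 1 / 2 := by
    rw [hθ, div_le_div_iff₀ (by linarith) (by norm_num)]; linarith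
  have hθm : θ * (p 0 - min (a 0) (b 0)) = (p 0 - X) / 2 := by
    have : p 0 - min (a 0) (b 0) ≠ 0 := by linarith
    rw [hθ]; field_simp
  have hchord : ∀ e ∈ supportBody g, min (a 0) (b 0) ≤ e 0 → ∀ y,
      0 ≤ (y - y₀) / (e 1 - y₀) → (y - y₀) / (e 1 - y₀) ≤ θ → e 1 - y₀ ≠ 0 →
      ∃ z ∈ supportBody g, z 1 = y ∧ X < z 0 := by
    intro e he hemin y hs0 hsθ hne
    set s := (y - y₀) / (e 1 - y₀) with hs
    refine ⟨(1 - s) • p + s • e, convex_supportBody g hp.1 he (by linarith) hs0 (by ring), ?_, ?_⟩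
    · have : s * (e 1 - y₀) = y - y₀ := by rw [hs]; field_simp
      simp only [PiLp.add_apply, PiLp.smul_apply, smul_eq_mul, hp1]
      linarith
    · simp only [PiLp.add_apply, PiLp.smul_apply, smul_eq_mul]
      have h1 : s * (p 0 - e 0) ≤ θ * (p 0 - min (a 0) (b 0)) := by
        refine mul_le_mul hsθ (by linarith) ?_ hθ0.le
        by_contra hneg
        push Not at hneg
        linarith [hp.2 e he]
      rw [hθm] at h1
      linarith
  set r := θ * min (b 1 - y₀) (y₀ - a 1) with hr
  have hr0 : 0 < r := mul_pos hθ0 (lt_min hb1 ha1')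
  have hrb : r < b 1 - y₀ := by
    have := min_le_left (b 1 - y₀) (y₀ - a 1)
    have := lt_min hb1 ha1'
    nlinarith
  have hra : r < y₀ - a 1 := by
    have := min_le_right (b 1 - y₀) (y₀ - a 1)
    have := lt_min hb1 ha1'
    nlinarith
  have hpoint : ∀ y, |y - y₀| < r → ∃ z ∈ supportBody g, z 1 = y ∧ X < z 0 := by
    intro y hy
    rcases le_total 0 (y - y₀) with h | h
    · rw [abs_of_nonneg h] at hy
      refine hchord b hb (min_le_right _ _) y (div_nonneg h hb1.le) ?_ hb1.ne'
      rw [div_le_iff₀ hb1]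
      exact hy.le.trans (mul_le_mul_of_nonneg_left (min_le_left _ _) hθ0.le)
    · rw [abs_of_nonpos h] at hy
      have hneg : a 1 - y₀ < 0 := by linarith
      refine hchord a ha (min_le_left _ _) y (div_nonneg_of_nonpos h hneg.le) ?_ hneg.ne
      rw [← neg_div_neg_eq, neg_sub (a 1), div_le_iff₀ ha1']
      exact hy.le.trans (mul_le_mul_of_nonneg_left (min_le_right _ _) hθ0.le)
  have hIoo : ∀ y, |y - y₀| < r → a 1 < y ∧ y < b 1 := by
    intro y hy
    rw [abs_lt] at hy
    constructor <;> linarith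
  -- the topmost point over each height is a boundary point
  have htop : ∀ y, |y - y₀| < r → ∃ x m : ℝ, !₂[x, y] ∈ frontier (supportBody g) ∧
      x + m * y = slopeSupport g m := by
    intro y hy
    obtain ⟨z, hz, hz1, hz0⟩ := hpoint y hy
    have hcomp : IsCompact (supportBody g ∩ {q : Plane | q 1 = y}) :=
      hg.isCompact_supportBody.inter_right (isClosed_eq (by fun_prop) continuous_const)
    obtain ⟨w, ⟨hw, hw1⟩, hwmax⟩ := hcomp.exists_isMaxOn ⟨z, hz, hz1⟩
      (f := fun q : Plane => q 0) (by fun_prop)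
    have hw1' : w 1 = y := hw1
    have hwX : X < w 0 := hz0.trans_le (hwmax (show z ∈ _ from ⟨hz, hz1⟩))
    have hwf : w ∈ frontier (supportBody g) := by
      refine mem_frontier_of_forall_le hw ?_
      filter_upwards [self_mem_nhdsWithin] with s hs hmem
      have := hwmax (show w + s • (!₂[1, 0] : Plane) ∈ _ from ⟨hmem, by simp [hw1']⟩)
      simp at this
      exact absurd hs (not_lt.2 this)
    obtain ⟨m, hm⟩ := hnormal w hwf hwX (by rw [hw1']; exact (hIoo y hy).1)
      (by rw [hw1']; exact (hIoo y hy).2)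
    have hwe : w = !₂[w 0, y] := by
      ext i
      fin_cases i
      · simp
      · simpa using hw1'
    refine ⟨w 0, m, ?_, by rw [← hm, hw1']⟩
    rw [← hwe]; exact hwf
  choose! φ m hφf hφm using htop
  have hsub : ∀ y, |y - y₀| < r → IsSubgradientAt (slopeSupport g) (m y) y := by
    intro y hy
    have := isSubgradientAt_slopeSupport (m := m y) (hcl.frontier_subset (hφf y hy))
      (by simpa using hφm y hy)
    simpa using this
  have hbound : ∀ δ > 0, ∀ z ∈ supportBody g, ∀ z' ∈ supportBody g,
      z 0 + δ * z 1 = slopeSupport g δ → z' 0 + (-δ) * z' 1 = slopeSupport g (-δ) →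
      ∀ y, |y - y₀| < r → y < z 1 → z' 1 < y → |m y| ≤ δ := by
    intro δ hδ z hz z' hz' hzm hzm' y hy h1 h2
    have h3 := (hsub y hy).mul_sub_nonneg (isSubgradientAt_slopeSupport hz hzm)
    have h4 := (hsub y hy).mul_sub_nonneg (isSubgradientAt_slopeSupport hz' hzm')
    rw [abs_le]
    constructor <;> nlinarith
  refine ⟨r, hr0, φ, m, {q | X < q 0}, isOpen_lt continuous_const (by fun_prop), hXp,
    fun y hy => ⟨hφf y hy, hφm y hy,
      hbound 1 one_pos b hb a ha hbm ham y hy (hIoo y hy).2 (hIoo y hy).1⟩,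
    fun q hq hqW hqr => ?_, fun δ hδ => ?_⟩
  · obtain ⟨m', hm'⟩ := hnormal q hq hqW (hIoo _ hqr).1 (hIoo _ hqr).2
    have h1 := le_slopeSupport (hcl.frontier_subset (hφf _ hqr)) m'
    have h2 := le_slopeSupport (hcl.frontier_subset hq) (m (q 1))
    have h3 := hφm _ hqr
    simp at h1
    ext i
    fin_cases i
    · simp; linarith
    · simp
  · obtain ⟨z, hz, hzm, hz1, -⟩ := exists_support_point hg hf hp hv hδ.ne'
    obtain ⟨z', hz', hzm', hz1', -⟩ := exists_support_point hg hf hp hv (neg_ne_zero.2 hδ.ne')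
    have e1 : 0 < z 1 - y₀ := pos_of_mul_pos_left hz1 hδ.le
    have e2 : 0 < y₀ - z' 1 := by
      have : 0 < (y₀ - z' 1) * δ := by linarith
      exact pos_of_mul_pos_left this hδ.le
    refine ⟨min (z 1 - y₀) (y₀ - z' 1), lt_min e1 e2, fun y hy hyr => ?_⟩
    have h1 := hy.trans_le (min_le_left _ _)
    have h2 := hy.trans_le (min_le_right _ _)
    rw [abs_lt] at h1 h2
    exact hbound δ hδ z hz z' hz' hzm hzm' y hyr (by linarith) (by linarith)

end PlanarBody

/-! ### Arc length parametrization of a graph and existence of the curvature -/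

lemma lipschitzOnWith_graph {φ m : ℝ → ℝ} {s : Set ℝ} {M : ℝ}
    (hφ : ∀ y ∈ s, ∀ z ∈ s, φ z + m y * z ≤ φ y + m y * y) (hm : ∀ y ∈ s, |m y| ≤ M) :
    LipschitzOnWith (1 + M ^ 2).toNNReal (fun y => (!₂[φ y, y] : Plane)) s := by
  refine LipschitzOnWith.of_dist_le_mul fun y hy z hz => ?_
  have h1 : |φ y - φ z| ≤ M * |y - z| := by
    have e1 := hφ y hy z hz
    have e2 := hφ z hz y hy
    have b1 : |m y * (y - z)| ≤ M * |y - z| := by rw [abs_mul]; gcongr; exact hm y hy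
    have b2 : |m z * (y - z)| ≤ M * |y - z| := by rw [abs_mul]; gcongr; exact hm z hz
    rw [abs_le] at b1 b2 ⊢
    constructor <;> linarith
  rw [Real.coe_toNNReal _ (by positivity), EuclideanSpace.dist_eq, Fin.sum_univ_two,
    Real.dist_eq y z]
  refine Real.sqrt_le_iff.2 ⟨by positivity, ?_⟩
  have h2 : |φ y - φ z| ^ 2 ≤ (M * |y - z|) ^ 2 := by gcongr
  simp only [Matrix.cons_val_zero, Matrix.cons_val_one, Real.dist_eq]
  have h3 : 0 ≤ M ^ 2 * |y - z| ^ 2 := by positivity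
  have h4 : 0 ≤ M ^ 4 * |y - z| ^ 2 := by positivity
  nlinarith

/-- The parametrization by arc length `c` of a graph over the second coordinate, with the arc
length `ℓ` measured from `y₀`. -/
lemma exists_arcLength {γ : ℝ → Plane} {y₀ r : ℝ} (hr : 0 < r) (hγ : ∀ y, γ y 1 = y)
    {C : NNReal} (hL : LipschitzOnWith C γ (Ioo (y₀ - r) (y₀ + r))) :
    ∃ (c : ℝ → Plane) (ℓ : ℝ → ℝ), ℓ y₀ = 0 ∧
      (∀ y ∈ Ioo (y₀ - r) (y₀ + r), c (ℓ y) = γ y) ∧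
      (∀ y ∈ Ioo (y₀ - r) (y₀ + r), ∀ z ∈ Ioo (y₀ - r) (y₀ + r), y ≤ z → z - y ≤ ℓ z - ℓ y) ∧
      (∀ y ∈ Ioo (y₀ - r) (y₀ + r), ∀ z ∈ Ioo (y₀ - r) (y₀ + r), y ≤ z →
        ∀ C : NNReal, LipschitzOnWith C γ (Icc y z) → ℓ z - ℓ y ≤ C * (z - y)) ∧
      (∀ t, |t| < r / 2 → ∃ y ∈ Ioo (y₀ - r) (y₀ + r), ℓ y = t) ∧
      HasUnitSpeedOn c (Ioo (-(r / 2)) (r / 2)) := by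
  set J := Ioo (y₀ - r) (y₀ + r) with hJ
  have h0 : y₀ ∈ J := ⟨by linarith, by linarith⟩
  have hlb : LocallyBoundedVariationOn γ J := by
    intro a b ha hb
    refine ne_top_of_le_ne_top ?_
      (eVariationOn_le_of_lipschitzOnWith ha hb (hL.mono inter_subset_left))
    exact ENNReal.mul_ne_top ENNReal.coe_ne_top ENNReal.ofReal_ne_top
  set ℓ := variationOnFromTo γ J y₀ with hℓ
  have hdiff : ∀ y ∈ J, ∀ z ∈ J, y ≤ z → ℓ z - ℓ y = (eVariationOn γ (J ∩ Icc y z)).toReal := by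
    intro y hy z hz hyz
    have : ℓ y + variationOnFromTo γ J y z = ℓ z := variationOnFromTo.add hlb h0 hy hz
    rw [← variationOnFromTo.eq_of_le γ J hyz]; linarith
  have hlow : ∀ y ∈ J, ∀ z ∈ J, y ≤ z → z - y ≤ ℓ z - ℓ y := by
    intro y hy z hz hyz
    rw [hdiff y hy z hz hyz]
    have h1 := eVariationOn.edist_le γ (s := J ∩ Icc y z) (x := z) (y := y)
      ⟨hz, right_mem_Icc.2 hyz⟩ ⟨hy, left_mem_Icc.2 hyz⟩
    have h2 : dist (γ z) (γ y) ≤ (eVariationOn γ (J ∩ Icc y z)).toReal := by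
      rw [dist_edist]
      exact ENNReal.toReal_mono (hlb y z hy hz) h1
    refine le_trans ?_ h2
    have h3 := abs_apply_le_norm (γ z - γ y) 1
    rw [PiLp.sub_apply, hγ, hγ, ← dist_eq_norm] at h3
    exact (le_abs_self _).trans h3
  have hup : ∀ y ∈ J, ∀ z ∈ J, y ≤ z → ∀ C : NNReal, LipschitzOnWith C γ (Icc y z) →
      ℓ z - ℓ y ≤ C * (z - y) := by
    intro y hy z hz hyz C hC
    rw [hdiff y hy z hz hyz]
    have h1 := eVariationOn_le_of_lipschitzOnWith hy hz (hC.mono inter_subset_right)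
    have h2 := ENNReal.toReal_mono
      (ENNReal.mul_ne_top ENNReal.coe_ne_top ENNReal.ofReal_ne_top) h1
    rwa [ENNReal.toReal_mul, ENNReal.coe_toReal, ENNReal.toReal_ofReal (by linarith)] at h2
  have hℓ0 : ℓ y₀ = 0 := variationOnFromTo.self γ J y₀
  have hsurj : ∀ t, |t| < r / 2 → ∃ y ∈ J, ℓ y = t := by
    intro t ht
    have hsub : Icc (y₀ - r / 2) (y₀ + r / 2) ⊆ J :=
      fun y hy => ⟨by linarith [hy.1], by linarith [hy.2]⟩
    have hle : y₀ - r / 2 ≤ y₀ + r / 2 := by linarith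
    have hcont : ContinuousOn ℓ (Icc (y₀ - r / 2) (y₀ + r / 2)) := by
      have key : ∀ y ∈ Icc (y₀ - r / 2) (y₀ + r / 2), ∀ z ∈ Icc (y₀ - r / 2) (y₀ + r / 2), y ≤ z →
          |ℓ z - ℓ y| ≤ C * (z - y) := by
        intro y hy z hz hyz
        have h1 := hlow y (hsub hy) z (hsub hz) hyz
        rw [abs_of_nonneg (by linarith)]
        exact hup y (hsub hy) z (hsub hz) hyz C
          (hL.mono ((Icc_subset_Icc hy.1 hz.2).trans hsub))
      refine LipschitzOnWith.continuousOn (K := C) (LipschitzOnWith.of_dist_le_mul ?_)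
      intro y hy z hz
      rw [Real.dist_eq, Real.dist_eq]
      rcases le_total y z with h | h
      · rw [abs_sub_comm, abs_sub_comm y, abs_of_nonneg (sub_nonneg.2 h)]; exact key y hy z hz h
      · rw [abs_of_nonneg (sub_nonneg.2 h)]; exact key z hz y hy h
    have e1 := hlow _ (hsub (left_mem_Icc.2 hle)) _ h0 (by linarith)
    have e2 := hlow _ h0 _ (hsub (right_mem_Icc.2 hle)) (by linarith)
    rw [hℓ0] at e1 e2
    rw [abs_lt] at ht
    obtain ⟨y, hy, hyt⟩ := intermediate_value_Icc hle hcont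
      (show t ∈ Icc _ _ from ⟨by linarith, by linarith⟩)
    exact ⟨y, hsub hy, hyt⟩
  refine ⟨naturalParameterization γ J y₀, ℓ, hℓ0, fun y hy => ?_, hlow, hup, hsurj, ?_⟩
  · exact edist_eq_zero.1 (edist_naturalParameterization_eq_zero hlb h0 hy)
  · have h1 := has_unit_speed_naturalParameterization γ hlb h0
    have hIm : Ioo (-(r / 2)) (r / 2) ⊆ ℓ '' J := fun t ht => by
      obtain ⟨y, hy, h⟩ := hsurj t (abs_lt.2 ht)
      exact ⟨y, hy, h⟩
    intro x hx y hy
    rw [← h1 (hIm hx) (hIm hy)]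
    congr 1
    have h2 : Icc x y ⊆ Ioo (-(r / 2)) (r / 2) :=
      fun t ht => ⟨by linarith [ht.1, hx.1], by linarith [ht.2, hy.2]⟩
    rw [inter_eq_right.2 h2, inter_eq_right.2 (h2.trans hIm)]

/-- The first order condition along a curve in `K` with a point of support `c t`, and the bounds on
the vertical speed that come from the length of the graph. -/
lemma deriv_arcLength {K : Set Plane} {c : ℝ → Plane} {ε t a C m : ℝ} (ht : t ∈ Ioo (-ε) ε)
    (hcK : MapsTo c (Ioo (-ε) ε) K) (hcl : LipschitzOnWith 1 c (Ioo (-ε) ε))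
    (hm : ∀ q ∈ K, q 0 + m * q 1 ≤ c t 0 + m * c t 1) (ha : 0 < a)
    (hC : ∀ t' ∈ Ioo t (t + a), t' ∈ Ioo (-ε) ε → t' - t ≤ C * (c t' 1 - c t 1))
    (hd : DifferentiableAt ℝ c t) :
    deriv c t 0 = -(m * deriv c t 1) ∧ 1 ≤ C * deriv c t 1 ∧ deriv c t 1 ≤ 1 := by
  have hnhds : Ioo (-ε) ε ∈ 𝓝 t := Ioo_mem_nhds ht.1 ht.2
  have hdi : ∀ i, HasDerivAt (fun s => c s i) (deriv c t i) t := fun i =>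
    (EuclideanSpace.proj (𝕜 := ℝ) i).hasFDerivAt.comp_hasDerivAt t hd.hasDerivAt
  refine ⟨?_, ?_, ?_⟩
  · have h1 : HasDerivAt (fun s => c s 0 + m * c s 1) (deriv c t 0 + m * deriv c t 1) t :=
      (hdi 0).fun_add ((hdi 1).const_mul m)
    have h2 : IsLocalMax (fun s => c s 0 + m * c s 1) t := by
      filter_upwards [hnhds] with s hs using hm _ (hcK hs)
    linarith [h2.hasDerivAt_eq_zero h1]
  · have h1 := (hasDerivAt_iff_tendsto_slope.1 ((hdi 1).const_mul C)).mono_left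
      (nhdsWithin_mono t (fun s hs => (ne_of_gt hs : s ≠ t)) : 𝓝[>] t ≤ 𝓝[≠] t)
    refine ge_of_tendsto h1 ?_
    have h2 : Ioo t (t + a) ∈ 𝓝[>] t := Ioo_mem_nhdsGT (by linarith)
    filter_upwards [h2, mem_nhdsWithin_of_mem_nhds hnhds] with s hs hs'
    rw [slope_def_field, le_div_iff₀ (by linarith [hs.1])]
    have := hC s hs hs'
    linarith
  · have h1 : ‖deriv c t‖ ≤ ((1 : NNReal) : ℝ) := norm_deriv_le_of_lipschitzOn hnhds hcl
    rw [NNReal.coe_one] at h1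
    exact ((le_abs_self _).trans (abs_apply_le_norm _ 1)).trans h1

lemma norm_le_abs_add_abs (z : Plane) : ‖z‖ ≤ |z 0| + |z 1| := by
  rw [EuclideanSpace.norm_eq, Fin.sum_univ_two]
  refine Real.sqrt_le_iff.2 ⟨by positivity, ?_⟩
  simp only [Real.norm_eq_abs]
  nlinarith [abs_nonneg (z 0), abs_nonneg (z 1)]

set_option maxHeartbeats 1000000 in
/-- If the subdifferential of the support function is differentiable in the direction `(1, 0)`,
then the boundary of the body has a curvature at the maximiser of the first coordinate, namely the
inverse of the derivative. -/
theorem exists_hasCurvatureAt {g : Plane → ℝ} {ρ y₀ : ℝ} {p : Plane} (hg : IsSupportFun g)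
    (hf : HasSubgradientDeriv (slopeSupport g) ρ y₀) (hp : IsMaximiser (supportBody g) p) :
    ∃ κ, HasCurvatureAt (supportBody g) p κ := by
  by_cases hv : IsVertex (supportBody g) p
  · exact ⟨∞, Or.inl ⟨hv, rfl⟩⟩
  have hcl : IsClosed (supportBody g) := isClosed_supportBody g
  obtain ⟨r, hr, φ, m, W, hWo, hpW, hgraph, hloc, hsmall⟩ := exists_local_graph hg hf hp hv
  have hp1 := hp.apply_one_eq hg hf
  have hp0 := hp.slopeSupport_zero hg
  set γ : ℝ → Plane := fun y => !₂[φ y, y] with hγ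
  have hmem : ∀ y, y ∈ Ioo (y₀ - r) (y₀ + r) ↔ |y - y₀| < r := by
    intro y
    rw [abs_lt, mem_Ioo]
    constructor <;> rintro ⟨h1, h2⟩ <;> constructor <;> linarith
  have hγK : ∀ y, |y - y₀| < r → γ y ∈ supportBody g :=
    fun y hy => hcl.frontier_subset (hgraph y hy).1
  have hsupp : ∀ y, |y - y₀| < r → ∀ q ∈ supportBody g, q 0 + m y * q 1 ≤ φ y + m y * y := by
    intro y hy q hq
    rw [(hgraph y hy).2.1]
    exact le_slopeSupport hq _
  have hsub : ∀ y, |y - y₀| < r → IsSubgradientAt (slopeSupport g) (m y) y := by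
    intro y hy
    have := isSubgradientAt_slopeSupport (m := m y) (hγK y hy)
      (by simpa [hγ] using (hgraph y hy).2.1)
    simpa [hγ] using this
  have hlipM : ∀ s : Set ℝ, ∀ M : ℝ, (∀ y ∈ s, |y - y₀| < r ∧ |m y| ≤ M) →
      LipschitzOnWith (1 + M ^ 2).toNNReal γ s := by
    intro s M hs
    refine lipschitzOnWith_graph (m := m) (fun y hy z hz => ?_) fun y hy => (hs y hy).2
    simpa [hγ] using hsupp y (hs y hy).1 (γ z) (hγK z (hs z hz).1)
  have hlip1 := hlipM (Ioo (y₀ - r) (y₀ + r)) 1 fun y hy =>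
    ⟨(hmem y).1 hy, (hgraph y ((hmem y).1 hy)).2.2⟩
  obtain ⟨c, ℓ, hℓ0, hcℓ, hlow, hup, hsurj, hunit⟩ :=
    exists_arcLength hr (γ := γ) (fun y => by simp [hγ]) hlip1
  have h0J : y₀ ∈ Ioo (y₀ - r) (y₀ + r) := (hmem y₀).2 (by simpa using hr)
  have hpγ : p = γ y₀ := by
    have hpf := mem_frontier_of_support hp.1 (m := 0) (by rw [hp0]; ring)
    have := hloc p hpf hpW (by simpa [hp1] using hr)
    rwa [hp1] at this
  have hc0 : c 0 = p := by rw [← hℓ0, hcℓ y₀ h0J, hpγ]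
  have hφ0 : φ y₀ = p 0 := by rw [hpγ]; simp [hγ]
  -- comparison of the arc length with the height
  have habs : ∀ y, |y - y₀| < r → |y - y₀| ≤ |ℓ y| := by
    intro y hy
    rcases le_total y₀ y with h | h
    · have := hlow y₀ h0J y ((hmem y).2 hy) h
      rw [hℓ0] at this
      rw [abs_of_nonneg (by linarith), abs_of_nonneg (by linarith)]; linarith
    · have := hlow y ((hmem y).2 hy) y₀ h0J h
      rw [hℓ0] at this
      rw [abs_of_nonpos (by linarith), abs_of_nonpos (by linarith)]; linarith
  have hdev : ∀ y, |y - y₀| < r → ∀ M, (∀ z, |z - y₀| ≤ |y - y₀| → |m z| ≤ M) →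
      |ℓ y - (y - y₀)| ≤ M ^ 2 * |y - y₀| := by
    intro y hy M hM
    rcases le_total y₀ y with h | h
    · have h1 := hlow y₀ h0J y ((hmem y).2 hy) h
      have h2 := hup y₀ h0J y ((hmem y).2 hy) h _ (hlipM (Icc y₀ y) M fun z hz => by
        have : |z - y₀| ≤ |y - y₀| := by
          rw [abs_of_nonneg (by linarith [hz.1]), abs_of_nonneg (by linarith)]; linarith [hz.2]
        exact ⟨this.trans_lt hy, hM z this⟩)
      rw [hℓ0] at h1 h2
      rw [Real.coe_toNNReal _ (by positivity)] at h2
      rw [abs_of_nonneg (by linarith), abs_of_nonneg (by linarith)]; linarith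
    · have h1 := hlow y ((hmem y).2 hy) y₀ h0J h
      have h2 := hup y ((hmem y).2 hy) y₀ h0J h _ (hlipM (Icc y y₀) M fun z hz => by
        have : |z - y₀| ≤ |y - y₀| := by
          rw [abs_of_nonpos (by linarith [hz.2]), abs_of_nonpos (by linarith)]; linarith [hz.1]
        exact ⟨this.trans_lt hy, hM z this⟩)
      rw [hℓ0] at h1 h2
      rw [Real.coe_toNNReal _ (by positivity)] at h2
      rw [abs_of_nonpos (by linarith), abs_of_nonpos (by linarith)]; linarith
  have hcK : MapsTo c (Ioo (-(r / 2)) (r / 2)) (frontier (supportBody g)) := by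
    intro t ht
    obtain ⟨y, hy, rfl⟩ := hsurj t (abs_lt.2 ht)
    rw [hcℓ y hy]
    exact (hgraph y ((hmem y).1 hy)).1
  have hparam : IsArcLengthParam (supportBody g) p c := by
    refine ⟨hc0, r / 2, by positivity, ?_, hcK, ?_, hunit⟩
    · intro t ht t' ht' htt
      obtain ⟨y, hy, rfl⟩ := hsurj t (abs_lt.2 ht)
      obtain ⟨y', hy', rfl⟩ := hsurj t' (abs_lt.2 ht')
      rw [hcℓ y hy, hcℓ y' hy'] at htt
      have : y = y' := by simpa [hγ] using congrArg (fun q : Plane => q 1) htt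
      rw [this]
    · have hO : IsOpen (W ∩ {q : Plane | |q 1 - y₀| < r / 4}) :=
        hWo.inter (isOpen_lt (by fun_prop) continuous_const)
      have hpO : p ∈ W ∩ {q : Plane | |q 1 - y₀| < r / 4} := ⟨hpW, by simpa [hp1] using hr⟩
      refine mem_of_superset (inter_mem_nhdsWithin _ (hO.mem_nhds hpO)) ?_
      rintro q ⟨hqf, hqW, hq⟩
      have hq' : |q 1 - y₀| < r / 4 := hq
      have hqr : |q 1 - y₀| < r := by linarith
      refine ⟨ℓ (q 1), ?_, ?_⟩
      · have h1 := hdev (q 1) hqr 1 fun z hz => (hgraph z (hz.trans_lt hqr)).2.2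
        have h2 := abs_sub_abs_le_abs_sub (ℓ (q 1)) (q 1 - y₀)
        exact abs_lt.1 (by linarith)
      · rw [hcℓ _ ((hmem _).2 hqr)]
        exact (hloc q hqf hqW hqr).symm
  have hpack : ∀ s M, (∀ z, |z - y₀| < s → |z - y₀| < r → |m z| ≤ M) → ∀ t, |t| < r / 2 → |t| < s →
      ∃ y, |y - y₀| < r ∧ |y - y₀| ≤ |t| ∧ |t - (y - y₀)| ≤ M ^ 2 * |y - y₀| ∧ c t = γ y ∧
        (DifferentiableAt ℝ c t → deriv c t 0 = -(m y * deriv c t 1) ∧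
          1 ≤ (1 + M ^ 2) * deriv c t 1 ∧ deriv c t 1 ≤ 1) := by
    intro s M hM t ht hts
    obtain ⟨y, hy, hyt⟩ := hsurj t ht
    have hyr := (hmem y).1 hy
    have hyt' : |y - y₀| ≤ |t| := by rw [← hyt]; exact habs y hyr
    have hct : c t = γ y := by rw [← hyt, hcℓ y hy]
    refine ⟨y, hyr, hyt', ?_, hct, fun hd => ?_⟩
    · have := hdev y hyr M fun z hz => hM z (by linarith) (by linarith)
      rwa [hyt] at this
    · refine deriv_arcLength (K := supportBody g) (abs_lt.1 ht)
        (fun s hs => hcl.frontier_subset (hcK hs)) hunit.lipschitzOnWith ?_ (sub_pos.2 hts) ?_ hd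
      · intro q hq
        rw [hct]
        simpa [hγ] using hsupp y hyr q hq
      · intro t' ht' htr
        obtain ⟨y', hy', hyt2⟩ := hsurj t' (abs_lt.2 htr)
        have hyr' := (hmem y').1 hy'
        have hts' : |t'| < s := by
          have h1 := ht'.2
          have h2 := ht'.1
          rw [abs_lt] at hts ⊢
          constructor
          · linarith
          · have := le_abs_self t
            linarith
        have hys' := (habs y' hyr').trans_lt (by rw [hyt2]; exact hts')
        have hys := hyt'.trans_lt hts
        have hyy : y ≤ y' := by
          by_contra hlt
          push Not at hlt
          have := hlow y' hy' y hy hlt.le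
          have := ht'.1
          linarith
        have h1 := hup y hy y' hy' hyy _ (hlipM (Icc y y') M fun z hz => by
          have hz1 : |z - y₀| < s := by
            rw [abs_lt] at hys hys' ⊢
            constructor <;> linarith [hz.1, hz.2]
          have hz2 : |z - y₀| < r := by
            rw [abs_lt] at hyr hyr' ⊢
            constructor <;> linarith [hz.1, hz.2]
          exact ⟨hz2, hM z hz1 hz2⟩)
        rw [Real.coe_toNNReal _ (by positivity), hyt, hyt2] at h1
        rw [hct, ← hyt2, hcℓ y' hy']
        simpa [hγ, hyt2] using h1
  -- the tangent at the maximiser is vertical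
  have hd0 : HasDerivAt c !₂[0, 1] 0 := by
    rw [hasDerivAt_iff_isLittleO, Asymptotics.isLittleO_iff]
    intro ε hε
    set δ := min (ε / 2) 1 with hδ
    have hδ0 : 0 < δ := by positivity
    have hδ1 : δ ≤ 1 := min_le_right _ _
    have hδ2 : δ ≤ ε / 2 := min_le_left _ _
    obtain ⟨η, hη, hηm⟩ := hsmall δ hδ0
    filter_upwards [Metric.ball_mem_nhds (0 : ℝ) (lt_min (half_pos hr) hη)] with t ht
    rw [Metric.mem_ball, Real.dist_eq, sub_zero] at ht
    obtain ⟨y, hyr, hyt, htdev, hct, -⟩ := hpack η δ hηm t (ht.trans_le (min_le_left _ _))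
      (ht.trans_le (min_le_right _ _))
    have hmy : |m y| ≤ δ := hηm y (hyt.trans_lt (ht.trans_le (min_le_right _ _))) hyr
    have e1 : |φ y - φ y₀| ≤ δ * |y - y₀| := by
      have h1 := hsupp y hyr (γ y₀) (hγK y₀ (by simpa using hr))
      have h2 := hp.2 _ (hγK y hyr)
      rw [← hφ0] at h2
      simp [hγ] at h1 h2
      have h3 : |m y * (y - y₀)| ≤ δ * |y - y₀| := by rw [abs_mul]; gcongr
      rw [abs_le] at h3 ⊢
      constructor <;> nlinarith
    refine (norm_le_abs_add_abs _).trans ?_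
    rw [hct, hc0, hpγ, sub_zero, Real.norm_eq_abs]
    have e3 : |y - y₀ - t| ≤ δ * |t| := by
      rw [abs_sub_comm]
      calc |t - (y - y₀)| ≤ δ ^ 2 * |y - y₀| := htdev
        _ ≤ δ * |t| := by
          have : δ ^ 2 ≤ δ := by nlinarith
          gcongr
    have e4 : δ * |y - y₀| ≤ δ * |t| := by gcongr
    have e5 : 2 * (δ * |t|) ≤ ε * |t| := by
      have := abs_nonneg t
      nlinarith
    simp [hγ]
    linarith
  have hmono : ∀ y, |y - y₀| < r → 0 ≤ (y - y₀) * m y := by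
    intro y hy
    have h0 := isSubgradientAt_slopeSupport hp.1 (m := 0) (by rw [hp0]; ring)
    have := (hsub y hy).mul_sub_nonneg h0
    rwa [hp1, sub_zero] at this
  have hder : ∀ ε > 0, ∃ η > 0, ∀ y, |y - y₀| < η → |y - y₀| < r →
      |y - y₀ - ρ * m y| ≤ ε * |m y| := by
    intro ε hε
    obtain ⟨δ, hδ, hδf⟩ := hf ε hε
    obtain ⟨η, hη, hηm⟩ := hsmall (δ / 2) (half_pos hδ)
    exact ⟨η, hη, fun y hy hyr => hδf _ _ (by linarith [hηm y hy hyr]) (hsub y hyr)⟩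
  have hρ : 0 ≤ ρ := by
    by_contra hneg
    push Not at hneg
    obtain ⟨η, hη, hηd⟩ := hder (-ρ) (by linarith)
    set y := y₀ + min η r / 2 with hy
    have hmin : 0 < min η r := lt_min hη hr
    have hyy : |y - y₀| = min η r / 2 := by rw [hy, add_sub_cancel_left, abs_of_pos (half_pos hmin)]
    have h1 := min_le_left η r
    have h2 := min_le_right η r
    have h3 := hηd y (by linarith) (by linarith)
    have h4 := hmono y (by linarith)
    have h5 : y - y₀ = min η r / 2 := by rw [hy]; ring
    rw [h5] at h3 h4
    have h6 : 0 ≤ m y := nonneg_of_mul_nonneg_right h4 (half_pos hmin)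
    rw [abs_of_nonneg h6] at h3
    have := (abs_le.1 h3).2
    linarith
  rcases hρ.eq_or_lt with hρ0 | hρ0
  · -- the slope grows faster than the arc length
    refine ⟨∞, Or.inr ⟨c, hparam, hd0.differentiableAt, Or.inr ⟨?_, rfl⟩⟩⟩
    rw [tendsto_atTop]
    intro B
    obtain ⟨η, hη, hηd⟩ := hder (1 / (4 * (|B| + 1))) (by positivity)
    have hball : Metric.ball (0 : ℝ) (min (r / 2) η) ∈ 𝓝[{t | DifferentiableAt ℝ c t} \ {0}] 0 :=
      mem_nhdsWithin_of_mem_nhds (Metric.ball_mem_nhds _ (lt_min (half_pos hr) hη))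
    filter_upwards [hball, self_mem_nhdsWithin] with t ht htD
    rw [Metric.mem_ball, Real.dist_eq, sub_zero] at ht
    obtain ⟨y, hyr, hyt, htdev, hct, hdc⟩ := hpack (r / 2) 1
      (fun z _ hz => (hgraph z hz).2.2) t (ht.trans_le (min_le_left _ _))
      (ht.trans_le (min_le_left _ _))
    obtain ⟨d0, d1, -⟩ := hdc htD.1
    have ht0 : 0 < |t| := abs_pos.2 htD.2
    have h1 := hηd y (hyt.trans_lt (ht.trans_le (min_le_right _ _))) hyr
    rw [← hρ0, zero_mul, sub_zero, div_mul_eq_mul_div, one_mul, le_div_iff₀ (by positivity)] at h1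
    have h2 : |t| ≤ 2 * |y - y₀| := by
      have := abs_sub_abs_le_abs_sub t (y - y₀)
      linarith
    have h3 : |t⁻¹ * (-(m y * deriv c t 1))| ≤ ‖t⁻¹ • (deriv c t - deriv c 0)‖ := by
      have := abs_apply_le_norm (t⁻¹ • (deriv c t - deriv c 0)) 0
      rw [hd0.deriv] at this ⊢
      simpa [d0] using this
    refine le_trans ?_ h3
    rw [abs_mul, abs_inv, abs_neg, abs_mul, abs_of_nonneg (by linarith : 0 ≤ deriv c t 1),
      ← div_eq_inv_mul, le_div_iff₀ ht0]
    have h4 : |m y| / 2 ≤ |m y| * deriv c t 1 := by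
      have := abs_nonneg (m y)
      nlinarith
    have h5 : B * |t| ≤ |B| * |t| := by gcongr; exact le_abs_self B
    have h6 : |B| * |t| ≤ |B| * (2 * |y - y₀|) := by gcongr
    have h7 := abs_nonneg (y - y₀)
    nlinarith
  · -- the slope is asymptotic to the arc length divided by `ρ`
    refine ⟨‖(!₂[-1 / ρ, 0] : Plane)‖ₑ, Or.inr ⟨c, hparam, hd0.differentiableAt,
      Or.inl ⟨!₂[-1 / ρ, 0], ?_, rfl⟩⟩⟩
    rw [hasDerivWithinAt_iff_isLittleO, Asymptotics.isLittleO_iff]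
    intro ε hε
    set ε' := min (ρ / 2) (ε * ρ ^ 2 / 4) with hε'
    have hε'0 : 0 < ε' := by positivity
    obtain ⟨η, hη, hηd⟩ := hder ε' hε'0
    -- a bound for the slope in terms of the height
    have hmy : ∀ y, |y - y₀| < η → |y - y₀| < r → |m y| ≤ 2 / ρ * |y - y₀| := by
      intro y hy hyr
      have h1 := hηd y hy hyr
      have h2 : ε' * |m y| ≤ ρ / 2 * |m y| := by gcongr; exact min_le_left _ _
      have h3 := abs_sub_abs_le_abs_sub (ρ * m y) (y - y₀)
      rw [abs_sub_comm (ρ * m y), abs_mul, abs_of_pos hρ0] at h3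
      rw [div_mul_eq_mul_div, le_div_iff₀ hρ0]
      linarith
    set A := 16 / ρ ^ 2 * (2 / ρ * (r / 2) + r / 2 / ρ + 1) with hA
    have hA0 : 0 < A := by positivity
    have hball : Metric.ball (0 : ℝ) (min (min (r / 2) (η / 2)) (ε / (2 * A))) ∈
        𝓝[{t | DifferentiableAt ℝ c t}] 0 :=
      mem_nhdsWithin_of_mem_nhds (Metric.ball_mem_nhds _ (by positivity))
    filter_upwards [hball, self_mem_nhdsWithin] with t ht htD
    rw [Metric.mem_ball, Real.dist_eq, sub_zero] at ht
    have ht1 : |t| < r / 2 := ht.trans_le ((min_le_left _ _).trans (min_le_left _ _))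
    have ht2 : |t| < η / 2 := ht.trans_le ((min_le_left _ _).trans (min_le_right _ _))
    have ht3 := (ht.trans_le (min_le_right _ _)).le
    rw [le_div_iff₀ (by positivity)] at ht3
    by_cases ht0 : t = 0
    · subst ht0; simp
    have htpos : 0 < |t| := abs_pos.2 ht0
    set M := 4 / ρ * |t| with hM
    have hM0 : 0 < M := by positivity
    obtain ⟨y, hyr, hyt, htdev, hct, hdc⟩ := hpack (2 * |t|) M
      (fun z hz hzr => by
        refine (hmy z (by linarith) hzr).trans ?_
        rw [hM, show 4 / ρ * |t| = 2 / ρ * (2 * |t|) by ring]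
        gcongr) t ht1 (by linarith)
    obtain ⟨d0, d1, d2⟩ := hdc htD
    have hmy' := hmy y (by linarith) hyr
    have hy1 := hηd y (by linarith) hyr
    have hmt : |m y| ≤ 2 / ρ * |t| := hmy'.trans (by gcongr)
    have hdy : |deriv c t 1 - 1| ≤ M ^ 2 := by
      rw [abs_le]
      constructor <;> nlinarith [sq_nonneg M]
    have hM2 : M ^ 2 = 16 / ρ ^ 2 * |t| * |t| := by rw [hM]; ring
    have e0 : |-(m y * deriv c t 1) + t / ρ| ≤
        (2 / ρ * |t|) * M ^ 2 + M ^ 2 * |t| / ρ + ε' * (2 / ρ * |t|) / ρ := by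
      have hsplit : -(m y * deriv c t 1) + t / ρ =
          -(m y * (deriv c t 1 - 1)) + (t - (y - y₀)) / ρ + (y - y₀ - ρ * m y) / ρ := by
        field_simp; ring
      rw [hsplit]
      refine (abs_add_three _ _ _).trans ?_
      rw [abs_neg, abs_mul, abs_div, abs_div, abs_of_pos hρ0]
      gcongr
      · exact htdev.trans (by gcongr)
      · exact hy1.trans (by gcongr)
    have e1 : ε' * (2 / ρ * |t|) / ρ ≤ ε / 2 * |t| := by
      calc ε' * (2 / ρ * |t|) / ρ ≤ (ε * ρ ^ 2 / 4) * (2 / ρ * |t|) / ρ := by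
            gcongr; exact min_le_right _ _
        _ = ε / 2 * |t| := by field_simp; ring
    have e2 : (2 / ρ * |t|) * M ^ 2 + M ^ 2 * |t| / ρ + M ^ 2 ≤ A * |t| * |t| := by
      rw [hM2, hA]
      calc (2 / ρ * |t|) * (16 / ρ ^ 2 * |t| * |t|) + (16 / ρ ^ 2 * |t| * |t|) * |t| / ρ +
            16 / ρ ^ 2 * |t| * |t| = 16 / ρ ^ 2 * (2 / ρ * |t| + |t| / ρ + 1) * |t| * |t| := by ring
        _ ≤ _ := by gcongr
    have e3 : A * |t| * |t| ≤ ε / 2 * |t| := by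
      have : A * |t| ≤ ε / 2 := by linarith
      gcongr
    refine (norm_le_abs_add_abs _).trans ?_
    rw [hd0.deriv, sub_zero, Real.norm_eq_abs]
    have c0 : (deriv c t - (!₂[0, 1] : Plane) - t • (!₂[-1 / ρ, 0] : Plane)) 0 =
        -(m y * deriv c t 1) + t / ρ := by
      simp [d0]; ring
    have c1 : (deriv c t - (!₂[0, 1] : Plane) - t • (!₂[-1 / ρ, 0] : Plane)) 1 =
        deriv c t 1 - 1 := by
      simp
    rw [c0, c1]
    linarith

/-! ### Almost everywhere second differentiability along lines -/

section Line

variable {E : Type*} [NormedAddCommGroup E] [NormedSpace ℝ E] {h : E → ℝ}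

lemma IsSupportFun.convexOn_line (hh : IsSupportFun h) (S T : E) :
    ConvexOn ℝ univ fun t : ℝ => h (S + t • T) := by
  refine ⟨convex_univ, fun x _ y _ a b ha hb hab => ?_⟩
  have := hh.convexOn.2 (mem_univ (S + x • T)) (mem_univ (S + y • T)) ha hb hab
  refine le_trans (le_of_eq ?_) this
  rw [smul_add, smul_add, add_add_add_comm, ← add_smul, hab, one_smul, smul_smul, smul_smul,
    ← add_smul]
  rfl

/-- The right derivative of `h` at `S` in the direction `T`. -/
noncomputable def rightSlope (h : E → ℝ) (S T : E) : ℝ :=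
  derivWithin (fun t : ℝ => h (S + t • T)) (Ioi 0) 0

lemma IsSupportFun.rightSlope_add_smul (hh : IsSupportFun h) (S T : E) (t : ℝ) :
    rightSlope h (S + t • T) T = derivWithin (fun t : ℝ => h (S + t • T)) (Ioi t) t := by
  have h1 := (hh.convexOn_line S T).hasDerivWithinAt_rightDeriv_of_mem_interior (x := t) (by simp)
  have h2 : HasDerivWithinAt (fun s : ℝ => t + s) 1 (Ioi 0) 0 :=
    ((hasDerivAt_id (0 : ℝ)).const_add t).hasDerivWithinAt
  have h1' : HasDerivWithinAt (fun t : ℝ => h (S + t • T))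
      (derivWithin (fun t : ℝ => h (S + t • T)) (Ioi t) t) (Ioi t) (t + 0) := by rwa [add_zero]
  have h3 := h1'.comp (0 : ℝ) h2 (fun s hs => by
    have : (0 : ℝ) < s := hs
    simpa using this)
  rw [mul_one] at h3
  rw [rightSlope, ← h3.derivWithin (uniqueDiffWithinAt_Ioi 0)]
  congr 1
  funext s
  simp only [Function.comp, add_smul, add_assoc]

lemma IsSupportFun.monotone_rightSlope (hh : IsSupportFun h) (S T : E) :
    Monotone fun t : ℝ => rightSlope h (S + t • T) T := by
  intro a b hab
  simp only [hh.rightSlope_add_smul]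
  exact (hh.convexOn_line S T).monotoneOn_rightDeriv (by simp) (by simp) hab

lemma IsSubgradientAt.le_rightSlope (hh : IsSupportFun h) {S T : E} {m y : ℝ}
    (hy : IsSubgradientAt (fun t : ℝ => h (S + t • T)) m y) :
    y ≤ rightSlope h (S + m • T) T := by
  rw [hh.rightSlope_add_smul]
  have h1 := (hh.convexOn_line S T).hasDerivWithinAt_rightDeriv_of_mem_interior (x := m) (by simp)
  rw [hasDerivWithinAt_iff_tendsto_slope' self_notMem_Ioi] at h1
  refine ge_of_tendsto h1 ?_
  filter_upwards [self_mem_nhdsWithin] with s hs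
  have hs' : m < s := hs
  rw [slope_def_field, le_div_iff₀ (by linarith)]
  have := hy s
  linarith

lemma IsSubgradientAt.rightSlope_le (hh : IsSupportFun h) {S T : E} {m y r : ℝ}
    (hy : IsSubgradientAt (fun t : ℝ => h (S + t • T)) m y) (hr : r < m) :
    rightSlope h (S + r • T) T ≤ y := by
  rw [hh.rightSlope_add_smul]
  refine ((hh.convexOn_line S T).rightDeriv_le_slope_of_mem_interior (by simp) (mem_univ m)
    hr).trans ?_
  rw [slope_def_field, div_le_iff₀ (by linarith)]
  have := hy r
  linarith

/-- The difference quotients of the right derivative of `h` along the line `S + ℝ T` converge. They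
are taken at rational parameters, so that the set of such pairs `(S, T)` is visibly measurable. -/
def HasLineSecondDeriv (h : E → ℝ) (S T : E) : Prop :=
  ∃ ρ : ℝ, Tendsto (fun q : ℚ => (rightSlope h (S + (q : ℝ) • T) T - rightSlope h S T) / (q : ℝ))
    (comap (fun q : ℚ => (q : ℝ)) (𝓝[≠] 0)) (𝓝 ρ)

lemma HasLineSecondDeriv.exists_hasSubgradientDeriv (hh : IsSupportFun h) {S T : E}
    (hST : HasLineSecondDeriv h S T) :
    ∃ ρ y₀, HasSubgradientDeriv (fun t : ℝ => h (S + t • T)) ρ y₀ := by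
  obtain ⟨ρ, hρ⟩ := hST
  refine ⟨ρ, rightSlope h S T, fun ε hε => ?_⟩
  have h1 := Metric.tendsto_nhds.1 hρ ε hε
  rw [eventually_comap, eventually_nhdsWithin_iff, Metric.eventually_nhds_iff] at h1
  obtain ⟨δ, hδ, h1⟩ := h1
  have h2 : ∀ q : ℚ, (q : ℝ) ≠ 0 → |(q : ℝ)| < δ →
      |rightSlope h (S + (q : ℝ) • T) T - rightSlope h S T - ρ * q| ≤ ε * |(q : ℝ)| := by
    intro q hq hqδ
    have h3 := (h1 (y := (q : ℝ)) (by rwa [Real.dist_eq, sub_zero]) hq q rfl).le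
    rw [Real.dist_eq] at h3
    have h4 : rightSlope h (S + (q : ℝ) • T) T - rightSlope h S T - ρ * q =
        ((rightSlope h (S + (q : ℝ) • T) T - rightSlope h S T) / q - ρ) * q := by
      field_simp
    rw [h4, abs_mul]
    gcongr
  refine ⟨δ, hδ, fun m y hm hy => ?_⟩
  rw [abs_lt] at hm
  rw [abs_le]
  -- rational points on either side of `m`, arbitrarily close to it and different from `0`
  have hside : ∀ U : Set ℝ, U ∈ 𝓝 m →
      (∃ q : ℚ, (q : ℝ) ∈ U ∧ (q : ℝ) ≠ 0 ∧ |(q : ℝ)| < δ ∧ m < q) ∧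
      (∃ q : ℚ, (q : ℝ) ∈ U ∧ (q : ℝ) ≠ 0 ∧ |(q : ℝ)| < δ ∧ (q : ℝ) < m) := by
    intro U hU
    obtain ⟨θ, hθ, hθU⟩ := Metric.mem_nhds_iff.1 hU
    constructor
    · obtain ⟨b, hb1, hb2, hb3⟩ : ∃ b, m < b ∧ b ≤ δ ∧ (b ≤ 0 ∨ 0 ≤ m) := by
        rcases lt_or_ge m 0 with h | h
        · exact ⟨0, h, hδ.le, Or.inl le_rfl⟩
        · exact ⟨δ, hm.2, le_rfl, Or.inr h⟩
      obtain ⟨q, hq1, hq2⟩ := exists_rat_btwn (lt_min hb1 (by linarith : m < m + θ))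
      have e1 := hq2.trans_le (min_le_left _ _)
      have e2 := hq2.trans_le (min_le_right _ _)
      refine ⟨q, hθU ?_, ?_, ?_, hq1⟩
      · rw [Metric.mem_ball, Real.dist_eq, abs_lt]; constructor <;> linarith
      · rcases hb3 with h | h
        · exact (e1.trans_le h).ne
        · exact (h.trans_lt hq1).ne'
      · rw [abs_lt]; constructor <;> linarith
    · obtain ⟨b, hb1, hb2, hb3⟩ : ∃ b, b < m ∧ -δ ≤ b ∧ (0 ≤ b ∨ m ≤ 0) := by
        rcases lt_or_ge 0 m with h | h
        · exact ⟨0, h, by linarith, Or.inl le_rfl⟩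
        · exact ⟨-δ, hm.1, le_rfl, Or.inr h⟩
      obtain ⟨q, hq1, hq2⟩ := exists_rat_btwn (max_lt hb1 (by linarith : m - θ < m))
      have e1 := (le_max_left _ _).trans_lt hq1
      have e2 := (le_max_right _ _).trans_lt hq1
      refine ⟨q, hθU ?_, ?_, ?_, hq2⟩
      · rw [Metric.mem_ball, Real.dist_eq, abs_lt]; constructor <;> linarith
      · rcases hb3 with h | h
        · exact (h.trans_lt e1).ne'
        · exact (hq2.trans_le h).ne
      · rw [abs_lt]; constructor <;> linarith
  constructor
  · by_contra hlt
    push Not at hlt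
    have hU : {s : ℝ | y < rightSlope h S T + ρ * s - ε * |s|} ∈ 𝓝 m :=
      (isOpen_lt continuous_const (by fun_prop)).mem_nhds (by
        show y < rightSlope h S T + ρ * m - ε * |m|
        linarith)
    obtain ⟨q, hqU, hq0, hqδ, hqm⟩ := (hside _ hU).2
    have e1 := hy.rightSlope_le hh hqm
    have e2 := (abs_le.1 (h2 q hq0 hqδ)).1
    have e3 : y < rightSlope h S T + ρ * q - ε * |(q : ℝ)| := hqU
    linarith
  · by_contra hlt
    push Not at hlt
    have hU : {s : ℝ | rightSlope h S T + ρ * s + ε * |s| < y} ∈ 𝓝 m :=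
      (isOpen_lt (by fun_prop) continuous_const).mem_nhds (by
        show rightSlope h S T + ρ * m + ε * |m| < y
        linarith)
    obtain ⟨q, hqU, hq0, hqδ, hqm⟩ := (hside _ hU).1
    have e1 := (hy.le_rightSlope hh).trans (hh.monotone_rightSlope S T hqm.le)
    have e2 := (abs_le.1 (h2 q hq0 hqδ)).2
    have e3 : rightSlope h S T + ρ * q + ε * |(q : ℝ)| < y := hqU
    linarith

/-- The existence of a second derivative does not depend on the lengths of `S` and `T`. -/
lemma exists_hasSubgradientDeriv_of_smul (hh : IsSupportFun h) {S T : E} {r q : ℝ} (hr : 0 < r)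
    (hq : 0 < q) (hST : ∃ ρ y₀, HasSubgradientDeriv (fun t : ℝ => h (r • S + t • q • T)) ρ y₀) :
    ∃ ρ y₀, HasSubgradientDeriv (fun t : ℝ => h (S + t • T)) ρ y₀ := by
  obtain ⟨ρ, y₀, hρ⟩ := hST
  have hscale : ∀ t : ℝ, h (r • S + t • q • T) = r * h (S + (t * q / r) • T) := by
    intro t
    rw [← hh.smul r hr.le, smul_add, smul_smul, smul_smul]
    congr 3
    field_simp
  refine ⟨ρ * r / q ^ 2, y₀ / q, fun ε hε => ?_⟩
  obtain ⟨δ, hδ, hδρ⟩ := hρ (ε * q ^ 2 / r) (by positivity)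
  refine ⟨δ * q / r, by positivity, fun m y hm hy => ?_⟩
  rw [lt_div_iff₀ hr] at hm
  have h1 := hδρ (r * m / q) (q * y) (by
    rw [abs_div, abs_mul, abs_of_pos hr, abs_of_pos hq, div_lt_iff₀ hq]; linarith) (by
    intro t
    simp only [hscale]
    have h2 := hy (t * q / r)
    have e1 : r * m / q * q / r = m := by field_simp
    rw [e1]
    have h3 := mul_le_mul_of_nonneg_left h2 hr.le
    refine le_trans (le_of_eq ?_) h3
    field_simp)
  have e2 : y - y₀ / q - ρ * r / q ^ 2 * m = (q * y - y₀ - ρ * (r * m / q)) / q := by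
    field_simp
  rw [e2, abs_div, abs_of_pos hq, div_le_iff₀ hq]
  refine h1.trans (le_of_eq ?_)
  rw [abs_div, abs_mul, abs_of_pos hr, abs_of_pos hq]
  field_simp

variable [FiniteDimensional ℝ E] [MeasurableSpace E] [BorelSpace E]

lemma IsSupportFun.measurable_rightSlope (hh : IsSupportFun h) :
    Measurable fun z : E × E => rightSlope h z.1 z.2 := by
  have hc := hh.continuous
  refine measurable_of_tendsto_metrizable
    (f := fun (n : ℕ) (z : E × E) => slope (fun t : ℝ => h (z.1 + t • z.2)) 0 (1 / ((n : ℝ) + 1)))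
    (fun n => ?_) ?_
  · simp only [slope_def_field]
    refine Continuous.measurable ?_
    fun_prop
  · rw [tendsto_pi_nhds]
    rintro ⟨S, T⟩
    have h1 := (hh.convexOn_line S T).hasDerivWithinAt_rightDeriv_of_mem_interior (x := 0) (by simp)
    rw [hasDerivWithinAt_iff_tendsto_slope' self_notMem_Ioi] at h1
    refine h1.comp (tendsto_nhdsWithin_iff.2 ⟨tendsto_one_div_add_atTop_nhds_zero_nat, ?_⟩)
    exact Eventually.of_forall fun n => by
      show (0 : ℝ) < 1 / ((n : ℝ) + 1)
      positivity

lemma IsSupportFun.measurableSet_hasLineSecondDeriv (hh : IsSupportFun h) :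
    MeasurableSet {z : E × E | HasLineSecondDeriv h z.1 z.2} := by
  obtain ⟨R, hR⟩ : ∃ R : E × E → ℝ, R = fun z => rightSlope h z.1 z.2 := ⟨_, rfl⟩
  have hR' : ∀ S T, rightSlope h S T = R (S, T) := fun S T => by rw [hR]
  have hRm : Measurable R := hR ▸ hh.measurable_rightSlope
  simp only [HasLineSecondDeriv, hR']
  refine measurableSet_exists_tendsto fun q => ?_
  fun_prop

/-- Lebesgue's theorem on the differentiability of monotone functions, on each line in direction
`T`, gives the second derivative at almost every point. -/
lemma IsSupportFun.ae_hasLineSecondDeriv (hh : IsSupportFun h) (μ : Measure E)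
    [μ.IsAddHaarMeasure] (T : E) : ∀ᵐ S ∂μ, HasLineSecondDeriv h S T := by
  have hT : Measurable fun S : E => (S, T) := measurable_prodMk_right
  have hm : MeasurableSet {S : E | HasLineSecondDeriv h S T} :=
    hT hh.measurableSet_hasLineSecondDeriv
  refine ae_mem_of_ae_add_linearMap_mem (LinearMap.toSpanSingleton ℝ E T) volume μ hm fun S => ?_
  filter_upwards [(hh.monotone_rightSlope S T).ae_differentiableAt] with t ht
  show HasLineSecondDeriv h (S + LinearMap.toSpanSingleton ℝ E T t) T
  refine ⟨deriv (fun t : ℝ => rightSlope h (S + t • T) T) t, ?_⟩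
  have h1 := hasDerivAt_iff_tendsto_slope.1 ht.hasDerivAt
  have h2 : Tendsto (fun q : ℚ => t + (q : ℝ)) (comap (fun q : ℚ => (q : ℝ)) (𝓝[≠] 0))
      (𝓝[≠] t) := by
    have h3 : Tendsto (fun s : ℝ => t + s) (𝓝[≠] 0) (𝓝[≠] t) := by
      refine tendsto_nhdsWithin_iff.2 ⟨?_, ?_⟩
      · have : Tendsto (fun s : ℝ => t + s) (𝓝 0) (𝓝 (t + 0)) :=
          (continuous_const_add t).tendsto 0
        rw [add_zero] at this
        exact this.mono_left nhdsWithin_le_nhds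
      · filter_upwards [self_mem_nhdsWithin] with s hs
        simpa using hs
    exact h3.comp tendsto_comap
  refine (h1.comp h2).congr fun q => ?_
  simp only [Function.comp, slope_def_field, LinearMap.toSpanSingleton_apply, add_smul,
    add_sub_cancel_left, add_assoc]

end Line

/-! ### Polar coordinates for pairs of vectors -/

section Polar

variable {α β γ δ : Type*} [MeasurableSpace α] [MeasurableSpace β] [MeasurableSpace γ]
  [MeasurableSpace δ]

lemma measurePreserving_prodProdProdComm (μa : Measure α) (μb : Measure β) (μc : Measure γ)
    (μd : Measure δ) [SFinite μa] [SFinite μb] [SFinite μc] [SFinite μd] :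
    MeasurePreserving (fun x : (α × γ) × (β × δ) => ((x.1.1, x.2.1), (x.1.2, x.2.2)))
      ((μa.prod μc).prod (μb.prod μd)) ((μa.prod μb).prod (μc.prod μd)) := by
  have hm : Measurable (fun x : (α × γ) × (β × δ) => ((x.1.1, x.2.1), (x.1.2, x.2.2))) := by
    fun_prop
  refine ⟨hm, Measure.ext_of_lintegral _ fun f hf => ?_⟩
  rw [lintegral_map hf hm, lintegral_prod _ (by fun_prop), lintegral_prod _ (by fun_prop),
    lintegral_prod _ (by fun_prop), lintegral_prod _ (by fun_prop)]
  refine lintegral_congr fun a => ?_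
  have h1 : ∀ c, ∫⁻ y : β × δ, f ((a, y.1), (c, y.2)) ∂μb.prod μd =
      ∫⁻ b, ∫⁻ d, f ((a, b), (c, d)) ∂μd ∂μb :=
    fun c => lintegral_prod _ (by fun_prop)
  have h2 : ∀ b, ∫⁻ y : γ × δ, f ((a, b), y) ∂μc.prod μd =
      ∫⁻ c, ∫⁻ d, f ((a, b), (c, d)) ∂μd ∂μc :=
    fun b => lintegral_prod _ (by fun_prop)
  simp only [h1, h2]
  exact lintegral_lintegral_swap (by fun_prop)

variable {E : Type*} [NormedAddCommGroup E] [NormedSpace ℝ E] [FiniteDimensional ℝ E]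
  [MeasurableSpace E] [BorelSpace E] [Nontrivial E] (μ : Measure E) [μ.IsAddHaarMeasure]

/-- The measure `r ^ (d - 1) dr` of polar coordinates on `E`. -/
noncomputable abbrev radialMeasure (E : Type*) [NormedAddCommGroup E] [NormedSpace ℝ E] :
    Measure (Ioi (0 : ℝ)) := Measure.volumeIoiPow (Module.finrank ℝ E - 1)

lemma measurePreserving_polar :
    MeasurePreserving (fun x : Metric.sphere (0 : E) 1 × Ioi (0 : ℝ) => (x.2 : ℝ) • (x.1 : E))
      (μ.toSphere.prod (radialMeasure E)) μ := by
  have h1 : MeasurePreserving (homeomorphUnitSphereProd E).toMeasurableEquiv (μ.comap (↑))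
      (μ.toSphere.prod (radialMeasure E)) := μ.measurePreserving_homeomorphUnitSphereProd
  have h2 := measurePreserving_subtype_coe (μa := μ) (measurableSet_singleton (0 : E)).compl
  rw [restrict_compl_singleton] at h2
  exact h2.comp h1.symm

/-- Polar coordinates for a pair of vectors: the pair of directions and the pair of radii. -/
lemma measurePreserving_polar_prod :
    MeasurePreserving (fun x : (Metric.sphere (0 : E) 1 × Metric.sphere (0 : E) 1) ×
        (Ioi (0 : ℝ) × Ioi (0 : ℝ)) => ((x.2.1 : ℝ) • (x.1.1 : E), (x.2.2 : ℝ) • (x.1.2 : E)))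
      ((μ.toSphere.prod μ.toSphere).prod ((radialMeasure E).prod (radialMeasure E)))
      (μ.prod μ) :=
  ((measurePreserving_polar μ).prod (measurePreserving_polar μ)).comp
    (measurePreserving_prodProdProdComm μ.toSphere (radialMeasure E) μ.toSphere (radialMeasure E))

omit [FiniteDimensional ℝ E] [MeasurableSpace E] [BorelSpace E] [Nontrivial E] in
lemma radialMeasure_Iio_ne_zero {a : Ioi (0 : ℝ)} : radialMeasure E (Iio a) ≠ 0 := by
  rw [radialMeasure, Measure.volumeIoiPow_apply_Iio]
  have : (0 : ℝ) < a := a.2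
  simp only [ne_eq, ENNReal.ofReal_eq_zero, not_le]
  positivity

lemma ae_toSphere_prod_of_ae {p : E → E → Prop} (h : ∀ᵐ z ∂μ.prod μ, p z.1 z.2) :
    ∀ᵐ z ∂μ.toSphere.prod μ.toSphere, ∃ r > (0 : ℝ), ∃ q > (0 : ℝ),
      p (r • (z.1 : E)) (q • (z.2 : E)) := by
  have h1 := Measure.ae_ae_of_ae_prod ((measurePreserving_polar_prod μ).quasiMeasurePreserving.ae h)
  have hne : (radialMeasure E).prod (radialMeasure E) ≠ 0 := by
    intro h0
    have h2 : ((radialMeasure E).prod (radialMeasure E))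
        (Iio ⟨1, mem_Ioi.2 one_pos⟩ ×ˢ Iio ⟨1, mem_Ioi.2 one_pos⟩) = 0 := by rw [h0]; simp
    rw [Measure.prod_prod, mul_eq_zero, or_self] at h2
    exact radialMeasure_Iio_ne_zero h2
  have : (ae ((radialMeasure E).prod (radialMeasure E))).NeBot := ae_neBot.2 hne
  filter_upwards [h1] with z hz
  obtain ⟨⟨r, q⟩, hrq⟩ := hz.exists
  exact ⟨r, r.2, q, q.2, hrq⟩

end Polar

/-- Along almost every pair of directions, a support function has a second derivative. -/
lemma IsSupportFun.ae_toSphere_exists_hasSubgradientDeriv {E : Type*} [NormedAddCommGroup E]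
    [NormedSpace ℝ E] [FiniteDimensional ℝ E] [MeasurableSpace E] [BorelSpace E] [Nontrivial E]
    (μ : Measure E) [μ.IsAddHaarMeasure] {h : E → ℝ} (hh : IsSupportFun h) :
    ∀ᵐ z ∂μ.toSphere.prod μ.toSphere,
      ∃ ρ y₀, HasSubgradientDeriv (fun t : ℝ => h ((z.1 : E) + t • (z.2 : E))) ρ y₀ := by
  have h1 : ∀ᵐ z ∂μ.prod μ, HasLineSecondDeriv h z.1 z.2 := by
    have hm := hh.measurableSet_hasLineSecondDeriv
    refine (Measure.ae_prod_mem_iff_ae_ae_mem hm).2 ?_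
    refine (Measure.ae_ae_comm hm).2 ?_
    exact Eventually.of_forall fun T => hh.ae_hasLineSecondDeriv μ T
  filter_upwards [ae_toSphere_prod_of_ae μ h1] with z hz
  obtain ⟨r, hr, q, hq, hrq⟩ := hz
  exact exists_hasSubgradientDeriv_of_smul hh hr hq (hrq.exists_hasSubgradientDeriv hh)

/-! ### The mean second derivative -/

section Rotation

variable {E : Type*} [NormedAddCommGroup E] [InnerProductSpace ℝ E]

/-- The rotation of `E × E` that takes the direction `(1, τ)` to the first factor. -/
noncomputable def pairRotation (E : Type*) [NormedAddCommGroup E] [InnerProductSpace ℝ E] (τ : ℝ) :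
    (E × E) ≃ₗ[ℝ] (E × E) where
  toFun z := ((√(1 + τ ^ 2))⁻¹ • (z.1 + τ • z.2), (√(1 + τ ^ 2))⁻¹ • (z.2 - τ • z.1))
  invFun z := ((√(1 + τ ^ 2))⁻¹ • (z.1 - τ • z.2), (√(1 + τ ^ 2))⁻¹ • (z.2 + τ • z.1))
  map_add' x y := by
    ext <;> simp only [Prod.fst_add, Prod.snd_add] <;> module
  map_smul' c x := by
    ext <;> simp only [Prod.smul_fst, Prod.smul_snd, RingHom.id_apply] <;> module
  left_inv z := by
    have h0 : (√(1 + τ ^ 2))⁻¹ * (√(1 + τ ^ 2))⁻¹ * (1 + τ ^ 2) = 1 := by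
      rw [← mul_inv, Real.mul_self_sqrt (by positivity), inv_mul_cancel₀ (by positivity)]
    ext
    · calc _ = ((√(1 + τ ^ 2))⁻¹ * (√(1 + τ ^ 2))⁻¹ * (1 + τ ^ 2)) • z.1 := by
            dsimp only; module
        _ = z.1 := by rw [h0, one_smul]
    · calc _ = ((√(1 + τ ^ 2))⁻¹ * (√(1 + τ ^ 2))⁻¹ * (1 + τ ^ 2)) • z.2 := by
            dsimp only; module
        _ = z.2 := by rw [h0, one_smul]
  right_inv z := by
    have h0 : (√(1 + τ ^ 2))⁻¹ * (√(1 + τ ^ 2))⁻¹ * (1 + τ ^ 2) = 1 := by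
      rw [← mul_inv, Real.mul_self_sqrt (by positivity), inv_mul_cancel₀ (by positivity)]
    ext
    · calc _ = ((√(1 + τ ^ 2))⁻¹ * (√(1 + τ ^ 2))⁻¹ * (1 + τ ^ 2)) • z.1 := by
            dsimp only; module
        _ = z.1 := by rw [h0, one_smul]
    · calc _ = ((√(1 + τ ^ 2))⁻¹ * (√(1 + τ ^ 2))⁻¹ * (1 + τ ^ 2)) • z.2 := by
            dsimp only; module
        _ = z.2 := by rw [h0, one_smul]

/-- The Euclidean unit ball of `E × E` (whose norm in Mathlib is the maximum norm). -/
def pairBall (E : Type*) [NormedAddCommGroup E] : Set (E × E) :=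
  {z | ‖z.1‖ ^ 2 + ‖z.2‖ ^ 2 ≤ 1}

lemma pairRotation_preimage_pairBall (τ : ℝ) :
    pairRotation E τ ⁻¹' pairBall E = pairBall E := by
  ext z
  have h0 : ((√(1 + τ ^ 2))⁻¹) ^ 2 * (1 + τ ^ 2) = 1 := by
    rw [inv_pow, Real.sq_sqrt (by positivity), inv_mul_cancel₀ (by positivity)]
  have key : ‖(pairRotation E τ z).1‖ ^ 2 + ‖(pairRotation E τ z).2‖ ^ 2 =
      ‖z.1‖ ^ 2 + ‖z.2‖ ^ 2 := by
    show ‖(√(1 + τ ^ 2))⁻¹ • (z.1 + τ • z.2)‖ ^ 2 + ‖(√(1 + τ ^ 2))⁻¹ • (z.2 - τ • z.1)‖ ^ 2 = _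
    rw [norm_smul, norm_smul, mul_pow, mul_pow, norm_add_sq_real, norm_sub_sq_real, norm_smul,
      norm_smul, real_inner_smul_right, real_inner_smul_right, real_inner_comm z.1 z.2, mul_pow,
      mul_pow, Real.norm_eq_abs, Real.norm_eq_abs, sq_abs, sq_abs]
    linear_combination (‖z.1‖ ^ 2 + ‖z.2‖ ^ 2) * h0
  show ‖(pairRotation E τ z).1‖ ^ 2 + ‖(pairRotation E τ z).2‖ ^ 2 ≤ 1 ↔ ‖z.1‖ ^ 2 + ‖z.2‖ ^ 2 ≤ 1
  rw [key]

variable [FiniteDimensional ℝ E]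

lemma isCompact_pairBall : IsCompact (pairBall E) := by
  refine Metric.isCompact_of_isClosed_isBounded ?_ (isBounded_iff_forall_norm_le.2 ⟨1, ?_⟩)
  · exact isClosed_le (by fun_prop) continuous_const
  · intro z hz
    have hz' : ‖z.1‖ ^ 2 + ‖z.2‖ ^ 2 ≤ 1 := hz
    rw [Prod.norm_def, max_le_iff]
    constructor <;> nlinarith [norm_nonneg z.1, norm_nonneg z.2]

variable [MeasurableSpace E] [BorelSpace E] (μ : Measure E) [μ.IsAddHaarMeasure]

omit [BorelSpace E] in
lemma prod_pairBall_ne_zero : (μ.prod μ) (pairBall E) ≠ 0 := by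
  refine (Measure.measure_pos_of_nonempty_interior _ ⟨0, ?_⟩).ne'
  rw [mem_interior]
  exact ⟨{z | ‖z.1‖ ^ 2 + ‖z.2‖ ^ 2 < 1},
    fun z (hz : ‖z.1‖ ^ 2 + ‖z.2‖ ^ 2 < 1) => show ‖z.1‖ ^ 2 + ‖z.2‖ ^ 2 ≤ 1 from hz.le,
    isOpen_lt (by fun_prop) continuous_const, by simp⟩

lemma measurePreserving_pairRotation (τ : ℝ) :
    MeasurePreserving (pairRotation E τ) ((μ.prod μ).restrict (pairBall E))
      ((μ.prod μ).restrict (pairBall E)) := by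
  have hc : Continuous (pairRotation E τ) :=
    (pairRotation E τ).toLinearMap.continuous_of_finiteDimensional
  have hdet : LinearMap.det (pairRotation E τ : (E × E) →ₗ[ℝ] (E × E)) ≠ 0 :=
    (pairRotation E τ).isUnit_det'.ne_zero
  have hmap := Measure.map_linearMap_addHaar_eq_smul_addHaar (μ.prod μ) hdet
  have hD : MeasurableSet (pairBall E) := isCompact_pairBall.isClosed.measurableSet
  set a := ENNReal.ofReal |(LinearMap.det (pairRotation E τ : (E × E) →ₗ[ℝ] (E × E)))⁻¹| with ha
  have h1 : (μ.prod μ) (pairBall E) = a * (μ.prod μ) (pairBall E) := by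
    conv_lhs => rw [← pairRotation_preimage_pairBall (E := E) τ]
    have h2 := congrArg (fun m : Measure (E × E) => m (pairBall E)) hmap
    simp only [Measure.smul_apply, smul_eq_mul] at h2
    rw [← h2]
    exact (Measure.map_apply hc.measurable hD).symm
  have ha1 : a = 1 := by
    have h3 : a * (μ.prod μ) (pairBall E) = 1 * (μ.prod μ) (pairBall E) := by rw [one_mul, ← h1]
    exact (ENNReal.mul_left_inj (prod_pairBall_ne_zero μ)
      isCompact_pairBall.measure_lt_top.ne).1 h3
  have hmp : MeasurePreserving (pairRotation E τ) (μ.prod μ) (μ.prod μ) := by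
    refine ⟨hc.measurable, ?_⟩
    rw [ha1, one_smul] at hmap
    exact hmap
  have h4 := hmp.restrict_preimage hD
  rwa [pairRotation_preimage_pairBall] at h4

variable {h : E → ℝ}

lemma integrable_pairBall {f : E × E → ℝ} (hf : Continuous f) :
    Integrable f ((μ.prod μ).restrict (pairBall E)) :=
  hf.continuousOn.integrableOn_compact isCompact_pairBall

/-- Rotating the pair `(S, T)`, the mean of `h (S + τ T)` is a multiple of that of `h S`. -/
lemma IsSupportFun.integral_add_smul (hh : IsSupportFun h) (τ : ℝ) :
    ∫ z in pairBall E, h (z.1 + τ • z.2) ∂μ.prod μ =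
      √(1 + τ ^ 2) * ∫ z in pairBall E, h z.1 ∂μ.prod μ := by
  have h1 := (measurePreserving_pairRotation μ τ).integral_comp
    ((pairRotation E τ).toContinuousLinearEquiv.toHomeomorph.measurableEmbedding)
    (fun z : E × E => h z.1)
  rw [← h1, ← integral_const_mul]
  refine integral_congr_ae (Eventually.of_forall fun z => ?_)
  have h0 : 0 < √(1 + τ ^ 2) := Real.sqrt_pos.2 (by positivity)
  show h (z.1 + τ • z.2) = √(1 + τ ^ 2) * h ((√(1 + τ ^ 2))⁻¹ • (z.1 + τ • z.2))
  rw [hh.smul _ (by positivity), ← mul_assoc, mul_inv_cancel₀ h0.ne', one_mul]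

/-- By the symmetry `S ↦ -S`, the mean of a support function is that of its half width. -/
lemma IsSupportFun.integral_pairBall_mem (hh : IsSupportFun h) {w : ℝ}
    (hw : ∀ x, h x + h (-x) ≤ w * ‖x‖) :
    0 ≤ ∫ z in pairBall E, h z.1 ∂μ.prod μ ∧
      ∫ z in pairBall E, h z.1 ∂μ.prod μ ≤ w / 2 * ∫ z in pairBall E, ‖z.1‖ ∂μ.prod μ := by
  have hc := hh.continuous
  have hneg : ∫ z in pairBall E, h (-z.1) ∂μ.prod μ = ∫ z in pairBall E, h z.1 ∂μ.prod μ := by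
    have hmp : MeasurePreserving (Neg.neg : E × E → E × E) (μ.prod μ) (μ.prod μ) :=
      (Measure.measurePreserving_neg μ).prod (Measure.measurePreserving_neg μ)
    have h4 := hmp.restrict_preimage (isCompact_pairBall (E := E)).isClosed.measurableSet
    rw [show (Neg.neg : E × E → E × E) ⁻¹' pairBall E = pairBall E by
      ext z; simp [pairBall]] at h4
    exact h4.integral_comp (Homeomorph.neg (E × E)).measurableEmbedding (fun z : E × E => h z.1)
  have i1 := integrable_pairBall μ (f := fun z : E × E => h z.1) (by fun_prop)
  have i2 := integrable_pairBall μ (f := fun z : E × E => h (-z.1)) (by fun_prop)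
  have i3 := integrable_pairBall μ (f := fun z : E × E => w * ‖z.1‖) (by fun_prop)
  have hsum := integral_add i1 i2
  rw [hneg] at hsum
  have hlow : 0 ≤ ∫ z in pairBall E, (h z.1 + h (-z.1)) ∂μ.prod μ := by
    refine integral_nonneg fun z => ?_
    have := hh.add_le z.1 (-z.1)
    rw [add_neg_cancel, hh.map_zero] at this
    exact this
  have hup : ∫ z in pairBall E, (h z.1 + h (-z.1)) ∂μ.prod μ ≤
      ∫ z in pairBall E, w * ‖z.1‖ ∂μ.prod μ :=
    integral_mono (i1.add i2) i3 fun z => hw z.1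
  rw [integral_const_mul] at hup
  constructor <;> linarith

/-- The rescaled second difference of `h` at `S` in the direction `T`. -/
noncomputable def secondDifference (h : E → ℝ) (n : ℕ) (z : E × E) : ℝ :=
  ((n : ℝ) + 1) ^ 2 *
    (h (z.1 + (1 / ((n : ℝ) + 1)) • z.2) + h (z.1 + (-(1 / ((n : ℝ) + 1))) • z.2) - 2 * h z.1)

omit [FiniteDimensional ℝ E] [MeasurableSpace E] [BorelSpace E] in
lemma IsSupportFun.secondDifference_nonneg (hh : IsSupportFun h) (n : ℕ) (z : E × E) :
    0 ≤ secondDifference h n z := by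
  refine mul_nonneg (by positivity) ?_
  have h1 := hh.add_le (z.1 + (1 / ((n : ℝ) + 1)) • z.2) (z.1 + (-(1 / ((n : ℝ) + 1))) • z.2)
  have h2 : z.1 + (1 / ((n : ℝ) + 1)) • z.2 + (z.1 + (-(1 / ((n : ℝ) + 1))) • z.2) =
      (2 : ℝ) • z.1 := by module
  rw [h2, hh.smul 2 zero_le_two] at h1
  linarith

omit [FiniteDimensional ℝ E] [MeasurableSpace E] [BorelSpace E] in
lemma IsSupportFun.continuous_secondDifference (hh : IsSupportFun h) (n : ℕ) :
    Continuous (secondDifference h n) := by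
  have hc := hh.continuous
  unfold secondDifference
  fun_prop

lemma IsSupportFun.integral_secondDifference_le (hh : IsSupportFun h) {w : ℝ}
    (hw : ∀ x, h x + h (-x) ≤ w * ‖x‖) (n : ℕ) :
    ∫ z in pairBall E, secondDifference h n z ∂μ.prod μ ≤
      w / 2 * ∫ z in pairBall E, ‖z.1‖ ∂μ.prod μ := by
  have hc := hh.continuous
  obtain ⟨hI0, hI⟩ := hh.integral_pairBall_mem μ hw
  refine le_trans ?_ hI
  set τ : ℝ := 1 / ((n : ℝ) + 1) with hτ
  have hτ0 : 0 < τ := by positivity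
  have i1 := integrable_pairBall μ (f := fun z : E × E => h (z.1 + τ • z.2)) (by fun_prop)
  have i2 := integrable_pairBall μ (f := fun z : E × E => h (z.1 + (-τ) • z.2)) (by fun_prop)
  have i3 := integrable_pairBall μ (f := fun z : E × E => 2 * h z.1) (by fun_prop)
  have h1 : ∫ z in pairBall E, secondDifference h n z ∂μ.prod μ =
      ((n : ℝ) + 1) ^ 2 * (2 * (√(1 + τ ^ 2) - 1) * ∫ z in pairBall E, h z.1 ∂μ.prod μ) := by
    have i12 : Integrable (fun z : E × E => h (z.1 + τ • z.2) + h (z.1 + (-τ) • z.2))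
      ((μ.prod μ).restrict (pairBall E)) := i1.add i2
    unfold secondDifference
    rw [integral_const_mul, ← hτ, integral_sub i12 i3, integral_add i1 i2,
      integral_const_mul, hh.integral_add_smul μ, hh.integral_add_smul μ, neg_sq]
    ring
  have h2 : √(1 + τ ^ 2) ≤ 1 + τ ^ 2 / 2 := by
    rw [Real.sqrt_le_iff]
    exact ⟨by positivity, by nlinarith [sq_nonneg (τ ^ 2)]⟩
  have h3 : ((n : ℝ) + 1) ^ 2 * τ ^ 2 = 1 := by rw [hτ]; field_simp
  have h4 : ((n : ℝ) + 1) ^ 2 * (2 * (√(1 + τ ^ 2) - 1)) ≤ 1 := by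
    have : 0 ≤ ((n : ℝ) + 1) ^ 2 := by positivity
    nlinarith
  rw [h1, ← mul_assoc]
  exact mul_le_of_le_one_left hI0 h4

end Rotation

/-! ### Small curvature is unlikely -/

section Markov

lemma IsSupportFun.secondDifference_smul {E : Type*} [NormedAddCommGroup E]
    [InnerProductSpace ℝ E] {h : E → ℝ} (hh : IsSupportFun h) (n : ℕ) {r q : ℝ} (hr : 0 < r)
    (s t : E) :
    secondDifference h n (r • s, q • t) = ((n : ℝ) + 1) ^ 2 * r *
      (h (s + (q / r * (1 / ((n : ℝ) + 1))) • t) + h (s + (-(q / r * (1 / ((n : ℝ) + 1)))) • t)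
        - 2 * h s) := by
  have h1 : ∀ c : ℝ, r • s + c • q • t = r • (s + (q / r * c) • t) := by
    intro c
    rw [smul_add, smul_smul, smul_smul]
    congr 2
    field_simp
  simp only [secondDifference]
  rw [h1, h1, hh.smul r hr.le, hh.smul r hr.le, hh.smul r hr.le, mul_neg]
  ring

lemma IsSupportFun.le_liminf_secondDifference {E : Type*} [NormedAddCommGroup E]
    [InnerProductSpace ℝ E] {h : E → ℝ} (hh : IsSupportFun h) {k r q : ℝ} (hr : 0 < r) (hq : 0 < q)
    {s t : E} (hst : ∃ δ > 0, ∀ τ : ℝ, |τ| < δ →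
      τ ^ 2 / k ≤ h (s + τ • t) + h (s + (-τ) • t) - 2 * h s) :
    ENNReal.ofReal (q ^ 2 / r / k) ≤
      liminf (fun n => ENNReal.ofReal (secondDifference h n (r • s, q • t))) atTop := by
  obtain ⟨δ, hδ, hst⟩ := hst
  refine le_liminf_of_le (by isBoundedDefault) ?_
  have hlim : Tendsto (fun n : ℕ => q / r * (1 / ((n : ℝ) + 1))) atTop (𝓝 0) := by
    simpa using tendsto_one_div_add_atTop_nhds_zero_nat.const_mul (q / r)
  filter_upwards [hlim.eventually (gt_mem_nhds hδ)] with n hn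
  refine ENNReal.ofReal_le_ofReal ?_
  have hpos : 0 < q / r * (1 / ((n : ℝ) + 1)) := by positivity
  rw [hh.secondDifference_smul n hr]
  calc q ^ 2 / r / k = ((n : ℝ) + 1) ^ 2 * r * ((q / r * (1 / ((n : ℝ) + 1))) ^ 2 / k) := by
        field_simp
    _ ≤ _ := mul_le_mul_of_nonneg_left (hst _ (by rwa [abs_of_pos hpos])) (by positivity)

/-- The radii of the pairs of vectors in the Euclidean unit ball of `E × E`. -/
def radialBall : Set (Ioi (0 : ℝ) × Ioi (0 : ℝ)) :=
  {x | (x.1 : ℝ) ^ 2 + (x.2 : ℝ) ^ 2 ≤ 1}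

lemma measurableSet_radialBall : MeasurableSet radialBall :=
  measurableSet_le (by fun_prop) measurable_const

/-- By symmetry, and as `r + q ≤ q ^ 2 / r + r ^ 2 / q`. -/
lemma lintegral_radius_le (ν : Measure (Ioi (0 : ℝ))) [SFinite ν] :
    ∫⁻ x in radialBall, ENNReal.ofReal (x.1 : ℝ) ∂ν.prod ν ≤
      ∫⁻ x in radialBall, ENNReal.ofReal ((x.2 : ℝ) ^ 2 / (x.1 : ℝ)) ∂ν.prod ν := by
  have hmp : MeasurePreserving Prod.swap ((ν.prod ν).restrict radialBall)
      ((ν.prod ν).restrict radialBall) := by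
    have h := (Measure.measurePreserving_swap (μ := ν) (ν := ν)).restrict_preimage
      measurableSet_radialBall
    rwa [show Prod.swap ⁻¹' radialBall = radialBall by
      ext x; simp [radialBall, add_comm]] at h
  have e1 := hmp.lintegral_comp (f := fun x => ENNReal.ofReal (x.1 : ℝ)) (by fun_prop)
  have e2 := hmp.lintegral_comp
    (f := fun x => ENNReal.ofReal ((x.2 : ℝ) ^ 2 / (x.1 : ℝ))) (by fun_prop)
  have key : ∫⁻ x in radialBall, (ENNReal.ofReal (x.1 : ℝ) + ENNReal.ofReal (x.2 : ℝ)) ∂ν.prod ν ≤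
      ∫⁻ x in radialBall, (ENNReal.ofReal ((x.2 : ℝ) ^ 2 / (x.1 : ℝ)) +
        ENNReal.ofReal ((x.1 : ℝ) ^ 2 / (x.2 : ℝ))) ∂ν.prod ν := by
    refine lintegral_mono fun x => ?_
    obtain ⟨⟨r, hr⟩, ⟨q, hq⟩⟩ := x
    have hr' : 0 < r := hr
    have hq' : 0 < q := hq
    show ENNReal.ofReal r + ENNReal.ofReal q ≤
      ENNReal.ofReal (q ^ 2 / r) + ENNReal.ofReal (r ^ 2 / q)
    rw [← ENNReal.ofReal_add hr'.le hq'.le, ← ENNReal.ofReal_add (by positivity) (by positivity)]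
    refine ENNReal.ofReal_le_ofReal ?_
    rw [div_add_div _ _ hr'.ne' hq'.ne', le_div_iff₀ (by positivity)]
    nlinarith [mul_nonneg (add_pos hr' hq').le (sq_nonneg (r - q))]
  rw [lintegral_add_left (by fun_prop), lintegral_add_left (by fun_prop)] at key
  simp only [Prod.fst_swap, Prod.snd_swap] at e1 e2
  rw [e1, e2, ← two_mul, ← two_mul] at key
  exact (ENNReal.mul_le_mul_iff_right two_ne_zero ENNReal.ofNat_ne_top).1 key

variable {E : Type*} [NormedAddCommGroup E] [InnerProductSpace ℝ E] [FiniteDimensional ℝ E]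
  [MeasurableSpace E] [BorelSpace E] (μ : Measure E) [μ.IsAddHaarMeasure] {h : E → ℝ}

/-- Fatou's lemma for the second differences. -/
lemma IsSupportFun.lintegral_liminf_le (hh : IsSupportFun h) {w : ℝ}
    (hw : ∀ x, h x + h (-x) ≤ w * ‖x‖) :
    ∫⁻ z in pairBall E, liminf (fun n => ENNReal.ofReal (secondDifference h n z)) atTop ∂μ.prod μ ≤
      ENNReal.ofReal (w / 2) * ∫⁻ z in pairBall E, ENNReal.ofReal ‖z.1‖ ∂μ.prod μ := by
  have hnorm : ENNReal.ofReal (∫ z in pairBall E, ‖z.1‖ ∂μ.prod μ) =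
      ∫⁻ z in pairBall E, ENNReal.ofReal ‖z.1‖ ∂μ.prod μ :=
    ofReal_integral_eq_lintegral_ofReal (integrable_pairBall μ (by fun_prop))
      (Eventually.of_forall fun z => norm_nonneg _)
  have hint : 0 ≤ ∫ z in pairBall E, ‖z.1‖ ∂μ.prod μ := integral_nonneg fun z => norm_nonneg _
  rw [← hnorm, ← ENNReal.ofReal_mul' hint]
  refine (MeasureTheory.lintegral_liminf_le fun n =>
    (hh.continuous_secondDifference n).measurable.ennreal_ofReal).trans ?_
  refine liminf_le_of_le (by isBoundedDefault) fun b hb => ?_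
  obtain ⟨n, hn⟩ := hb.exists
  refine hn.trans ?_
  rw [← ofReal_integral_eq_lintegral_ofReal
    (integrable_pairBall μ (hh.continuous_secondDifference n))
    (Eventually.of_forall fun z => hh.secondDifference_nonneg n z)]
  exact ENNReal.ofReal_le_ofReal (hh.integral_secondDifference_le μ hw n)

/-- A support function of width at most `w` rarely has a large second derivative: the set of pairs
of directions `(s, t)` where the second derivative of `τ ↦ h (s + τ t)` at `0` is at least `1 / k`,
in terms of symmetric second differences, has probability at most `w k / 2`. -/
lemma IsSupportFun.toSphere_prod_le [Nontrivial E] (hh : IsSupportFun h) {w : ℝ}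
    (hw : ∀ x, h x + h (-x) ≤ w * ‖x‖) {k : ℝ} (hk : 0 < k)
    {B : Set (Metric.sphere (0 : E) 1 × Metric.sphere (0 : E) 1)} (hB : MeasurableSet B)
    (hBk : ∀ z ∈ B, ∃ δ > 0, ∀ τ : ℝ, |τ| < δ →
      τ ^ 2 / k ≤ h ((z.1 : E) + τ • (z.2 : E)) + h ((z.1 : E) + (-τ) • (z.2 : E)) - 2 * h z.1) :
    (μ.toSphere.prod μ.toSphere) B ≤
      ENNReal.ofReal (w / 2 * k) * (μ.toSphere.prod μ.toSphere) univ := by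
  set σσ := μ.toSphere.prod μ.toSphere with hσ
  set νν := (radialMeasure E).prod (radialMeasure E) with hν
  have hpolar := (measurePreserving_polar_prod μ).restrict_preimage
    (isCompact_pairBall (E := E)).isClosed.measurableSet
  have hpre : (fun x : (Metric.sphere (0 : E) 1 × Metric.sphere (0 : E) 1) ×
      (Ioi (0 : ℝ) × Ioi (0 : ℝ)) => ((x.2.1 : ℝ) • (x.1.1 : E), (x.2.2 : ℝ) • (x.1.2 : E))) ⁻¹'
        pairBall E = univ ×ˢ radialBall := by
    ext ⟨⟨s, t⟩, ⟨⟨r, hr⟩, ⟨q, hq⟩⟩⟩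
    simp [pairBall, radialBall, norm_smul]
  rw [hpre, ← hσ, ← hν, ← Measure.prod_restrict, Measure.restrict_univ] at hpolar
  set C₁ := ∫⁻ x in radialBall, ENNReal.ofReal ((x.2 : ℝ) ^ 2 / (x.1 : ℝ)) ∂νν with hC₁
  set C₂ := ∫⁻ x in radialBall, ENNReal.ofReal (x.1 : ℝ) ∂νν with hC₂
  have hC : C₂ ≤ C₁ := lintegral_radius_le _
  -- the mean norm in polar coordinates
  have hright : ∫⁻ z in pairBall E, ENNReal.ofReal ‖z.1‖ ∂μ.prod μ = σσ univ * C₂ := by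
    rw [← hpolar.lintegral_comp (f := fun z : E × E => ENNReal.ofReal ‖z.1‖) (by fun_prop)]
    have h1 := lintegral_prod_mul (μ := σσ) (ν := νν.restrict radialBall) (f := fun _ => 1)
      (g := fun x => ENNReal.ofReal (x.1 : ℝ)) aemeasurable_const (by fun_prop)
    rw [lintegral_const, one_mul] at h1
    rw [← h1]
    refine lintegral_congr fun x => ?_
    obtain ⟨⟨s, t⟩, ⟨⟨r, hr⟩, ⟨q, hq⟩⟩⟩ := x
    have hr' : 0 < r := hr
    simp [norm_smul, abs_of_pos hr']
  have hF : Measurable fun z : E × E =>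
      liminf (fun n => ENNReal.ofReal (secondDifference h n z)) atTop :=
    Measurable.liminf fun n => (hh.continuous_secondDifference n).measurable.ennreal_ofReal
  have hleft : σσ B * (ENNReal.ofReal k⁻¹ * C₁) ≤ ∫⁻ z in pairBall E,
      liminf (fun n => ENNReal.ofReal (secondDifference h n z)) atTop ∂μ.prod μ := by
    rw [← hpolar.lintegral_comp hF]
    have h1 := lintegral_prod_mul (μ := σσ) (ν := νν.restrict radialBall)
      (f := B.indicator fun _ => 1)
      (g := fun x => ENNReal.ofReal k⁻¹ * ENNReal.ofReal ((x.2 : ℝ) ^ 2 / (x.1 : ℝ)))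
      ((measurable_const.indicator hB).aemeasurable) (by fun_prop)
    rw [lintegral_indicator_const hB, one_mul, lintegral_const_mul _ (by fun_prop)] at h1
    rw [← h1]
    refine lintegral_mono fun x => ?_
    obtain ⟨z, ⟨⟨r, hr⟩, ⟨q, hq⟩⟩⟩ := x
    by_cases hz : z ∈ B
    · have h2 := hh.le_liminf_secondDifference hr hq (hBk z hz)
      simp only [indicator_of_mem hz, one_mul]
      rw [← ENNReal.ofReal_mul (inv_pos.2 hk).le]
      rwa [div_eq_inv_mul (q ^ 2 / r) k] at h2
    · simp [indicator_of_notMem hz]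
  have hσ0 : σσ univ ≠ 0 := by
    rw [hσ, ← univ_prod_univ, Measure.prod_prod]
    have : μ.toSphere univ ≠ 0 := by
      rw [Measure.measure_univ_ne_zero]
      exact μ.toSphere_ne_zero
    exact mul_ne_zero this this
  have hCtop : C₂ ≠ ∞ := by
    intro hC'
    have hfin : ∫⁻ z in pairBall E, ENNReal.ofReal ‖z.1‖ ∂μ.prod μ < ∞ :=
      (integrable_pairBall μ (f := fun z : E × E => ‖z.1‖) (by fun_prop)).lintegral_lt_top
    rw [hright, hC', ENNReal.mul_top hσ0] at hfin
    exact lt_irrefl _ hfin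
  have hC0 : C₂ ≠ 0 := by
    intro h0
    have hpos : ∀ x : Ioi (0 : ℝ) × Ioi (0 : ℝ), ENNReal.ofReal (x.1 : ℝ) ≠ 0 := fun x => by
      have : (0 : ℝ) < x.1 := x.1.2
      simpa using this
    rw [hC₂, lintegral_eq_zero_iff (by fun_prop)] at h0
    have h1 : νν radialBall = 0 := by
      have h6 : ∀ᵐ x ∂νν.restrict radialBall, False := h0.mono fun x hx => hpos x hx
      rw [ae_iff] at h6
      simpa using h6
    have h2 : Iio (⟨1 / 2, mem_Ioi.2 (by norm_num)⟩ : Ioi (0 : ℝ)) ×ˢ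
        Iio (⟨1 / 2, mem_Ioi.2 (by norm_num)⟩ : Ioi (0 : ℝ)) ⊆ radialBall := by
      rintro ⟨⟨r, hr⟩, ⟨q, hq⟩⟩ ⟨h3, h4⟩
      have hr' : 0 < r := hr
      have hq' : 0 < q := hq
      have h3' : r < 1 / 2 := h3
      have h4' : q < 1 / 2 := h4
      show r ^ 2 + q ^ 2 ≤ 1
      nlinarith
    have h3 := measure_mono_null h2 h1
    rw [hν, Measure.prod_prod, mul_eq_zero, or_self] at h3
    exact radialMeasure_Iio_ne_zero h3
  have hmain : σσ B * ENNReal.ofReal k⁻¹ * C₂ ≤ ENNReal.ofReal (w / 2) * σσ univ * C₂ := by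
    calc σσ B * ENNReal.ofReal k⁻¹ * C₂ ≤ σσ B * ENNReal.ofReal k⁻¹ * C₁ := by gcongr
      _ = σσ B * (ENNReal.ofReal k⁻¹ * C₁) := mul_assoc _ _ _
      _ ≤ _ := hleft
      _ ≤ _ := hh.lintegral_liminf_le μ hw
      _ = ENNReal.ofReal (w / 2) * σσ univ * C₂ := by rw [hright, mul_assoc]
  have h5 := (ENNReal.mul_le_mul_iff_left hC0 hCtop).1 hmain
  calc σσ B = σσ B * ENNReal.ofReal k⁻¹ * ENNReal.ofReal k := by
        rw [mul_assoc, ← ENNReal.ofReal_mul (inv_pos.2 hk).le, inv_mul_cancel₀ hk.ne',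
          ENNReal.ofReal_one, mul_one]
    _ ≤ ENNReal.ofReal (w / 2) * σσ univ * ENNReal.ofReal k := by gcongr
    _ = ENNReal.ofReal (w / 2 * k) * σσ univ := by
        rw [ENNReal.ofReal_mul' hk.le]; ring

end Markov

/-! ### Alignment scores -/

section Scores

variable {A : Type*} [Fintype A]

lemma SymScoring.abs_score_le (R : SymScoring A) (a b : Option A) : |R.score a b| ≤ ‖R‖ :=
  PiLp.norm_apply_le R.1 (a, b)

/-- The letter scores and the gap scores of `R` are bounded by constants `p` and `q`. As each gap
score occurs twice in the Frobenius norm, `p ^ 2 + 2 * q ^ 2 ≤ ‖R‖ ^ 2`. -/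
lemma SymScoring.exists_score_bounds (R : SymScoring A) : ∃ p q : ℝ, 0 ≤ p ∧ 0 ≤ q ∧
    (∀ a b, |R.score (some a) (some b)| ≤ p) ∧ (∀ a, |R.score (some a) none| ≤ q) ∧
    (∀ a, |R.score none (some a)| ≤ q) ∧ p ^ 2 + 2 * q ^ 2 ≤ ‖R‖ ^ 2 := by
  classical
  rcases isEmpty_or_nonempty A with hA | hA
  · exact ⟨0, 0, le_rfl, le_rfl, fun a => hA.elim a, fun a => hA.elim a, fun a => hA.elim a,
      by simp⟩
  obtain ⟨⟨a, b⟩, hab⟩ := Finite.exists_max fun z : A × A => |R.score (some z.1) (some z.2)|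
  obtain ⟨c, hc⟩ := Finite.exists_max fun a : A => |R.score (some a) none|
  have hsymm : ∀ a, R.score none (some a) = R.score (some a) none := fun a => R.2.1 _ _
  refine ⟨_, _, abs_nonneg _, abs_nonneg _, fun a' b' => hab (a', b'), hc,
    fun a' => by rw [hsymm]; exact hc a', ?_⟩
  have h1 : ‖R‖ ^ 2 = ∑ z, R.1 z ^ 2 := EuclideanSpace.real_norm_sq_eq R.1
  have h2 : ∑ z ∈ ({(some a, some b), (some c, none), (none, some c)} :
      Finset (Option A × Option A)), R.1 z ^ 2 ≤ ∑ z, R.1 z ^ 2 :=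
    Finset.sum_le_sum_of_subset_of_nonneg (Finset.subset_univ _) fun z _ _ => sq_nonneg _
  rw [Finset.sum_insert (by simp), Finset.sum_insert (by simp), Finset.sum_singleton] at h2
  have h3 : R.1 (none, some c) = R.1 (some c, none) := hsymm c
  rw [h1, sq_abs, sq_abs]
  simp only [SymScoring.score]
  rw [h3] at h2
  linarith

lemma totalScore_add {n : ℕ} (R R' : SymScoring A) (ν : GapAlignment n) (x y : Fin n → A) :
    totalScore (R + R') ν x y = totalScore R ν x y + totalScore R' ν x y := by
  have h : ∀ a b, (R + R').score a b = R.score a b + R'.score a b := fun a b => rfl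
  simp only [totalScore, h, Finset.sum_add_distrib]
  ring

lemma totalScore_smul {n : ℕ} (c : ℝ) (R : SymScoring A) (ν : GapAlignment n) (x y : Fin n → A) :
    totalScore (c • R) ν x y = c * totalScore R ν x y := by
  have h : ∀ a b, (c • R).score a b = c * R.score a b := fun a b => rfl
  simp only [totalScore, h, ← Finset.mul_sum]
  ring

lemma totalScore_neg {n : ℕ} (R : SymScoring A) (ν : GapAlignment n) (x y : Fin n → A) :
    totalScore (-R) ν x y = -totalScore R ν x y := by
  rw [← neg_one_smul ℝ R, totalScore_smul, neg_one_mul]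

lemma abs_sum_le_card_mul {ι : Type*} (s : Finset ι) {f : ι → ℝ} {c : ℝ} (h : ∀ i, |f i| ≤ c) :
    |∑ i ∈ s, f i| ≤ s.card * c := by
  rw [← nsmul_eq_mul]
  exact (Finset.abs_sum_le_sum_abs _ _).trans (Finset.sum_le_card_nsmul _ _ _ fun i _ => h i)

lemma abs_totalScore_le {n : ℕ} (R : SymScoring A) (ν : GapAlignment n) (x y : Fin n → A) :
    |totalScore R ν x y| ≤ 2 * ‖R‖ * n := by
  have hk : (ν.1 : ℕ) ≤ n := Nat.lt_succ_iff.1 ν.1.2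
  have h1 := abs_sum_le_card_mul Finset.univ
    fun l => R.abs_score_le (some (x (ν.2.1 l))) (some (y (ν.2.2 l)))
  have h2 := abs_sum_le_card_mul (Finset.univ.map ν.2.1.toEmbedding)ᶜ
    fun i => R.abs_score_le (some (x i)) none
  have h3 := abs_sum_le_card_mul (Finset.univ.map ν.2.2.toEmbedding)ᶜ
    fun i => R.abs_score_le none (some (y i))
  rw [Finset.card_compl, Finset.card_map, Finset.card_univ, Fintype.card_fin, Fintype.card_fin,
    Nat.cast_sub hk] at h2 h3
  rw [Finset.card_univ, Fintype.card_fin] at h1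
  have h4 : (0 : ℝ) ≤ (ν.1 : ℕ) * ‖R‖ := by positivity
  refine (abs_add_three _ _ _).trans ?_
  nlinarith

lemma sum_compl_sub_sum_compl_le {ι : Type*} [Fintype ι] [DecidableEq ι] (s t : Finset ι)
    {f : ι → ℝ} {q : ℝ} (h : ∀ i, |f i| ≤ q) :
    ∑ i ∈ sᶜ, f i - ∑ i ∈ tᶜ, f i ≤ Fintype.card ι * q := by
  have h1 : ∀ u : Finset ι, ∑ i ∈ u, f i = ∑ i, if i ∈ u then f i else 0 := fun u => by
    rw [← Finset.sum_filter, Finset.filter_mem_eq_inter, Finset.univ_inter]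
  rw [h1, h1, ← Finset.sum_sub_distrib, ← nsmul_eq_mul]
  refine Finset.sum_le_card_nsmul _ _ _ fun i _ => ?_
  have h2 := abs_le.1 (h i)
  have h3 := (abs_nonneg _).trans (h i)
  split_ifs <;> linarith

/-- Two alignments differ by at most `2 p + 2 q` per position. -/
lemma totalScore_sub_le {n : ℕ} (R : SymScoring A) (ν ν' : GapAlignment n) (x y : Fin n → A) :
    totalScore R ν x y - totalScore R ν' x y ≤ √6 * ‖R‖ * n := by
  obtain ⟨p, q, hp, hq, hRp, hRq, hRq', hpq⟩ := R.exists_score_bounds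
  have hcard : ∀ ν : GapAlignment n,
      |∑ l, R.score (some (x (ν.2.1 l))) (some (y (ν.2.2 l)))| ≤ n * p := by
    intro ν
    have hk : ((ν.1 : ℕ) : ℝ) ≤ n := by exact_mod_cast Nat.lt_succ_iff.1 ν.1.2
    have h1 := abs_sum_le_card_mul Finset.univ
      fun l => hRp (x (ν.2.1 l)) (y (ν.2.2 l))
    rw [Finset.card_univ, Fintype.card_fin] at h1
    exact h1.trans (mul_le_mul_of_nonneg_right hk hp)
  have h1 := (abs_le.1 (hcard ν)).2
  have h2 := (abs_le.1 (hcard ν')).1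
  have h3 := sum_compl_sub_sum_compl_le (Finset.univ.map ν.2.1.toEmbedding)
    (Finset.univ.map ν'.2.1.toEmbedding) fun i => hRq (x i)
  have h4 := sum_compl_sub_sum_compl_le (Finset.univ.map ν.2.2.toEmbedding)
    (Finset.univ.map ν'.2.2.toEmbedding) fun i => hRq' (y i)
  rw [Fintype.card_fin] at h3 h4
  -- the Cauchy-Schwarz inequality for `(2, √2)` and `(p, √2 q)`
  have h5 : 2 * p + 2 * q ≤ √6 * ‖R‖ := by
    refine abs_le_of_sq_le_sq' ?_ (by positivity) |>.2
    rw [mul_pow, Real.sq_sqrt (by norm_num)]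
    nlinarith [sq_nonneg (p - 2 * q)]
  have h6 : (n : ℝ) * (2 * p + 2 * q) ≤ √6 * ‖R‖ * n := by
    rw [mul_comm]
    exact mul_le_mul_of_nonneg_right h5 (Nat.cast_nonneg n)
  simp only [totalScore]
  linarith

lemma sum_ite_eq_le {ι κ : Type*} [DecidableEq κ] (s : Finset ι) {g : ι → κ}
    (hg : Function.Injective g) (i : κ) {c : ℝ} (hc : 0 ≤ c) :
    ∑ l ∈ s, (if g l = i then c else 0) ≤ c := by
  rw [← Finset.sum_filter, Finset.sum_const, nsmul_eq_mul]
  have h1 : (s.filter fun l => g l = i).card ≤ 1 := by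
    refine Finset.card_le_one.2 fun a ha b hb => hg ?_
    rw [(Finset.mem_filter.1 ha).2, (Finset.mem_filter.1 hb).2]
  have h2 : ((s.filter fun l => g l = i).card : ℝ) ≤ 1 := by exact_mod_cast h1
  nlinarith

/-- Changing one letter of each word changes at most four terms of the total score. -/
lemma totalScore_le_of_eq_off {n : ℕ} (R : SymScoring A) (ν : GapAlignment n)
    {x y x' y' : Fin n → A} {i : Fin n} (hx : ∀ j, j ≠ i → x j = x' j)
    (hy : ∀ j, j ≠ i → y j = y' j) :
    totalScore R ν x y ≤ totalScore R ν x' y' + 8 * ‖R‖ := by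
  have hR : ∀ a b a' b', R.score a b - R.score a' b' ≤ 2 * ‖R‖ := fun a b a' b' => by
    have h1 := (abs_le.1 (R.abs_score_le a b)).2
    have h2 := (abs_le.1 (R.abs_score_le a' b')).1
    linarith
  have h0 : 0 ≤ 2 * ‖R‖ := by positivity
  have h1 : ∑ l, R.score (some (x (ν.2.1 l))) (some (y (ν.2.2 l))) -
      ∑ l, R.score (some (x' (ν.2.1 l))) (some (y' (ν.2.2 l))) ≤ 2 * ‖R‖ + 2 * ‖R‖ := by
    rw [← Finset.sum_sub_distrib]
    calc _ ≤ ∑ l, ((if ν.2.1 l = i then 2 * ‖R‖ else 0) +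
          (if ν.2.2 l = i then 2 * ‖R‖ else 0)) := by
          refine Finset.sum_le_sum fun l _ => ?_
          by_cases h1 : ν.2.1 l = i
          · rw [if_pos h1]
            have h2 : (0 : ℝ) ≤ if ν.2.2 l = i then 2 * ‖R‖ else 0 := by split_ifs <;> simp
            linarith [hR (some (x (ν.2.1 l))) (some (y (ν.2.2 l))) (some (x' (ν.2.1 l)))
              (some (y' (ν.2.2 l)))]
          · by_cases h2 : ν.2.2 l = i
            · rw [if_neg h1, if_pos h2, zero_add]
              exact hR _ _ _ _
            · rw [if_neg h1, if_neg h2, hx _ h1, hy _ h2]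
              simp
      _ ≤ _ := by
          rw [Finset.sum_add_distrib]
          exact add_le_add (sum_ite_eq_le _ ν.2.1.injective i h0)
            (sum_ite_eq_le _ ν.2.2.injective i h0)
  have h2 : ∀ s : Finset (Fin n), ∑ j ∈ s, R.score (some (x j)) none -
      ∑ j ∈ s, R.score (some (x' j)) none ≤ 2 * ‖R‖ := fun s => by
    rw [← Finset.sum_sub_distrib]
    refine le_trans (Finset.sum_le_sum fun j _ => ?_)
      (sum_ite_eq_le s Function.injective_id i h0)
    by_cases hj : j = i
    · simpa [hj] using hR _ _ _ _
    · simp [hj, hx j hj]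
  have h3 : ∀ s : Finset (Fin n), ∑ j ∈ s, R.score none (some (y j)) -
      ∑ j ∈ s, R.score none (some (y' j)) ≤ 2 * ‖R‖ := fun s => by
    rw [← Finset.sum_sub_distrib]
    refine le_trans (Finset.sum_le_sum fun j _ => ?_)
      (sum_ite_eq_le s Function.injective_id i h0)
    by_cases hj : j = i
    · simpa [hj] using hR _ _ _ _
    · simp [hj, hy j hj]
  have h4 := h2 (Finset.univ.map ν.2.1.toEmbedding)ᶜ
  have h5 := h3 (Finset.univ.map ν.2.2.toEmbedding)ᶜ
  simp only [totalScore]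
  linarith

instance (n : ℕ) : Nonempty (GapAlignment n) :=
  ⟨⟨0, (OrderEmbedding.ofIsEmpty : Fin 0 ↪o Fin n), (OrderEmbedding.ofIsEmpty : Fin 0 ↪o Fin n)⟩⟩

/-- The optimal score of two words. -/
noncomputable def maxScore {n : ℕ} (x y : Fin n → A) (R : SymScoring A) : ℝ :=
  ⨆ ν : GapAlignment n, totalScore R ν x y

variable {n : ℕ} (x y : Fin n → A)

lemma totalScore_le_maxScore (R : SymScoring A) (ν : GapAlignment n) :
    totalScore R ν x y ≤ maxScore x y R :=
  le_ciSup (Set.finite_range fun ν : GapAlignment n => totalScore R ν x y).bddAbove ν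

lemma exists_totalScore_eq_maxScore (R : SymScoring A) :
    ∃ ν : GapAlignment n, totalScore R ν x y = maxScore x y R :=
  exists_eq_ciSup_of_finite

lemma abs_maxScore_le (R : SymScoring A) : |maxScore x y R| ≤ 2 * ‖R‖ * n := by
  obtain ⟨ν, hν⟩ := exists_totalScore_eq_maxScore x y R
  rw [← hν]
  exact abs_totalScore_le R ν x y

lemma maxScore_add_le (R R' : SymScoring A) :
    maxScore x y (R + R') ≤ maxScore x y R + maxScore x y R' :=
  ciSup_le fun ν => by
    rw [totalScore_add]
    exact add_le_add (totalScore_le_maxScore x y R ν) (totalScore_le_maxScore x y R' ν)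

lemma maxScore_smul {c : ℝ} (hc : 0 ≤ c) (R : SymScoring A) :
    maxScore x y (c • R) = c * maxScore x y R := by
  simp only [maxScore, totalScore_smul]
  exact (Real.mul_iSup_of_nonneg hc _).symm

lemma maxScore_add_maxScore_neg_le (R : SymScoring A) :
    maxScore x y R + maxScore x y (-R) ≤ √6 * ‖R‖ * n := by
  obtain ⟨ν, hν⟩ := exists_totalScore_eq_maxScore x y R
  obtain ⟨ν', hν'⟩ := exists_totalScore_eq_maxScore x y (-R)
  rw [← hν, ← hν', totalScore_neg]
  exact totalScore_sub_le R ν ν' x y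

lemma isSupportFun_maxScore_div : IsSupportFun fun R => maxScore x y R / n where
  smul c hc R := by rw [maxScore_smul x y hc]; ring
  add_le R R' := by
    rw [← add_div]
    exact div_le_div_of_nonneg_right (maxScore_add_le x y R R') (Nat.cast_nonneg n)
  bound := ⟨2, fun R => div_le_of_le_mul₀ (Nat.cast_nonneg n) (by positivity)
    (abs_le.1 (abs_maxScore_le x y R)).2⟩

variable {x y}

lemma maxScore_le_of_eq_off (R : SymScoring A) {x' y' : Fin n → A} {i : Fin n}
    (hx : ∀ j, j ≠ i → x j = x' j) (hy : ∀ j, j ≠ i → y j = y' j) :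
    maxScore x y R ≤ maxScore x' y' R + 8 * ‖R‖ :=
  ciSup_le fun ν => (totalScore_le_of_eq_off R ν hx hy).trans
    (add_le_add_left (totalScore_le_maxScore x' y' R ν) _)

end Scores

section Concatenation

/-- Two increasing sequences of positions, one after the other. -/
def appendOrderEmb {a b m n : ℕ} (f : Fin a ↪o Fin m) (g : Fin b ↪o Fin n) :
    Fin (a + b) ↪o Fin (m + n) :=
  OrderEmbedding.ofStrictMono
    (Fin.append (fun i => Fin.castAdd n (f i)) fun j => Fin.natAdd m (g j)) <| by
    intro i j hij
    induction i using Fin.addCases with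
    | left i =>
      induction j using Fin.addCases with
      | left j =>
        simp only [Fin.append_left]
        exact f.strictMono hij
      | right j =>
        simp only [Fin.append_left, Fin.append_right]
        exact Fin.lt_def.2 ((f i).2.trans_le (Nat.le_add_right _ _))
    | right i =>
      induction j using Fin.addCases with
      | left j =>
        have := Fin.lt_def.1 hij
        simp only [Fin.val_natAdd, Fin.val_castAdd] at this
        omega
      | right j =>
        simp only [Fin.append_right]
        have h1 : i < j := by
          have := Fin.lt_def.1 hij
          simp only [Fin.val_natAdd] at this
          exact Fin.lt_def.2 (by omega)
        have := Fin.lt_def.1 (g.strictMono h1)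
        exact Fin.lt_def.2 (by simpa using this)

variable {a b m n : ℕ} (f : Fin a ↪o Fin m) (g : Fin b ↪o Fin n)

lemma appendOrderEmb_castAdd (i : Fin a) :
    appendOrderEmb f g (Fin.castAdd b i) = Fin.castAdd n (f i) :=
  Fin.append_left (fun i => Fin.castAdd n (f i)) (fun j => Fin.natAdd m (g j)) i

lemma appendOrderEmb_natAdd (j : Fin b) :
    appendOrderEmb f g (Fin.natAdd a j) = Fin.natAdd m (g j) :=
  Fin.append_right (fun i => Fin.castAdd n (f i)) (fun j => Fin.natAdd m (g j)) j

lemma sum_compl_map {α M : Type*} [Fintype α] {ι : Type*} [Fintype ι] [DecidableEq ι]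
    [AddCommGroup M] (e : α ↪ ι) (F : ι → M) :
    ∑ i ∈ (Finset.univ.map e)ᶜ, F i = ∑ i, F i - ∑ l, F (e l) := by
  rw [eq_sub_iff_add_eq, ← Finset.sum_map Finset.univ e F, Finset.sum_compl_add_sum]

lemma sum_compl_appendOrderEmb (F : Fin (m + n) → ℝ) :
    ∑ i ∈ (Finset.univ.map (appendOrderEmb f g).toEmbedding)ᶜ, F i =
      ∑ i ∈ (Finset.univ.map f.toEmbedding)ᶜ, F (Fin.castAdd n i) +
        ∑ i ∈ (Finset.univ.map g.toEmbedding)ᶜ, F (Fin.natAdd m i) := by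
  rw [sum_compl_map, sum_compl_map _ fun i => F (Fin.castAdd n i),
    sum_compl_map _ fun i => F (Fin.natAdd m i), Fin.sum_univ_add, Fin.sum_univ_add]
  simp only [RelEmbedding.coe_toEmbedding, appendOrderEmb_castAdd, appendOrderEmb_natAdd]
  abel

variable {A : Type*} [Fintype A]

/-- The alignment of two concatenated words that is given by alignments of their parts. -/
def GapAlignment.append (ν : GapAlignment m) (ν' : GapAlignment n) : GapAlignment (m + n) :=
  ⟨⟨ν.1 + ν'.1, by have := ν.1.2; have := ν'.1.2; omega⟩,
    appendOrderEmb ν.2.1 ν'.2.1, appendOrderEmb ν.2.2 ν'.2.2⟩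

lemma totalScore_append (R : SymScoring A) (ν : GapAlignment m) (ν' : GapAlignment n)
    (x y : Fin m → A) (x' y' : Fin n → A) :
    totalScore R (ν.append ν') (Fin.append x x') (Fin.append y y') =
      totalScore R ν x y + totalScore R ν' x' y' := by
  have h1 : ∑ l : Fin (ν.1 + ν'.1), R.score
        (some (Fin.append x x' (appendOrderEmb ν.2.1 ν'.2.1 l)))
        (some (Fin.append y y' (appendOrderEmb ν.2.2 ν'.2.2 l))) =
      ∑ l, R.score (some (x (ν.2.1 l))) (some (y (ν.2.2 l))) +
        ∑ l, R.score (some (x' (ν'.2.1 l))) (some (y' (ν'.2.2 l))) := by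
    rw [Fin.sum_univ_add]
    simp only [appendOrderEmb_castAdd, appendOrderEmb_natAdd, Fin.append_left, Fin.append_right]
  have h2 := sum_compl_appendOrderEmb ν.2.1 ν'.2.1
    fun i => R.score (some (Fin.append x x' i)) none
  have h3 := sum_compl_appendOrderEmb ν.2.2 ν'.2.2
    fun i => R.score none (some (Fin.append y y' i))
  simp only [Fin.append_left, Fin.append_right] at h2 h3
  refine (congrArg₂ (· + ·) (congrArg₂ (· + ·) h1 h2) h3).trans ?_
  simp only [totalScore]
  ring

lemma maxScore_add_le_append (R : SymScoring A) (x y : Fin m → A) (x' y' : Fin n → A) :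
    maxScore x y R + maxScore x' y' R ≤ maxScore (Fin.append x x') (Fin.append y y') R := by
  obtain ⟨ν, hν⟩ := exists_totalScore_eq_maxScore x y R
  obtain ⟨ν', hν'⟩ := exists_totalScore_eq_maxScore x' y' R
  rw [← hν, ← hν', ← totalScore_append]
  exact totalScore_le_maxScore _ _ _ _

end Concatenation

/-! ### Superadditive functions of independent letters -/

section LawOfLargeNumbers

variable {B : Type*} [Finite B] [MeasurableSpace B] [MeasurableSingletonClass B]
  (ν : Measure B) [IsProbabilityMeasure ν]

lemma integral_sq_le_of_le_add {φ : B → ℝ} {c : ℝ} (h : ∀ b b', φ b ≤ φ b' + c) :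
    ∫ b, φ b ^ 2 ∂ν ≤ (∫ b, φ b ∂ν) ^ 2 + c ^ 2 := by
  set g := ∫ b, φ b ∂ν with hg
  have hup : ∀ b, φ b ≤ g + c := fun b => by
    have := integral_mono (μ := ν) (f := fun _ => φ b - c) (g := φ) .of_finite .of_finite
      fun b' => by linarith [h b b']
    simp only [integral_const, probReal_univ, one_smul] at this
    linarith
  have hlow : ∀ b, g - c ≤ φ b := fun b => by
    have := integral_mono (μ := ν) (f := φ) (g := fun _ => φ b + c) .of_finite .of_finite
      fun b' => h b' b
    simp only [integral_const, probReal_univ, one_smul] at this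
    linarith
  have h1 : ∫ b, φ b ^ 2 ∂ν ≤ ∫ b, (2 * g * φ b + (c ^ 2 - g ^ 2)) ∂ν :=
    integral_mono .of_finite .of_finite fun b => by
      have h2 := hup b
      have h3 := hlow b
      show φ b ^ 2 ≤ 2 * g * φ b + (c ^ 2 - g ^ 2)
      nlinarith
  rw [integral_add .of_finite .of_finite, integral_const_mul, ← hg] at h1
  simp only [integral_const, probReal_univ, one_smul] at h1
  linarith

/-- A function of `n` independent letters that changes by at most `c` when one letter changes has
variance at most `n * c ^ 2`. -/
lemma integral_pi_sq_le {c : ℝ} (n : ℕ) {f : (Fin n → B) → ℝ}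
    (hf : ∀ (z z' : Fin n → B) i, (∀ j, j ≠ i → z j = z' j) → f z ≤ f z' + c) :
    ∫ z, f z ^ 2 ∂Measure.pi (fun _ : Fin n => ν) ≤
      (∫ z, f z ∂Measure.pi (fun _ : Fin n => ν)) ^ 2 + n * c ^ 2 := by
  induction n with
  | zero =>
    have h1 : ∀ z, f z = f default := fun z => congrArg f (Subsingleton.elim _ _)
    simp [h1]
  | succ n ih =>
    have hmp := (measurePreserving_piFinSuccAbove (fun _ : Fin (n + 1) => ν) 0).symm
    set e := (MeasurableEquiv.piFinSuccAbove (fun _ : Fin (n + 1) => B) 0).symm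
    have hint : ∀ F : (Fin (n + 1) → B) → ℝ, ∫ z, F z ∂Measure.pi (fun _ : Fin (n + 1) => ν) =
        ∫ z, ∫ b, F (e (b, z)) ∂ν ∂Measure.pi (fun _ : Fin n => ν) := by
      intro F
      rw [← hmp.integral_comp e.measurableEmbedding F]
      exact integral_prod_symm _ .of_finite
    rw [hint f, hint]
    have h1 : ∀ z, ∫ b, f (e (b, z)) ^ 2 ∂ν ≤ (∫ b, f (e (b, z)) ∂ν) ^ 2 + c ^ 2 := by
      refine fun z => integral_sq_le_of_le_add ν fun b b' => hf _ _ 0 fun j hj => ?_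
      obtain ⟨j, rfl⟩ := Fin.exists_succ_eq.2 hj
      rfl
    have h2 := ih (f := fun z => ∫ b, f (e (b, z)) ∂ν) fun z z' i hzz' => by
      have h3 : ∫ b, f (e (b, z)) ∂ν ≤ ∫ b, (f (e (b, z')) + c) ∂ν := by
        refine integral_mono .of_finite .of_finite fun b => hf _ _ i.succ fun j hj => ?_
        cases j using Fin.cases with
        | zero => rfl
        | succ j => exact hzz' j fun h => hj (congrArg Fin.succ h)
      rw [integral_add .of_finite .of_finite] at h3
      simpa using h3
    calc _ ≤ ∫ z, ((∫ b, f (e (b, z)) ∂ν) ^ 2 + c ^ 2) ∂Measure.pi (fun _ : Fin n => ν) :=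
          integral_mono .of_finite .of_finite h1
      _ ≤ _ := by
          rw [integral_add .of_finite .of_finite]
          simp only [integral_const, probReal_univ, one_smul]
          push_cast
          linarith

variable {Ω : Type*} [MeasurableSpace Ω] {P : Measure Ω} [IsProbabilityMeasure P]
  {Z : ℕ → Ω → B} {V : ∀ n, (Fin n → B) → ℝ} {c C : ℝ}

lemma tendsto_integral_div
    (hZ : ∀ m n, HasLaw (fun ω (i : Fin n) => Z (m + i) ω) (Measure.pi fun _ => ν) P)
    (hbound : ∀ n z, |V n z| ≤ C * n)
    (hsuper : ∀ m n (z : Fin m → B) (z' : Fin n → B), V m z + V n z' ≤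
      V (m + n) (Fin.append z z')) :
    ∃ l, Tendsto (fun n : ℕ => (∫ z, V n z ∂Measure.pi fun _ : Fin n => ν) / n) atTop (𝓝 l) := by
  have hlaw : ∀ m n, ∫ ω, V n (fun i : Fin n => Z (m + i) ω) ∂P =
      ∫ z, V n z ∂Measure.pi fun _ : Fin n => ν := fun m n =>
    (hZ m n).integral_comp (X := fun ω (i : Fin n) => Z (m + i) ω)
      (Measurable.of_discrete (f := V n)).aestronglyMeasurable
  have hint : ∀ m n, Integrable (fun ω => V n (fun i : Fin n => Z (m + i) ω)) P := fun m n =>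
    Integrable.of_bound ((Measurable.of_discrete (f := V n)).comp_aemeasurable
      (hZ m n).aemeasurable).aestronglyMeasurable (C * n)
      (Eventually.of_forall fun ω => hbound n _)
  set a : ℕ → ℝ := fun n => ∫ z, V n z ∂Measure.pi fun _ : Fin n => ν with ha
  have hsub : Subadditive fun n => -a n := by
    intro m n
    have h1 : ∫ ω, (V m (fun i : Fin m => Z (0 + i) ω) + V n (fun i : Fin n => Z (m + i) ω)) ∂P ≤
        ∫ ω, V (m + n) (fun i : Fin (m + n) => Z (0 + i) ω) ∂P := by
      refine integral_mono ((hint 0 m).add (hint m n)) (hint 0 (m + n)) fun ω => ?_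
      refine (hsuper m n _ _).trans_eq (congrArg (V (m + n)) (funext fun i => ?_))
      induction i using Fin.addCases with
      | left i => simp
      | right i => simp
    rw [integral_add (hint 0 m) (hint m n), hlaw, hlaw, hlaw] at h1
    show -a (m + n) ≤ -a m + -a n
    linarith
  have hC : 0 ≤ C := by
    have hB : Nonempty B := ν.nonempty_of_neZero
    have := (abs_nonneg _).trans (hbound 1 fun _ => hB.some)
    simpa using this
  have hbdd : BddBelow (range fun n : ℕ => -a n / n) := by
    refine ⟨-C, ?_⟩
    rintro _ ⟨n, rfl⟩
    rcases Nat.eq_zero_or_pos n with rfl | hn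
    · simpa using hC
    · have hn' : (0 : ℝ) < n := by exact_mod_cast hn
      show -C ≤ -a n / n
      rw [le_div_iff₀ hn']
      have h1 : a n ≤ ∫ _, C * n ∂Measure.pi fun _ : Fin n => ν :=
        integral_mono .of_finite .of_finite fun z => (abs_le.1 (hbound n z)).2
      simp only [integral_const, probReal_univ, one_smul] at h1
      linarith
  refine ⟨-hsub.lim, ?_⟩
  have := (hsub.tendsto_lim hbdd).neg
  simpa [neg_div] using this

omit [IsProbabilityMeasure P] in
/-- The variance bound gives almost sure convergence along the squares. -/
lemma ae_tendsto_sub_div_sq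
    (hZ : ∀ n, HasLaw (fun ω (i : Fin n) => Z i ω) (Measure.pi fun _ => ν) P)
    (hdiff : ∀ n (z z' : Fin n → B) i, (∀ j, j ≠ i → z j = z' j) → V n z ≤ V n z' + c) :
    ∀ᵐ ω ∂P, Tendsto (fun n : ℕ => (V ((n + 1) ^ 2) (fun i => Z i ω) -
      ∫ z, V ((n + 1) ^ 2) z ∂Measure.pi fun _ => ν) / ((n + 1) ^ 2 : ℕ)) atTop (𝓝 0) := by
  set a : ℕ → ℝ := fun n => ∫ z, V n z ∂Measure.pi fun _ : Fin n => ν with ha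
  have hvar : ∀ n, ∫⁻ ω, ENNReal.ofReal (((V n (fun i => Z i ω) - a n) / n) ^ 2) ∂P ≤
      ENNReal.ofReal (n * c ^ 2 / n ^ 2) := by
    intro n
    rw [(hZ n).lintegral_comp (f := fun z => ENNReal.ofReal (((V n z - a n) / n) ^ 2))
      (Measurable.of_discrete.aemeasurable),
      ← ofReal_integral_eq_lintegral_ofReal .of_finite (Eventually.of_forall fun z => sq_nonneg _)]
    refine ENNReal.ofReal_le_ofReal ?_
    simp only [div_pow]
    rw [integral_div]
    refine div_le_div_of_nonneg_right ?_ (sq_nonneg _)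
    have h1 := integral_pi_sq_le ν n (hdiff n)
    have h2 : ∀ z, (V n z - a n) ^ 2 = V n z ^ 2 - (2 * a n * V n z - a n ^ 2) := fun z => by ring
    simp only [h2]
    rw [integral_sub .of_finite .of_finite, integral_sub .of_finite .of_finite, integral_const_mul]
    simp only [integral_const, probReal_univ, one_smul]
    change _ - (2 * a n * a n - a n ^ 2) ≤ _
    change _ ≤ a n ^ 2 + _ at h1
    linarith
  have hmeas : ∀ n, AEMeasurable
      (fun ω => ENNReal.ofReal (((V n (fun i => Z i ω) - a n) / n) ^ 2)) P := fun n =>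
    (Measurable.of_discrete
      (f := fun z => ENNReal.ofReal (((V n z - a n) / n) ^ 2))).comp_aemeasurable (hZ n).aemeasurable
  have hsum : ∑' n : ℕ, ENNReal.ofReal (((n + 1) ^ 2 : ℕ) * c ^ 2 / ((n + 1) ^ 2 : ℕ) ^ 2) ≠ ∞ := by
    refine Summable.tsum_ofReal_ne_top ?_
    have h1 : Summable fun n : ℕ => c ^ 2 * (1 / ((n + 1 : ℕ) : ℝ) ^ 2) :=
      ((summable_nat_add_iff 1).2 (Real.summable_one_div_nat_pow.2 one_lt_two)).mul_left _
    refine h1.congr fun n => ?_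
    have : ((n + 1 : ℕ) : ℝ) ≠ 0 := by positivity
    push_cast at this ⊢
    field_simp
  have hfin : ∫⁻ ω, ∑' n : ℕ, ENNReal.ofReal (((V ((n + 1) ^ 2) (fun i => Z i ω) -
      a ((n + 1) ^ 2)) / ((n + 1) ^ 2 : ℕ)) ^ 2) ∂P ≠ ∞ := by
    rw [lintegral_tsum fun n => hmeas _]
    exact ne_top_of_le_ne_top hsum (ENNReal.tsum_le_tsum fun n => hvar _)
  filter_upwards [ae_lt_top' (AEMeasurable.tsum fun n => hmeas _) hfin] with ω hω
  have h1 := ENNReal.tendsto_atTop_zero_of_tsum_ne_top hω.ne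
  have h2 := (ENNReal.tendsto_toReal ENNReal.zero_ne_top).comp h1
  have h3 : Tendsto (fun n : ℕ => ((V ((n + 1) ^ 2) (fun i => Z i ω) -
      a ((n + 1) ^ 2)) / ((n + 1) ^ 2 : ℕ)) ^ 2) atTop (𝓝 0) := by
    refine h2.congr fun n => ?_
    exact ENNReal.toReal_ofReal (sq_nonneg _)
  rw [tendsto_zero_iff_abs_tendsto_zero]
  have h4 := (Real.continuous_sqrt.tendsto 0).comp h3
  rw [Real.sqrt_zero] at h4
  exact h4.congr fun n => Real.sqrt_sq_eq_abs _

/-- A superadditive function of independent letters, with bounded differences, grows linearly. -/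
lemma exists_ae_tendsto_div
    (hZ : ∀ m n, HasLaw (fun ω (i : Fin n) => Z (m + i) ω) (Measure.pi fun _ => ν) P)
    (hbound : ∀ n z, |V n z| ≤ C * n)
    (hsuper : ∀ m n (z : Fin m → B) (z' : Fin n → B), V m z + V n z' ≤ V (m + n) (Fin.append z z'))
    (hdiff : ∀ n (z z' : Fin n → B) i, (∀ j, j ≠ i → z j = z' j) → V n z ≤ V n z' + c) :
    ∃ l, ∀ᵐ ω ∂P, Tendsto (fun n : ℕ => V n (fun i => Z i ω) / n) atTop (𝓝 l) := by
  obtain ⟨l, hl⟩ := tendsto_integral_div ν hZ hbound hsuper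
  refine ⟨l, ?_⟩
  have hZ0 : ∀ n, HasLaw (fun ω (i : Fin n) => Z i ω) (Measure.pi fun _ => ν) P := fun n => by
    simpa using hZ 0 n
  have hsq : Tendsto (fun n : ℕ => (n + 1) ^ 2) atTop atTop :=
    tendsto_atTop_mono (fun n => show n ≤ (n + 1) ^ 2 by nlinarith) tendsto_id
  filter_upwards [ae_tendsto_sub_div_sq ν hZ0 hdiff] with ω hω
  -- `V n + C n` is monotone in `n`, which fills the gaps between the squares
  have hmono : Monotone fun n : ℕ => V n (fun i => Z i ω) + C * n := by
    refine monotone_nat_of_le_succ fun n => ?_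
    have h1 := hsuper n 1 (fun i => Z i ω) (fun i => Z (n + i) ω)
    have h2 := (abs_le.1 (hbound 1 fun i => Z (n + i) ω)).1
    have h3 : Fin.append (fun i : Fin n => Z i ω) (fun i : Fin 1 => Z (n + i) ω) =
        fun i : Fin (n + 1) => Z i ω := by
      funext i
      induction i using Fin.addCases with
      | left i => simp
      | right i => simp
    rw [h3] at h1
    push_cast at h2 ⊢
    linarith
  have key := tendsto_div_of_monotone_of_exists_subseq_tendsto_div _ (l + C) hmono
    fun b hb => ⟨fun n => (n + 1) ^ 2, ?_, hsq, ?_⟩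
  · have h1 := key.sub_const C
    rw [add_sub_cancel_right] at h1
    refine h1.congr' ?_
    filter_upwards [eventually_gt_atTop 0] with n hn
    have : (n : ℝ) ≠ 0 := by positivity
    field_simp
    ring
  · have h1 : Tendsto (fun n : ℕ => (1 + 1 / ((n : ℝ) + 1)) ^ 2) atTop (𝓝 ((1 + 0) ^ 2)) :=
      (tendsto_const_nhds.add tendsto_one_div_add_atTop_nhds_zero_nat).pow 2
    rw [add_zero, one_pow] at h1
    filter_upwards [h1.eventually (gt_mem_nhds hb)] with n hn
    have h2 : (0 : ℝ) < (n : ℝ) + 1 := by positivity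
    have h3 : (((n + 1 + 1) ^ 2 : ℕ) : ℝ) =
        (1 + 1 / ((n : ℝ) + 1)) ^ 2 * (((n + 1) ^ 2 : ℕ) : ℝ) := by
      push_cast
      field_simp
    rw [h3]
    exact mul_le_mul_of_nonneg_right hn.le (by positivity)
  · have h1 := (hω.add (hl.comp hsq)).add_const C
    rw [zero_add] at h1
    refine h1.congr fun n => ?_
    have : (((n + 1) ^ 2 : ℕ) : ℝ) ≠ 0 := by positivity
    simp only [Function.comp_apply]
    field_simp
    ring

end LawOfLargeNumbers

/-! ### The limit of the optimal scores -/

section ScoreRate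

variable {A Ω : Type*} [Fintype A] [MeasurableSpace Ω] {P : Measure Ω} {X Y : ℕ → Ω → A}

/-- The pairs of letters are independent. -/
lemma hasLaw_pairs [MeasurableSpace A] [MeasurableSingletonClass A] [IsProbabilityMeasure P]
    {letterLaw : Measure A} (hX : ∀ i, HasLaw (X i) letterLaw P)
    (hY : ∀ i, HasLaw (Y i) letterLaw P) (hXY : iIndepFun (Sum.elim X Y) P) (m n : ℕ) :
    HasLaw (fun ω (i : Fin n) => (X (m + i) ω, Y (m + i) ω))
      (Measure.pi fun _ => letterLaw.prod letterLaw) P := by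
  have : IsProbabilityMeasure letterLaw := (hX 0).isProbabilityMeasure_iff.1 inferInstance
  let g : Fin n ⊕ Fin n → ℕ ⊕ ℕ := Sum.map (fun i => m + i) fun i => m + i
  have hg : Function.Injective g := by
    have h1 : Function.Injective fun i : Fin n => m + (i : ℕ) := fun i j hij =>
      Fin.ext (Nat.add_left_cancel hij)
    exact Sum.map_injective.2 ⟨h1, h1⟩
  have hlaw : ∀ j, HasLaw (fun ω => Sum.elim X Y (g j) ω) letterLaw P := by
    rintro (j | j)
    · exact hX _
    · exact hY _
  have h1 := iIndepFun.hasLaw_pi hlaw (hXY.precomp hg)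
  let e : (Fin n ⊕ Fin n → A) → Fin n → A × A := fun z i => (z (Sum.inl i), z (Sum.inr i))
  have h2 : HasLaw e (Measure.pi fun _ => letterLaw.prod letterLaw)
      (Measure.pi fun _ : Fin n ⊕ Fin n => letterLaw) := by
    refine ⟨Measurable.of_discrete.aemeasurable, Measure.ext_of_singleton fun w => ?_⟩
    rw [Measure.map_apply Measurable.of_discrete (measurableSet_singleton w), Measure.pi_singleton]
    have h3 : e ⁻¹' {w} = {Sum.elim (fun i => (w i).1) fun i => (w i).2} := by
      ext z
      constructor
      · rintro rfl
        ext (i | i) <;> rfl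
      · rintro rfl
        rfl
    have h4 : ∀ i, (letterLaw.prod letterLaw) {w i} = letterLaw {(w i).1} * letterLaw {(w i).2} :=
      fun i => by rw [← Measure.prod_prod, singleton_prod_singleton]
    rw [h3, Measure.pi_singleton, Fintype.prod_sum_type]
    simp only [h4, Finset.prod_mul_distrib, Sum.elim_inl, Sum.elim_inr]
  exact h2.comp h1

/-- `h R` is the almost sure limit of the optimal score per letter, for each scoring function
`R`. -/
def IsScoreRate (P : Measure Ω) (X Y : ℕ → Ω → A) (h : SymScoring A → ℝ) : Prop :=
  ∀ R, ∀ᵐ ω ∂P, Tendsto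
    (fun n : ℕ => maxScore (fun i : Fin n => X i ω) (fun i : Fin n => Y i ω) R / n) atTop (𝓝 (h R))

lemma exists_isScoreRate [MeasurableSpace A] [MeasurableSingletonClass A] [IsProbabilityMeasure P]
    {letterLaw : Measure A} (hX : ∀ i, HasLaw (X i) letterLaw P)
    (hY : ∀ i, HasLaw (Y i) letterLaw P) (hXY : iIndepFun (Sum.elim X Y) P) :
    ∃ h, IsScoreRate P X Y h := by
  have : IsProbabilityMeasure letterLaw := (hX 0).isProbabilityMeasure_iff.1 inferInstance
  have key : ∀ R : SymScoring A, ∃ l, ∀ᵐ ω ∂P, Tendsto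
      (fun n : ℕ => maxScore (fun i : Fin n => X i ω) (fun i : Fin n => Y i ω) R / n)
      atTop (𝓝 l) := by
    intro R
    refine exists_ae_tendsto_div (letterLaw.prod letterLaw) (Z := fun i ω => (X i ω, Y i ω))
      (V := fun n z => maxScore (fun i => (z i).1) (fun i => (z i).2) R) (C := 2 * ‖R‖)
      (c := 8 * ‖R‖) (hasLaw_pairs hX hY hXY) (fun n z => abs_maxScore_le _ _ R) ?_ ?_
    · intro m n z z'
      refine (maxScore_add_le_append R _ _ _ _).trans_eq ?_
      congr 1 <;>
      · funext i
        induction i using Fin.addCases <;> simp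
    · intro n z z' i hzz'
      exact maxScore_le_of_eq_off R (fun j hj => congrArg Prod.fst (hzz' j hj))
        fun j hj => congrArg Prod.snd (hzz' j hj)
  choose h hh using key
  exact ⟨h, hh⟩

variable {h : SymScoring A → ℝ} [IsProbabilityMeasure P]

lemma IsScoreRate.le_norm (hh : IsScoreRate P X Y h) (R : SymScoring A) : h R ≤ 2 * ‖R‖ := by
  obtain ⟨ω, hω⟩ := (hh R).exists
  exact le_of_tendsto' hω fun n => div_le_of_le_mul₀ (Nat.cast_nonneg n) (by positivity)
    (abs_le.1 (abs_maxScore_le _ _ R)).2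

lemma IsScoreRate.isSupportFun (hh : IsScoreRate P X Y h) : IsSupportFun h where
  smul c hc R := by
    obtain ⟨ω, h1, h2⟩ := ((hh R).and (hh (c • R))).exists
    exact tendsto_nhds_unique h2 ((h1.const_mul c).congr fun n =>
      ((isSupportFun_maxScore_div _ _).smul c hc R).symm)
  add_le R R' := by
    obtain ⟨ω, h1, h2, h3⟩ := ((hh R).and ((hh R').and (hh (R + R')))).exists
    exact le_of_tendsto_of_tendsto' h3 (h1.add h2) fun n =>
      (isSupportFun_maxScore_div _ _).add_le R R'
  bound := ⟨2, hh.le_norm⟩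

lemma IsScoreRate.width_le (hh : IsScoreRate P X Y h) (R : SymScoring A) :
    h R + h (-R) ≤ √6 * ‖R‖ := by
  obtain ⟨ω, h1, h2⟩ := ((hh R).and (hh (-R))).exists
  refine le_of_tendsto' (h1.add h2) fun n => ?_
  rw [← add_div]
  exact div_le_of_le_mul₀ (Nat.cast_nonneg n) (by positivity)
    (maxScore_add_maxScore_neg_le _ _ R)

end ScoreRate

/-! ### The score sets as bodies of support functions -/

section ScoreSets

variable {A Ω : Type*} [Fintype A] [MeasurableSpace Ω] {P : Measure Ω} {X Y : ℕ → Ω → A}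

/-- The map `u ↦ u₀ S + u₁ T` from the plane to the scoring functions. -/
noncomputable def scoreCombination (S T : SymScoring A) : Plane →L[ℝ] SymScoring A :=
  (EuclideanSpace.proj (0 : Fin 2) : Plane →L[ℝ] ℝ).smulRight S +
    (EuclideanSpace.proj (1 : Fin 2) : Plane →L[ℝ] ℝ).smulRight T

lemma scoreCombination_apply (S T : SymScoring A) (u : Plane) :
    scoreCombination S T u = u 0 • S + u 1 • T := rfl

lemma slopeSupport_scoreCombination (h : SymScoring A → ℝ) (S T : SymScoring A) :
    slopeSupport (fun u => h (scoreCombination S T u)) = fun t : ℝ => h (S + t • T) := by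
  funext t
  simp [slopeSupport, scoreCombination_apply]

lemma scoreSet_eq_supportBody {n : ℕ} (S T : SymScoring A) (x y : Fin n → A) :
    scoreSet S T x y = supportBody fun u => maxScore x y (scoreCombination S T u) / n := by
  have hinner : ∀ (ν : GapAlignment n) (u : Plane),
      inner ℝ (!₂[totalScore S ν x y / n, totalScore T ν x y / n] : Plane) u =
        totalScore (scoreCombination S T u) ν x y / n := by
    intro ν u
    rw [scoreCombination_apply, totalScore_add, totalScore_smul, totalScore_smul]
    simp only [PiLp.inner_apply, Fin.sum_univ_two]
    simp
    ring
  have hmem : ∀ ν : GapAlignment n,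
      (!₂[totalScore S ν x y / n, totalScore T ν x y / n] : Plane) ∈ scoreSet S T x y :=
    fun ν => subset_closure (subset_convexHull ℝ _ (mem_range_self ν))
  refine eq_supportBody ⟨_, hmem (Classical.arbitrary _)⟩ isClosed_closure
    (convex_convexHull ℝ _).closure fun u => ⟨?_, ?_⟩
  · rintro _ ⟨z, hz, rfl⟩
    have hsub : scoreSet S T x y ⊆
        {z : Plane | inner ℝ z u ≤ maxScore x y (scoreCombination S T u) / n} := by
      refine closure_minimal (convexHull_min ?_ ?_) (isClosed_le (by fun_prop) continuous_const)
      · rintro _ ⟨ν, rfl⟩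
        refine (hinner ν u).trans_le ?_
        exact div_le_div_of_nonneg_right (totalScore_le_maxScore x y _ ν) (Nat.cast_nonneg n)
      · refine convex_halfSpace_le ⟨fun a b => inner_add_left a b u, fun c a => ?_⟩ _
        rw [real_inner_smul_left, smul_eq_mul]
    exact hsub hz
  · intro b hb
    obtain ⟨ν, hν⟩ := exists_totalScore_eq_maxScore x y (scoreCombination S T u)
    have h1 := hb (mem_image_of_mem _ (hmem ν))
    rwa [hinner, hν] at h1

variable [IsProbabilityMeasure P]

lemma IsScoreRate.isLimitSet {h : SymScoring A → ℝ} (hh : IsScoreRate P X Y h)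
    (S T : SymScoring A) :
    IsLimitSet P X Y S T (supportBody fun u => h (scoreCombination S T u)) := by
  have hg := hh.isSupportFun.comp_linear (scoreCombination S T)
  refine ⟨hg.nonempty_supportBody, hg.isCompact_supportBody, convex_supportBody _, ?_⟩
  have hae : ∀ᵐ ω ∂P, ∀ k, Tendsto (fun n : ℕ => maxScore (fun i : Fin n => X i ω)
      (fun i : Fin n => Y i ω) (scoreCombination S T (TopologicalSpace.denseSeq Plane k)) / n) atTop
      (𝓝 (h (scoreCombination S T (TopologicalSpace.denseSeq Plane k)))) :=
    ae_all_iff.2 fun k => hh _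
  have hnorm : ∀ u, 2 * ‖scoreCombination S T u‖ ≤ 2 * ‖scoreCombination S T‖ * ‖u‖ := fun u => by
    rw [mul_assoc]
    exact mul_le_mul_of_nonneg_left ((scoreCombination S T).le_opNorm u) zero_le_two
  filter_upwards [hae] with ω hω
  simp only [scoreSet_eq_supportBody]
  exact hg.tendsto_hausdorffDist_supportBody
    (gn := fun n u => maxScore (fun i : Fin n => X i ω) (fun i : Fin n => Y i ω)
      (scoreCombination S T u) / n)
    (fun n => (isSupportFun_maxScore_div _ _).comp_linear (scoreCombination S T))
    (fun u => (hh.le_norm _).trans (hnorm u))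
    (fun n u => (div_le_of_le_mul₀ (Nat.cast_nonneg n) (by positivity)
      (abs_le.1 (abs_maxScore_le _ _ _)).2).trans (hnorm u))
    (TopologicalSpace.denseRange_denseSeq Plane) hω

lemma IsLimitSet.unique {S T : SymScoring A} {K K' : Set Plane} (hK : IsLimitSet P X Y S T K)
    (hK' : IsLimitSet P X Y S T K') : K = K' := by
  obtain ⟨ω, h1, h2⟩ := (hK.tendsto.and hK'.tendsto).exists
  refine (hK.isCompact.isClosed.hausdorffDist_zero_iff_eq hK'.isCompact.isClosed
    (Metric.hausdorffEDist_ne_top_of_nonempty_of_bounded hK.nonempty hK'.nonempty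
      hK.isCompact.isBounded hK'.isCompact.isBounded)).1
      (le_antisymm ?_ Metric.hausdorffDist_nonneg)
  have h3 := h1.add h2
  rw [add_zero] at h3
  refine ge_of_tendsto' h3 fun n => ?_
  rw [Metric.hausdorffDist_comm (t := K)]
  have hg := (isSupportFun_maxScore_div (fun i : Fin n => X i ω) fun i : Fin n =>
    Y i ω).comp_linear (scoreCombination S T)
  rw [scoreSet_eq_supportBody]
  exact Metric.hausdorffDist_triangle (Metric.hausdorffEDist_ne_top_of_nonempty_of_bounded
    hK.nonempty hg.nonempty_supportBody hK.isCompact.isBounded hg.isCompact_supportBody.isBounded)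

lemma IsScoreRate.limitSet_eq {h : SymScoring A → ℝ} (hh : IsScoreRate P X Y h)
    (S T : SymScoring A) :
    limitSet P X Y S T = supportBody fun u => h (scoreCombination S T u) := by
  have h1 := hh.isLimitSet S T
  refine Subset.antisymm (sUnion_subset fun K hK => ?_) (subset_sUnion_of_mem h1)
  rw [IsLimitSet.unique hK h1]

end ScoreSets

/-! ### Random scoring functions -/

section RandomScores

variable {A : Type*} [Fintype A]

lemma IsSupportFun.measurableSet_secondDifference_ge {E : Type*} [NormedAddCommGroup E]
    [NormedSpace ℝ E] [MeasurableSpace E] [BorelSpace E] [SecondCountableTopology E] {h : E → ℝ}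
    (hh : IsSupportFun h) (k : ℝ) :
    MeasurableSet {z : Metric.sphere (0 : E) 1 × Metric.sphere (0 : E) 1 |
      ∃ n : ℕ, ∀ τ : ℝ, |τ| ≤ 1 / ((n : ℝ) + 1) → τ ^ 2 / k ≤
        h ((z.1 : E) + τ • (z.2 : E)) + h ((z.1 : E) + (-τ) • (z.2 : E)) - 2 * h z.1} := by
  have hc := hh.continuous
  rw [ofPred_exists]
  refine MeasurableSet.iUnion fun n => IsClosed.measurableSet ?_
  simp only [ofPred_forall]
  exact isClosed_iInter fun τ => isClosed_iInter fun _ =>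
    isClosed_le continuous_const (by fun_prop)

variable {Ω' : Type*} [MeasurableSpace Ω'] {Q : Measure Ω'} [IsProbabilityMeasure Q]
  {S T : Ω' → FrobeniusSphere A}

lemma nontrivial_symScoring_of_sphere (s : FrobeniusSphere A) : Nontrivial (SymScoring A) :=
  ⟨s.1, 0, fun h0 => by
    have h1 := mem_sphere_zero_iff_norm.1 s.2
    rw [h0, norm_zero] at h1
    exact zero_ne_one h1⟩

lemma frobeniusUniform_prod [Nontrivial (SymScoring A)] :
    (frobeniusUniform A).prod (frobeniusUniform A) =
      (((Measure.addHaar : Measure (SymScoring A)).toSphere.prod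
        (Measure.addHaar : Measure (SymScoring A)).toSphere) univ)⁻¹ •
        ((Measure.addHaar : Measure (SymScoring A)).toSphere.prod
          (Measure.addHaar : Measure (SymScoring A)).toSphere) := by
  have h0 : (Measure.addHaar : Measure (SymScoring A)).toSphere univ ≠ 0 := by
    rw [Measure.measure_univ_ne_zero]
    exact Measure.toSphere_ne_zero _
  rw [frobeniusUniform, Measure.prod_smul_left, Measure.prod_smul_right, smul_smul,
    ← univ_prod_univ, Measure.prod_prod, ENNReal.mul_inv (Or.inl h0) (Or.inr h0)]

lemma ae_exists_hasSubgradientDeriv (hS : HasLaw S (frobeniusUniform A) Q)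
    (hT : HasLaw T (frobeniusUniform A) Q) (hST : IndepFun S T Q) {h : SymScoring A → ℝ}
    (hh : IsSupportFun h) :
    ∀ᵐ ω ∂Q, ∃ ρ y₀, HasSubgradientDeriv
      (slopeSupport fun u => h (scoreCombination (S ω).1 (T ω).1 u)) ρ y₀ := by
  have hne := Q.nonempty_of_neZero
  have := nontrivial_symScoring_of_sphere (S hne.some)
  have h1 := IndepFun.hasLaw_prod hS hT hST
  have h2 := hh.ae_toSphere_exists_hasSubgradientDeriv Measure.addHaar
  simp only [slopeSupport_scoreCombination]
  refine ae_of_ae_map h1.aemeasurable (p := fun z => ∃ ρ y₀,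
    HasSubgradientDeriv (fun t : ℝ => h (z.1.1 + t • z.2.1)) ρ y₀) ?_
  rw [h1.map_eq, frobeniusUniform_prod]
  exact Measure.ae_smul_measure h2 _

lemma measure_secondDifference_ge_le (hS : HasLaw S (frobeniusUniform A) Q)
    (hT : HasLaw T (frobeniusUniform A) Q) (hST : IndepFun S T Q) {h : SymScoring A → ℝ}
    (hh : IsSupportFun h) {w : ℝ} (hw : ∀ R, h R + h (-R) ≤ w * ‖R‖) {k : ℝ} (hk : 0 < k) :
    Q {ω | ∃ δ > 0, ∀ τ : ℝ, |τ| < δ → τ ^ 2 / k ≤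
      h ((S ω).1 + τ • (T ω).1) + h ((S ω).1 + (-τ) • (T ω).1) - 2 * h (S ω).1} ≤
      ENNReal.ofReal (w / 2 * k) := by
  have hne := Q.nonempty_of_neZero
  have := nontrivial_symScoring_of_sphere (S hne.some)
  have h1 := IndepFun.hasLaw_prod hS hT hST
  have hm := hh.measurableSet_secondDifference_ge k
  set B := {z : FrobeniusSphere A × FrobeniusSphere A |
      ∃ n : ℕ, ∀ τ : ℝ, |τ| ≤ 1 / ((n : ℝ) + 1) → τ ^ 2 / k ≤
        h (z.1.1 + τ • z.2.1) + h (z.1.1 + (-τ) • z.2.1) - 2 * h z.1.1}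
  have hle := hh.toSphere_prod_le Measure.addHaar hw hk hm fun z ⟨n, hn⟩ =>
    ⟨1 / ((n : ℝ) + 1), by positivity, fun τ hτ => hn τ hτ.le⟩
  calc _ ≤ Q {ω | (S ω, T ω) ∈ B} := by
        refine measure_mono fun ω ⟨δ, hδ, hω⟩ => ?_
        obtain ⟨n, hn⟩ := exists_nat_one_div_lt hδ
        exact ⟨n, fun τ hτ => hω τ (hτ.trans_lt hn)⟩
    _ = ((frobeniusUniform A).prod (frobeniusUniform A)) B := h1.measure_eq hm
    _ ≤ _ := by
        rw [frobeniusUniform_prod, Measure.smul_apply, smul_eq_mul]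
        refine (mul_le_mul_right hle _).trans ?_
        rw [← mul_assoc, mul_comm _ (ENNReal.ofReal _), mul_assoc]
        exact mul_le_of_le_one_right' (ENNReal.inv_mul_le_one _)

end RandomScores

theorem theorem2 {A : Type*} [Fintype A] [MeasurableSpace A] [MeasurableSingletonClass A]
    -- the random letters: two independent sequences of i.i.d. letters, all with the same law
    {Ω : Type*} [MeasurableSpace Ω] (P : Measure Ω) [IsProbabilityMeasure P]
    (X Y : ℕ → Ω → A) (letterLaw : Measure A)
    (hX : ∀ i, HasLaw (X i) letterLaw P) (hY : ∀ i, HasLaw (Y i) letterLaw P)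
    (hXY : iIndepFun (Sum.elim X Y) P)
    -- the random scoring functions: i.i.d. and uniform on the Frobenius unit sphere
    {Ω' : Type*} [MeasurableSpace Ω'] (Q : Measure Ω') [IsProbabilityMeasure Q]
    (S T : Ω' → FrobeniusSphere A)
    (hS : HasLaw S (frobeniusUniform A) Q) (hT : HasLaw T (frobeniusUniform A) Q)
    (hST : IndepFun S T Q) :
    -- the maximisers over all the sets `SET^n`, and over `SET`, are almost surely unique
    (∀ᵐ ω ∂Q, ∀ (n : ℕ) (x y : Fin n → A),
      ∃! p, IsMaximiser (scoreSet (S ω).1 (T ω).1 x y) p) ∧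
    (∀ᵐ ω ∂Q, ∃! p, IsMaximiser (limitSet P X Y (S ω).1 (T ω).1) p) ∧
    -- the curvature at the maximiser almost surely exists, and its law satisfies the bound
    (∀ᵐ ω ∂Q, ∀ p, IsMaximiser (limitSet P X Y (S ω).1 (T ω).1) p →
      ∃ κ, HasCurvatureAt (limitSet P X Y (S ω).1 (T ω).1) p κ) ∧
    ∀ k : ℝ, 0 < k →
      Q {ω | ∃ p κ, IsMaximiser (limitSet P X Y (S ω).1 (T ω).1) p ∧
          HasCurvatureAt (limitSet P X Y (S ω).1 (T ω).1) p κ ∧ κ < ENNReal.ofReal k}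
        ≤ ENNReal.ofReal (4 * k / Real.pi) := by
  obtain ⟨h, hh⟩ := exists_isScoreRate hX hY hXY
  have hs := hh.isSupportFun
  have hg : ∀ ω, IsSupportFun fun u => h (scoreCombination (S ω).1 (T ω).1 u) :=
    fun ω => hs.comp_linear _
  simp only [hh.limitSet_eq]
  refine ⟨?_, ?_, ?_, fun k hk => ?_⟩
  · refine ae_all_iff.2 fun n => ae_all_iff.2 fun x => ae_all_iff.2 fun y => ?_
    have hm := isSupportFun_maxScore_div x y
    filter_upwards [ae_exists_hasSubgradientDeriv hS hT hST hm] with ω hω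
    obtain ⟨ρ, y₀, hω⟩ := hω
    rw [scoreSet_eq_supportBody]
    exact existsUnique_isMaximiser (hm.comp_linear (scoreCombination (S ω).1 (T ω).1)) hω
  · filter_upwards [ae_exists_hasSubgradientDeriv hS hT hST hs] with ω hω
    obtain ⟨ρ, y₀, hω⟩ := hω
    exact existsUnique_isMaximiser (hg ω) hω
  · filter_upwards [ae_exists_hasSubgradientDeriv hS hT hST hs] with ω hω p hp
    obtain ⟨ρ, y₀, hω⟩ := hω
    exact exists_hasCurvatureAt (hg ω) hω hp
  · refine le_trans (measure_mono ?_) ((measure_secondDifference_ge_le hS hT hST hs hh.width_le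
      hk).trans (ENNReal.ofReal_le_ofReal ?_))
    · rintro ω ⟨p, κ, hp, hκ, hκk⟩
      have h1 := eventually_secondDifference_ge (isClosed_supportBody _) hp hκ hk hκk
        (fun z hz => le_slopeSupport hz) (hp.slopeSupport_zero (hg ω))
      simp only [slopeSupport_scoreCombination, zero_smul, add_zero] at h1
      exact h1
    · -- `√6 / 2 < 5 / 4 < 4 / π`
      have h6 : √6 ≤ 5 / 2 := Real.sqrt_le_iff.2 ⟨by norm_num, by norm_num⟩
      have hpi : Real.pi ≤ 16 / 5 := Real.pi_lt_d2.le.trans (by norm_num)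
      rw [le_div_iff₀ Real.pi_pos]
      calc √6 / 2 * k * Real.pi ≤ 5 / 2 / 2 * k * (16 / 5) := by gcongr
        _ = 4 * k := by ring
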